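/- **Setting.** An *EER schema* $\mathcal C$ (without attributes) consists of finitely many entities and relationships. Each relationship $R$ is declared among entities $E_1,\dots,E_n$, $n\ge 2$. There may be is-a declarations between entities, is-a declarations $R \text{ isa } R'[j_1,\dots,j_n]$ between relationships of the same arity $n$ (with $(j_1,\dots,j_n)$ a permutation of $(1,\dots,n)$), and declarations that the entity at component $c$ of $R$ participates at least once, or at most once, in $R$ as $c$-th component. The associated relational schema $\mathcal R$ has a unary predicate $e$ per entity and an $n$-ary predicate $r$ per $n$-ary relationship. The set $\Sigma=\Sigma_I\cup\Sigma_K$ of *conceptual dependencies* (CDs) of $\mathcal C$ consists of the inclusion dependencies (IDs) $e[1]\subseteq e'[1]$ (entity is-a), $r[i]\subseteq e_i[1]$ (all $r$, $i$), $r[1,\dots,n]\subseteq r'[j_1,\dots,j_n]$ (relationship is-a), $e_c[1]\subseteq r[c]$ (mandatory participation), and of the key dependencies (KDs) $\mathrm{key}(r)=\{c\}$ (participation at most once). Values are non-fresh constants from an infinite set $\Gamma$ and fresh constants $\alpha_0,\alpha_1,\dots$. Let $q$ be a conjunctive query over $\mathcal R$ with constants in $\Gamma$, distinct head variables, and all head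 variables occurring in its body. For a finite database $D$ with constants in $\Gamma$, $\mathrm{ans}(q,\Sigma,D)$ is the set of tuples $t$ over $\Gamma$ such that $t\in q(B)$ for every (possibly infinite) database $B\supseteq D$ with values in $\Gamma\cup\{\alpha_0,\alpha_1,\dots\}$ that satisfies $\Sigma$. **Chase.** The chase of $D$ starts from $D$, all of whose facts have level $0$. While the KD rule is applicable (two distinct facts $r(t),r(t')$ agree on the key), it is applied to the pair with the least minimum level: at each non-key position in turn, the two values are replaced everywhere by a non-fresh constant if one of them is non-fresh, and by the earlier one if both are fresh. If they are distinct non-fresh constants, the construction *fails*. Merged facts keep the minimum level. Otherwise the ID rule is applied once: if $r[\bar X]\subseteq s[\bar Y]$ is violated by $r(t)$, a fact for $s$ is added that has $t[\bar X]$ in the positions $\bar Y$ and new fresh constants elsewhere, at the level of $r(t)$ plus one. Full-width IDs have priority, then facts of lowest level. Ties are broken by arbitrary fixed linear orders on facts, pairs of facts and dependencies. The chase *exists* if this (possibly infinite) construction never fails. **Program.** For every unary ID $\sigma$ and every position $j$ of its right-hand predicate, let $f_{\sigma,j}$ be a unary function symbol. An *annotation element* is a term $f_1(\cdots f_m(\bullet)\cdots)$,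 $m\ge 0$, over these symbols; $p^{\bar\eta}$ denotes a copy of the predicate $p$ annotated with one annotation element per argument. For $N\in\mathbb N$, the function-free program $\Pi^{\mathrm{fin}}_N(q,\Sigma)$ consists of the following rules. 1. *Dummy chase rules.* Chase, under $\Sigma_I$ alone, the database with one fact per predicate of $\mathcal R$, all its constants being distinct. Identify the fresh constant put in position $j$ by applying a unary ID $\sigma$ to the value represented by the term $\tau$ with $f_{\sigma,j}(\tau)$. For every application of the ID rule that creates an atom $A_2$ of level at most $N$ from an atom $A_1$, take the rule $A_2'\leftarrow A_1'$, where every argument $f_1(\cdots f_m(c)\cdots)$ is replaced by a variable for $c$ and $f_1(\cdots f_m(\bullet)\cdots)$ is made the corresponding element of the annotation of the predicate. 2. *Base annotation rules.* $p^{\bullet,\dots,\bullet}(X_1,\dots,X_n)\leftarrow p(X_1,\dots,X_n)$ for every $p$ in $\mathcal R\cup\{\mathrm{eq}\}$. 3. *Annotated rules.* All rules obtained from a rule among (a)–(c) below by annotating its predicates so that every annotation element is $\bullet$ or occurs in a dummy chase rule, equal terms receive equal annotation elements, and constants receive $\bullet$. (a) KD rules: $\mathrm{eq}(X_i,Y_i)\leftarrow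 r(\bar X),r(\bar Y),\mathrm{eq}(X_k,Y_k)$ for $\mathrm{key}(r)=\{k\}$ in $\Sigma_K$ and $i\ne k$. (b) Equality rules: $\mathrm{eq}(X_i,X_i)\leftarrow r(\bar X)$ for every predicate $r$ of $\mathcal R$ and every $i$; $\mathrm{eq}(Y,X)\leftarrow\mathrm{eq}(X,Y)$; $\mathrm{eq}(X,Z)\leftarrow\mathrm{eq}(X,Y),\mathrm{eq}(Y,Z)$. (c) The query $q_{\mathrm{eq}}$, obtained from $q$ by replacing every occurrence of a term $u$ in the body by a new variable $X$ and adding $\mathrm{eq}(X,u)$ to the body. **Theorem.** For every EER schema $\mathcal C$ as above, with set of CDs $\Sigma$, and every conjunctive query $q$ over $\mathcal R$, there is a function $\delta:\mathbb N\to\mathbb N$ (depending only on $\mathcal R$, $\Sigma$ and $q$) such that the following holds for every finite database $D$ over $\Gamma$ whose chase under $\Sigma$ exists. Let $k$ be the number of facts in the largest connected component of the graph on $D$ that joins two facts when they share a constant. Then for every $N\ge\delta(k)$, the set of tuples of the predicate $q_{\mathrm{eq}}^{\bullet,\dots,\bullet}$ in the least Herbrand model of $\Pi^{\mathrm{fin}}_N(q,\Sigma)\cup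 D$ is exactly $\mathrm{ans}(q,\Sigma,D)$. -/

import Mathlib

open Relation

noncomputable section

/-! ## Relational schemata, atoms, facts, dependencies -/

/-- A relational schema: predicate symbols with arities. -/
structure RelSchema where
  Pred : Type*
  arity : Pred → ℕ

/-- An atom `p(t₁,…,tₙ)` over the schema `S` with arguments in `T`.  A fact is an atom whose
arguments are constants, and a database is a set of facts. -/
structure Atom (S : RelSchema) (T : Type*) where
  pred : S.Pred
  args : Fin (S.arity pred) → T

/-- Apply a map to all the arguments of an atom. -/
def Atom.map {S : RelSchema} {T T' : Type*} (f : T → T') (A : Atom S T) : Atom S T' :=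
  ⟨A.pred, fun i => f (A.args i)⟩

/-- The values that may occur in a database: non-fresh constants (from the alphabet `K`, with the
unique name assumption) and fresh constants, which are numbered by their order. -/
inductive Val (K : Type*) where
  | dom (c : K) : Val K
  | fresh (n : ℕ) : Val K

/-- An inclusion dependency `lhs[X] ⊆ rhs[Y]`, with `X`, `Y` sequences of length `width`. -/
structure IncDep (S : RelSchema) where
  lhs : S.Pred
  rhs : S.Pred
  width : ℕ
  X : Fin width → Fin (S.arity lhs)
  Y : Fin width → Fin (S.arity rhs)

/-- Every attribute of either side occurs exactly once. -/
def IncDep.FullWidth {S : RelSchema} (σ : IncDep S) : Prop :=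
  Function.Bijective σ.X ∧ Function.Bijective σ.Y

def IncDep.Sat {S : RelSchema} {T : Type*} (σ : IncDep S) (B : Set (Atom S T)) : Prop :=
  ∀ t, (⟨σ.lhs, t⟩ : Atom S T) ∈ B →
    ∃ t', (⟨σ.rhs, t'⟩ : Atom S T) ∈ B ∧ ∀ i, t (σ.X i) = t' (σ.Y i)

/-- A key dependency `key(pred) = key`. -/
structure KeyDep (S : RelSchema) where
  pred : S.Pred
  key : Set (Fin (S.arity pred))

def KeyDep.Sat {S : RelSchema} {T : Type*} (κ : KeyDep S) (B : Set (Atom S T)) : Prop :=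
  ∀ t t', (⟨κ.pred, t⟩ : Atom S T) ∈ B → (⟨κ.pred, t'⟩ : Atom S T) ∈ B → t ≠ t' →
    ∃ i ∈ κ.key, t i ≠ t' i

/-! ## Conjunctive queries and certain answers -/

/-- Function-free terms: variables and constants. -/
inductive DTerm (V K : Type*) where
  | var (x : V) : DTerm V K
  | const (c : K) : DTerm V K

def DTerm.eval {V K : Type*} (θ : V → K) : DTerm V K → K
  | .var x => θ x
  | .const c => c

/-- A conjunctive query `q(X₁,…,Xₙ) ← body` with distinct head variables, all of which occur in
the body. -/
structure CQ (S : RelSchema) (V K : Type*) (n : ℕ) where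
  head : Fin n → V
  head_injective : Function.Injective head
  body : List (Atom S (DTerm V K))
  safe : ∀ i, ∃ A ∈ body, ∃ j, A.args j = DTerm.var (head i)

/-- The image of a query term under an assignment of values to the variables. -/
def DTerm.value {V K : Type*} (h : V → Val K) : DTerm V K → Val K
  | .var x => h x
  | .const c => .dom c

/-- The answers `q(B)` of a conjunctive query over a database with values in `Val K`. -/
def CQ.answers {S : RelSchema} {V K : Type*} {n : ℕ} (q : CQ S V K n)
    (B : Set (Atom S (Val K))) : Set (Fin n → Val K) :=
  {t | ∃ h : V → Val K, (∀ A ∈ q.body, A.map (DTerm.value h) ∈ B) ∧ t = fun i => h (q.head i)}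

/-- A database over non-fresh constants, as a database over all values. -/
def embedDB {S : RelSchema} {K : Type*} (D : Set (Atom S K)) : Set (Atom S (Val K)) :=
  Atom.map Val.dom '' D

/-- The certain answers `ans(q, Σ, D)`, with `Σ` given by its inclusion dependencies `I` and its
key dependencies `J`.  The models `B` may be infinite. -/
def certainAnswers {S : RelSchema} {V K : Type*} {n : ℕ} (I : Set (IncDep S)) (J : Set (KeyDep S))
    (q : CQ S V K n) (D : Set (Atom S K)) : Set (Fin n → K) :=
  {t | ∀ B : Set (Atom S (Val K)), (∀ σ ∈ I, σ.Sat B) → (∀ κ ∈ J, κ.Sat B) → embedDB D ⊆ B →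
    (fun i => Val.dom (t i)) ∈ q.answers B}

/-! ## EER schemata and conceptual dependencies -/

/-- An EER schema (without attributes) with entity symbols `Ent` and relationship symbols `Rel`. -/
structure EERSchema (Ent Rel : Type*) where
  /-- `E' ∈ isaEnt E`: the definition of `E` has the clause `isa: E'`. -/
  isaEnt : Ent → Set Ent
  arity : Rel → ℕ
  two_le_arity : ∀ R, 2 ≤ arity R
  /-- `among R i` is the entity of the `i`-th component of `R`. -/
  among : (R : Rel) → Fin (arity R) → Ent
  /-- `j ∈ isaRel R R'`: the definition of `R` has the clause `isa: R'[j₁,…,jₙ]`. -/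
  isaRel : (R R' : Rel) → Set (Fin (arity R) ≃ Fin (arity R'))
  /-- `c ∈ mandatory R`: the entity `among R c` has the clause `participates(≥ 1): R : c`. -/
  mandatory : (R : Rel) → Set (Fin (arity R))
  /-- `c ∈ functional R`: the entity `among R c` has the clause `participates(≤ 1): R : c`. -/
  functional : (R : Rel) → Set (Fin (arity R))

/-- The associated relational schema: a unary predicate per entity and an `n`-ary predicate per
`n`-ary relationship. -/
def EERSchema.schema {Ent Rel : Type*} (C : EERSchema Ent Rel) : RelSchema where
  Pred := Ent ⊕ Rel
  arity := Sum.elim (fun _ => 1) C.arity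

/-- The inclusion dependencies among the conceptual dependencies of `C`. -/
inductive EERSchema.IsID {Ent Rel : Type*} (C : EERSchema Ent Rel) : IncDep C.schema → Prop where
  /-- `e[1] ⊆ e'[1]` -/
  | isaEnt (E E' : Ent) : E' ∈ C.isaEnt E →
      C.IsID ⟨Sum.inl E, Sum.inl E', 1, fun _ => (0 : Fin 1), fun _ => (0 : Fin 1)⟩
  /-- `r[i] ⊆ eᵢ[1]` -/
  | component (R : Rel) (i : Fin (C.arity R)) :
      C.IsID ⟨Sum.inr R, Sum.inl (C.among R i), 1, fun _ => i, fun _ => (0 : Fin 1)⟩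
  /-- `r[1,…,n] ⊆ r'[j₁,…,jₙ]` -/
  | isaRel (R R' : Rel) (j : Fin (C.arity R) ≃ Fin (C.arity R')) : j ∈ C.isaRel R R' →
      C.IsID ⟨Sum.inr R, Sum.inr R', C.arity R, fun i => i, fun i => j i⟩
  /-- `e[1] ⊆ r[c]` -/
  | mandatory (R : Rel) (c : Fin (C.arity R)) : c ∈ C.mandatory R →
      C.IsID ⟨Sum.inl (C.among R c), Sum.inr R, 1, fun _ => (0 : Fin 1), fun _ => c⟩

/-- The key dependencies among the conceptual dependencies of `C`. -/
inductive EERSchema.IsKD {Ent Rel : Type*} (C : EERSchema Ent Rel) : KeyDep C.schema → Prop where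
  /-- `key(r) = {c}` -/
  | functional (R : Rel) (c : Fin (C.arity R)) : c ∈ C.functional R →
      C.IsKD ⟨Sum.inr R, ({c} : Set (Fin (C.arity R)))⟩

def EERSchema.ids {Ent Rel : Type*} (C : EERSchema Ent Rel) : Set (IncDep C.schema) :=
  {σ | C.IsID σ}

def EERSchema.kds {Ent Rel : Type*} (C : EERSchema Ent Rel) : Set (KeyDep C.schema) :=
  {κ | C.IsKD κ}

/-! ## The chase -/

/-- The orders that break ties in the construction of the chase (for instance, the lexicographic
orders of some encoding by strings). -/
structure ChaseOrder (S : RelSchema) (K : Type*) where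
  fact : LinearOrder (Atom S (Val K))
  pair : LinearOrder (Atom S (Val K) × Atom S (Val K))
  kd : LinearOrder (KeyDep S)
  id : LinearOrder (IncDep S)

/-- A stage of the chase: the facts, their levels (the level of a non-fact is irrelevant), and the
first fresh constant that follows all the fresh constants used so far. -/
structure ChaseState (S : RelSchema) (K : Type*) where
  facts : Set (Atom S (Val K))
  level : Atom S (Val K) → ℕ
  next : ℕ

def ChaseState.init {S : RelSchema} {K : Type*} (D : Set (Atom S K)) : ChaseState S K :=
  ⟨embedDB D, fun _ => 0, 0⟩

open Classical in
/-- The combined symbol of two values; `none` when they are distinct non-fresh constants. -/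
def Val.combine {K : Type*} : Val K → Val K → Option (Val K)
  | .dom c, .dom d => if c = d then some (.dom c) else none
  | .dom c, .fresh _ => some (.dom c)
  | .fresh _, .dom d => some (.dom d)
  | .fresh m, .fresh n => some (.fresh (min m n))

open Classical in
/-- Replace both `a` and `b` by `z`. -/
def Val.replace {K : Type*} (a b z : Val K) (x : Val K) : Val K :=
  if x = a ∨ x = b then z else x

/-- Merge `t` and `t'` at the listed positions, one after the other; the result is the replacement
to be carried out in all the facts, or `none` when the merging fails. -/
def unify {K : Type*} {m : ℕ} : List (Fin m) → (Fin m → Val K) → (Fin m → Val K) →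
    Option (Val K → Val K)
  | [], _, _ => some id
  | i :: l, t, t' =>
    match Val.combine (t i) (t' i) with
    | none => none
    | some z =>
      let ρ := Val.replace (t i) (t' i) z
      (unify l (fun j => ρ (t j)) (fun j => ρ (t' j))).map fun θ => θ ∘ ρ

section Chase

variable {S : RelSchema} {K : Type*} (ord : ChaseOrder S K) (I : Set (IncDep S))
  (J : Set (KeyDep S)) (st : ChaseState S K)

/-- The key dependency chase rule for `κ` is applicable on the tuples `t`, `t'`. -/
def KDApplicable (κ : KeyDep S) (t t' : Fin (S.arity κ.pred) → Val K) : Prop :=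
  κ ∈ J ∧ (⟨κ.pred, t⟩ : Atom S (Val K)) ∈ st.facts ∧ (⟨κ.pred, t'⟩ : Atom S (Val K)) ∈ st.facts ∧
    t ≠ t' ∧ ∀ i ∈ κ.key, t i = t' i

/-- The rule application that the chase has to perform next, among those of the key dependency
chase rule: least `min (level t) (level t')`, then first pair, then first dependency. -/
def KDSelected (κ : KeyDep S) (t t' : Fin (S.arity κ.pred) → Val K) : Prop :=
  KDApplicable J st κ t t' ∧
  ∀ κ' s s', KDApplicable J st κ' s s' →
    min (st.level ⟨κ.pred, t⟩) (st.level ⟨κ.pred, t'⟩) ≤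
      min (st.level ⟨κ'.pred, s⟩) (st.level ⟨κ'.pred, s'⟩) ∧
    (min (st.level ⟨κ.pred, t⟩) (st.level ⟨κ.pred, t'⟩) =
        min (st.level ⟨κ'.pred, s⟩) (st.level ⟨κ'.pred, s'⟩) →
      ord.pair.le (⟨κ.pred, t⟩, ⟨κ.pred, t'⟩) (⟨κ'.pred, s⟩, ⟨κ'.pred, s'⟩) ∧
      (((⟨κ.pred, t⟩, ⟨κ.pred, t'⟩) : Atom S (Val K) × Atom S (Val K)) =
          (⟨κ'.pred, s⟩, ⟨κ'.pred, s'⟩) →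
        ord.kd.le κ κ'))

open Classical in
/-- The result of the key dependency chase rule; `none` when the rule fails.  A fact that results
from several facts gets the least of their levels. -/
def kdApply (κ : KeyDep S) (t t' : Fin (S.arity κ.pred) → Val K) : Option (ChaseState S K) :=
  (unify ((List.finRange (S.arity κ.pred)).filter fun i => i ∉ κ.key) t t').map fun θ =>
    { facts := Atom.map θ '' st.facts
      level := fun A => sInf (st.level '' {A' | A' ∈ st.facts ∧ A'.map θ = A})
      next := st.next }

/-- The inclusion dependency chase rule for `σ` is applicable on the tuple `t`. -/
def IDApplicable (σ : IncDep S) (t : Fin (S.arity σ.lhs) → Val K) : Prop :=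
  σ ∈ I ∧ (⟨σ.lhs, t⟩ : Atom S (Val K)) ∈ st.facts ∧
    ¬ ∃ t', (⟨σ.rhs, t'⟩ : Atom S (Val K)) ∈ st.facts ∧ ∀ i, t' (σ.Y i) = t (σ.X i)

/-- Applicable, and full-width if some full-width inclusion dependency is applicable. -/
def IDCandidate (σ : IncDep S) (t : Fin (S.arity σ.lhs) → Val K) : Prop :=
  IDApplicable I st σ t ∧ ((∃ σ' t', IDApplicable I st σ' t' ∧ σ'.FullWidth) → σ.FullWidth)

/-- The rule application that the chase has to perform next, among those of the inclusion
dependency chase rule: least level, then first fact, then first dependency. -/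
def IDSelected (σ : IncDep S) (t : Fin (S.arity σ.lhs) → Val K) : Prop :=
  IDCandidate I st σ t ∧
  ∀ σ' s, IDCandidate I st σ' s →
    st.level ⟨σ.lhs, t⟩ ≤ st.level ⟨σ'.lhs, s⟩ ∧
    (st.level ⟨σ.lhs, t⟩ = st.level ⟨σ'.lhs, s⟩ →
      ord.fact.le ⟨σ.lhs, t⟩ ⟨σ'.lhs, s⟩ ∧
      ((⟨σ.lhs, t⟩ : Atom S (Val K)) = ⟨σ'.lhs, s⟩ → ord.id.le σ σ'))

open Classical in
/-- The tuple added by the inclusion dependency chase rule. -/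
def newTuple (σ : IncDep S) (t : Fin (S.arity σ.lhs) → Val K) (j : Fin (S.arity σ.rhs)) : Val K :=
  if h : ∃ i, σ.Y i = j then t (σ.X h.choose) else .fresh (st.next + j)

open Classical in
/-- The result of the inclusion dependency chase rule. -/
def idApply (σ : IncDep S) (t : Fin (S.arity σ.lhs) → Val K) : ChaseState S K where
  facts := insert ⟨σ.rhs, newTuple st σ t⟩ st.facts
  level := Function.update st.level ⟨σ.rhs, newTuple st σ t⟩ (st.level ⟨σ.lhs, t⟩ + 1)
  next := st.next + S.arity σ.rhs

/-- One step of the chase: key dependencies come first. -/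
inductive ChaseStep : ChaseState S K → ChaseState S K → Prop where
  | kd (st st' : ChaseState S K) (κ : KeyDep S) (t t' : Fin (S.arity κ.pred) → Val K) :
      KDSelected ord J st κ t t' → kdApply st κ t t' = some st' → ChaseStep st st'
  | id (st : ChaseState S K) (σ : IncDep S) (t : Fin (S.arity σ.lhs) → Val K) :
      (∀ κ s s', ¬ KDApplicable J st κ s s') → IDSelected ord I st σ t →
        ChaseStep st (idApply st σ t)

/-- The chase of `D` exists: its construction, which may go on forever, never fails. -/
def ChaseExists (D : Set (Atom S K)) : Prop :=
  ∀ st, ReflTransGen (ChaseStep ord I J) (ChaseState.init D) st →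
    ∀ κ t t', KDSelected ord J st κ t t' → kdApply st κ t t' ≠ none

end Chase

/-! ## The join graph -/

/-- The facts of `D`, joined when they share a constant. -/
def joinGraph {S : RelSchema} {K : Type*} (D : Set (Atom S K)) : SimpleGraph D where
  Adj A B := A ≠ B ∧ ∃ i j, A.1.args i = B.1.args j
  symm := ⟨fun _ _ ⟨hne, i, j, h⟩ => ⟨hne.symm, j, i, h.symm⟩⟩
  loopless := ⟨fun _ h => h.1 rfl⟩

/-- The number of facts in the largest connected part of the join graph of a finite `D`. -/
def largestConnectedSize {S : RelSchema} {K : Type*} (D : Set (Atom S K)) : ℕ :=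
  ⨆ c : (joinGraph D).ConnectedComponent, c.supp.ncard

/-! ## Datalog programs -/

/-- A function-free rule `head ← body`. -/
structure Rule (S : RelSchema) (V K : Type*) where
  head : Atom S (DTerm V K)
  body : List (Atom S (DTerm V K))

/-- The least Herbrand model of the program `P ∪ D`. -/
inductive LeastModel {S : RelSchema} {V K : Type*} (P : Set (Rule S V K)) (D : Set (Atom S K)) :
    Atom S K → Prop where
  | fact (A : Atom S K) : A ∈ D → LeastModel P D A
  | rule (ρ : Rule S V K) (θ : V → K) : ρ ∈ P →
      (∀ A ∈ ρ.body, LeastModel P D (A.map (DTerm.eval θ))) →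
      LeastModel P D (ρ.head.map (DTerm.eval θ))

/-! ## Skolem terms, annotations and annotated predicates -/

/-- Terms `f₁(f₂(…f_m(c)…))`, where every `fᵢ` is one of the unary Skolem functions `f_{σ,j}`, for
a dependency `σ` and an attribute `j` of its right-hand side. -/
inductive SkTerm (S : RelSchema) (K : Type*) where
  | base (c : K) : SkTerm S K
  | fn (σ : IncDep S) (j : Fin (S.arity σ.rhs)) (τ : SkTerm S K) : SkTerm S K

/-- Annotation elements `f₁(f₂(…f_m(•)…))`. -/
abbrev Ann (S : RelSchema) := SkTerm S Unit

/-- The annotation element `•`. -/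
def Ann.bullet {S : RelSchema} : Ann S := .base ()

/-- The annotation element of a term. -/
def SkTerm.ann {S : RelSchema} {K : Type*} : SkTerm S K → Ann S
  | .base _ => Ann.bullet
  | .fn σ j τ => .fn σ j τ.ann

/-- The innermost constant of a term. -/
def SkTerm.root {S : RelSchema} {K : Type*} : SkTerm S K → K
  | .base c => c
  | .fn _ _ τ => τ.root

/-- The predicates of `S`, the equality predicate, and the `n`-ary query predicate. -/
inductive BasePred (S : RelSchema) where
  | rel (p : S.Pred) : BasePred S
  | eq : BasePred S
  | query : BasePred S

def baseSchema (S : RelSchema) (n : ℕ) : RelSchema where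
  Pred := BasePred S
  arity
    | .rel p => S.arity p
    | .eq => 2
    | .query => n

/-- A predicate, either as it is or annotated. -/
inductive AnnPred (S : RelSchema) (n : ℕ) where
  | plain (b : BasePred S) : AnnPred S n
  | ann (b : BasePred S) (η : Fin ((baseSchema S n).arity b) → Ann S) : AnnPred S n

def annSchema (S : RelSchema) (n : ℕ) : RelSchema where
  Pred := AnnPred S n
  arity
    | .plain b => (baseSchema S n).arity b
    | .ann b _ => (baseSchema S n).arity b

/-- The constants of the dummy database: one for every attribute of every predicate. -/
abbrev DummyConst (S : RelSchema) := Σ p : S.Pred, Fin (S.arity p)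

/-- The variables of the rewriting: the variables of the query, new variables, and a variable for
every constant of the dummy database. -/
inductive RVar (S : RelSchema) (V : Type*) where
  | orig (x : V) : RVar S V
  | new (k i : ℕ) : RVar S V
  | dummy (c : DummyConst S) : RVar S V

section Rewriting

variable {S : RelSchema} {V K : Type*} {n : ℕ}

def relAtom {T : Type*} (n : ℕ) (p : S.Pred) (t : Fin (S.arity p) → T) : Atom (baseSchema S n) T :=
  ⟨BasePred.rel p, t⟩

def eqAtom {T : Type*} (S : RelSchema) (n : ℕ) (a b : T) : Atom (baseSchema S n) T :=
  ⟨BasePred.eq, (![a, b] : Fin 2 → T)⟩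

def queryAtom {T : Type*} (S : RelSchema) (t : Fin n → T) : Atom (baseSchema S n) T :=
  ⟨BasePred.query, t⟩

/-- The variables `X_{k,1}, X_{k,2}, …` -/
def nv (S : RelSchema) (V K : Type*) (k i : ℕ) : DTerm (RVar S V) K := .var (.new k i)

/-- Reflexivity, symmetry and transitivity of the equality predicate. -/
inductive IsEqRule : Rule (baseSchema S n) (RVar S V) K → Prop where
  | refl (p : S.Pred) (i : Fin (S.arity p)) :
      IsEqRule ⟨eqAtom S n (nv S V K 0 i) (nv S V K 0 i), [relAtom n p fun j => nv S V K 0 j]⟩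
  | symm : IsEqRule ⟨eqAtom S n (nv S V K 0 1) (nv S V K 0 0),
      [eqAtom S n (nv S V K 0 0) (nv S V K 0 1)]⟩
  | trans : IsEqRule ⟨eqAtom S n (nv S V K 0 0) (nv S V K 0 2),
      [eqAtom S n (nv S V K 0 0) (nv S V K 0 1), eqAtom S n (nv S V K 0 1) (nv S V K 0 2)]⟩

/-- For a unary key `key(r) = {k}` and `i ≠ k`, the rule
`eq(Xᵢ,Yᵢ) ← r(X₁,…,X_m), r(Y₁,…,Y_m), eq(X_k,Y_k)`. -/
inductive IsKDRule (J : Set (KeyDep S)) : Rule (baseSchema S n) (RVar S V) K → Prop where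
  | mk (κ : KeyDep S) (k i : Fin (S.arity κ.pred)) : κ ∈ J → κ.key = {k} → i ≠ k →
      IsKDRule J ⟨eqAtom S n (nv S V K 0 i) (nv S V K 1 i),
        [relAtom n κ.pred fun j => nv S V K 0 j, relAtom n κ.pred fun j => nv S V K 1 j,
          eqAtom S n (nv S V K 0 k) (nv S V K 1 k)]⟩

/-- A query term, in the variables of the rewriting. -/
def DTerm.orig : DTerm V K → DTerm (RVar S V) K
  | .var x => .var (.orig x)
  | .const c => .const c

/-- The query after the equality maquillage: the `i`-th term `u` of the `a`-th body atom is
replaced by a new variable `X`, and `eq(X,u)` is added to the body. -/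
def CQ.maquillage (q : CQ S V K n) : Rule (baseSchema S n) (RVar S V) K where
  head := queryAtom S fun i => .var (.orig (q.head i))
  body := q.body.zipIdx.flatMap fun Aa =>
    (relAtom n Aa.1.pred fun i => nv S V K Aa.2 i) ::
      (List.finRange (S.arity Aa.1.pred)).map fun i : Fin (S.arity Aa.1.pred) =>
        eqAtom S n (nv S V K Aa.2 i) (DTerm.orig (Aa.1.args i))

/-- The dummy database: one fact per predicate, all the constants being distinct. -/
def dummyDB (S : RelSchema) : Set (Atom S (DummyConst S)) :=
  Set.range fun p => ⟨p, fun i => ⟨p, i⟩⟩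

/-- In the chase of the dummy database under the inclusion dependencies alone, the inclusion
dependency chase rule for `σ` is applied on the tuple `t` at stage `st`. -/
def DummyApplied (ord : ChaseOrder S (DummyConst S)) (I : Set (IncDep S))
    (st : ChaseState S (DummyConst S)) (σ : IncDep S)
    (t : Fin (S.arity σ.lhs) → Val (DummyConst S)) : Prop :=
  ReflTransGen (ChaseStep ord I ∅) (ChaseState.init (dummyDB S)) st ∧ IDSelected ord I st σ t

/-- The Skolem term that corresponds to a value of the chase of the dummy database.  A fresh
constant put in position `j` by a unary `σ` applied on a tuple whose `X`-value corresponds to `τ`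
corresponds to `f_{σ,j}(τ)`.  (The conceptual dependencies that are not unary are full-width and
create no fresh constants.) -/
inductive SkolemOf (ord : ChaseOrder S (DummyConst S)) (I : Set (IncDep S)) :
    Val (DummyConst S) → SkTerm S (DummyConst S) → Prop where
  | base (c : DummyConst S) : SkolemOf ord I (.dom c) (.base c)
  | fn (st : ChaseState S (DummyConst S)) (σ : IncDep S)
      (t : Fin (S.arity σ.lhs) → Val (DummyConst S)) (i : Fin σ.width)
      (j : Fin (S.arity σ.rhs)) (τ : SkTerm S (DummyConst S)) :
      DummyApplied ord I st σ t → σ.width = 1 → (∀ i', σ.Y i' ≠ j) →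
      SkolemOf ord I (t (σ.X i)) τ → SkolemOf ord I (newTuple st σ t j) (.fn σ j τ)

/-- The annotated version of an atom `p(a₁,…,a_m)` of the dummy chase in Skolem terms, with the
constants replaced by variables. -/
def annotatedVersion (V K : Type*) (n : ℕ) (p : S.Pred)
    (a : Fin (S.arity p) → SkTerm S (DummyConst S)) : Atom (annSchema S n) (DTerm (RVar S V) K) :=
  ⟨AnnPred.ann (BasePred.rel p) fun i => (a i).ann, fun i => .var (.dummy (a i).root)⟩

/-- The dummy chase rules, obtained from the arcs of the first `N` levels of the chase of the dummy
database under the inclusion dependencies. -/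
inductive IsDummyRule (ord : ChaseOrder S (DummyConst S)) (I : Set (IncDep S)) (N : ℕ) :
    Rule (annSchema S n) (RVar S V) K → Prop where
  | mk (st : ChaseState S (DummyConst S)) (σ : IncDep S)
      (t : Fin (S.arity σ.lhs) → Val (DummyConst S))
      (a₁ : Fin (S.arity σ.lhs) → SkTerm S (DummyConst S))
      (a₂ : Fin (S.arity σ.rhs) → SkTerm S (DummyConst S)) :
      DummyApplied ord I st σ t → st.level ⟨σ.lhs, t⟩ + 1 ≤ N →
      (∀ i, SkolemOf ord I (t i) (a₁ i)) → (∀ j, SkolemOf ord I (newTuple st σ t j) (a₂ j)) →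
      IsDummyRule ord I N ⟨annotatedVersion V K n σ.rhs a₂, [annotatedVersion V K n σ.lhs a₁]⟩

/-- The annotation of an annotated atom has the element `η`. -/
def Atom.HasAnn {T : Type*} (A : Atom (annSchema S n) T) (η : Ann S) : Prop :=
  ∃ b ηs, A.pred = AnnPred.ann b ηs ∧ ∃ i, ηs i = η

/-- The annotation elements available for the rewriting: `•`, and those that occur in the dummy
chase rules. -/
def AnnAvailable (V K : Type*) (n : ℕ) (ord : ChaseOrder S (DummyConst S)) (I : Set (IncDep S))
    (N : ℕ) (η : Ann S) : Prop :=
  η = Ann.bullet ∨ ∃ ρ : Rule (annSchema S n) (RVar S V) K, IsDummyRule ord I N ρ ∧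
    (ρ.head.HasAnn η ∨ ∃ A ∈ ρ.body, A.HasAnn η)

/-- The annotation of a term, given the annotations of the variables; constants get `•`. -/
def DTerm.annBy {W : Type*} (α : W → Ann S) : DTerm W K → Ann S
  | .var x => α x
  | .const _ => Ann.bullet

/-- Annotate an atom, so that equal terms are annotated equally. -/
def Atom.annotate {W : Type*} (α : W → Ann S) (A : Atom (baseSchema S n) (DTerm W K)) :
    Atom (annSchema S n) (DTerm W K) :=
  ⟨AnnPred.ann A.pred fun i => (A.args i).annBy α, A.args⟩

def Rule.annotate {W : Type*} (α : W → Ann S) (ρ : Rule (baseSchema S n) W K) :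
    Rule (annSchema S n) W K :=
  ⟨ρ.head.annotate α, ρ.body.map (Atom.annotate α)⟩

/-- The base annotation rules `b^{•,…,•}(X₁,…,X_m) ← b(X₁,…,X_m)`, for `b` a predicate of `S` or
the equality predicate. -/
inductive IsBaseRule : Rule (annSchema S n) (RVar S V) K → Prop where
  | mk (b : BasePred S) : b ≠ BasePred.query →
      IsBaseRule ⟨⟨AnnPred.ann b fun _ => Ann.bullet, fun i => nv S V K 0 i⟩,
        [⟨AnnPred.plain b, fun i => nv S V K 0 i⟩]⟩

/-- The function-free rewriting of `q`, with the dummy chase cut at level `N`. -/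
def finProgram (ord : ChaseOrder S (DummyConst S)) (I : Set (IncDep S)) (J : Set (KeyDep S))
    (q : CQ S V K n) (N : ℕ) : Set (Rule (annSchema S n) (RVar S V) K) :=
  {ρ | IsDummyRule ord I N ρ} ∪ {ρ | IsBaseRule ρ} ∪
  {ρ | ∃ (ρ₀ : Rule (baseSchema S n) (RVar S V) K) (α : RVar S V → Ann S),
    (IsKDRule J ρ₀ ∨ IsEqRule ρ₀ ∨ ρ₀ = q.maquillage) ∧
    (∀ x, AnnAvailable V K n ord I N (α x)) ∧
    ρ = ρ₀.annotate α}

/-- A database, as a set of facts over the unannotated predicates. -/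
def plainFacts (n : ℕ) (D : Set (Atom S K)) : Set (Atom (annSchema S n) K) :=
  (fun A : Atom S K =>
    (⟨AnnPred.plain (BasePred.rel A.pred), A.args⟩ : Atom (annSchema S n) K)) '' D

/-- The evaluation over `D` of a program with query predicate `q_eq^{•,…,•}`. -/
def evalProgram {W : Type*} (P : Set (Rule (annSchema S n) W K)) (D : Set (Atom S K)) :
    Set (Fin n → K) :=
  {t | LeastModel P (plainFacts n D) ⟨AnnPred.ann BasePred.query fun _ => Ann.bullet, t⟩}

end Rewriting

end

/-! Soundness: in a model of the dependencies, read `f_{σ,j}` as a function that chooses witnesses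
for the inclusion dependency `σ`. Then an annotated fact asserts that the values of its terms form
a fact of the model, and every rule of the program preserves this.

Completeness for one database: a certain answer is already a match of the query in a finite stage
of the chase of `D`. Step by step, the stages map into the instances over `D` of facts of the dummy
chase, up to derived equality. Because full-width dependencies and facts of low level come first in
the dummy chase, the witness that a chase step asks for appears there a bounded number of levels
above the given fact, so every stage is reached within finitely many levels.

Uniformity: label the components of `D` and form the product of one model per label set. It shows
that a certain answer needs at most as many components as the query has atoms. Up to a permutation
of the constants that fixes those of `q`, only finitely many such databases and answers remain for
each `k`, and `δ k` is a bound that serves all of them. -/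

/-! ## Merging values -/

section Merging

variable {K : Type*} {a b z v w : Val K}

/-- The position of a value in the order of preference of the key dependency chase rule: merging
two values yields the one of smaller rank. -/
def Val.rank : Val K → ℕ
  | .dom _ => 0
  | .fresh k => k + 1

theorem Val.combine_comm (a b : Val K) : a.combine b = b.combine a := by
  cases a <;> cases b <;> simp only [Val.combine, min_comm]
  split_ifs with h h' h' <;> simp_all

theorem Val.eq_left_or_rank_lt_of_combine_eq_some (h : a.combine b = some z) :
    z = a ∨ z.rank < a.rank := by
  cases a <;> cases b <;> simp only [Val.combine, Option.ite_none_right_eq_some,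
    Option.some.injEq] at h
  case dom.dom => exact .inl h.2.symm
  all_goals subst h; simp only [Val.rank, Val.fresh.injEq]; grind

theorem Val.eq_right_or_rank_lt_of_combine_eq_some (h : a.combine b = some z) :
    z = b ∨ z.rank < b.rank :=
  Val.eq_left_or_rank_lt_of_combine_eq_some (Val.combine_comm a b ▸ h)

theorem Val.eq_or_eq_of_combine_eq_some (h : a.combine b = some z) : z = a ∨ z = b := by
  rcases Val.eq_left_or_rank_lt_of_combine_eq_some h with ha | ha
  · exact .inl ha
  · cases a <;> cases b <;> simp only [Val.combine, Option.ite_none_right_eq_some,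
      Option.some.injEq] at h <;> grind [Val.rank]

theorem Val.exists_dom_of_combine_eq_none (h : a.combine b = none) :
    ∃ c d, c ≠ d ∧ a = .dom c ∧ b = .dom d := by
  cases a <;> cases b <;> simp only [Val.combine, reduceCtorEq, ite_eq_right_iff, imp_false] at h
  exact ⟨_, _, h, rfl, rfl⟩

theorem Val.replace_eq_or_rank_lt (h : a.combine b = some z) (v : Val K) :
    Val.replace a b z v = v ∨ (Val.replace a b z v).rank < v.rank := by
  unfold Val.replace
  split_ifs with hv
  · rcases hv with rfl | rfl
    exacts [Val.eq_left_or_rank_lt_of_combine_eq_some h,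
      Val.eq_right_or_rank_lt_of_combine_eq_some h]
  · exact .inl rfl

theorem Val.rel_replace (E : Setoid (Val K)) (hab : E a b) (h : a.combine b = some z)
    (v : Val K) : E v (Val.replace a b z v) := by
  unfold Val.replace
  split_ifs with hv
  · rcases hv with rfl | rfl <;> rcases Val.eq_or_eq_of_combine_eq_some h with rfl | rfl
    exacts [E.refl _, hab, E.symm hab, E.refl _]
  · exact E.refl v

variable {m : ℕ} {i : Fin m} {l : List (Fin m)} {t t' : Fin m → Val K} {θ : Val K → Val K}

theorem unify_cons_eq_some (h : unify (i :: l) t t' = some θ) :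
    ∃ z θ', (t i).combine (t' i) = some z ∧
      unify l (fun j => Val.replace (t i) (t' i) z (t j))
        (fun j => Val.replace (t i) (t' i) z (t' j)) = some θ' ∧
      θ = θ' ∘ Val.replace (t i) (t' i) z := by
  simp only [unify] at h
  split at h
  · cases h
  case h_2 z hz =>
    obtain ⟨θ', hθ', rfl⟩ := Option.map_eq_some_iff.1 h
    exact ⟨z, θ', hz, hθ', rfl⟩

theorem unify_eq_or_rank_lt (h : unify l t t' = some θ) (v : Val K) :
    θ v = v ∨ (θ v).rank < v.rank := by
  induction l generalizing t t' θ v with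
  | nil => cases h; exact .inl rfl
  | cons i l ih =>
    obtain ⟨z, θ', hz, hθ', rfl⟩ := unify_cons_eq_some h
    have hρ := Val.replace_eq_or_rank_lt hz v
    have := ih hθ' (Val.replace (t i) (t' i) z v)
    simp only [Function.comp_apply]
    grind

theorem unify_apply_eq_apply (h : unify l t t' = some θ) (hi : i ∈ l) : θ (t i) = θ (t' i) := by
  induction l generalizing t t' θ with
  | nil => simp at hi
  | cons k l ih =>
    obtain ⟨z, θ', hz, hθ', rfl⟩ := unify_cons_eq_some h
    rcases List.mem_cons.1 hi with rfl | hi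
    · simp [Val.replace]
    · exact ih (t := fun j => Val.replace (t k) (t' k) z (t j)) hθ' hi

theorem rel_unify (E : Setoid (Val K)) (h : unify l t t' = some θ) (hE : ∀ i, E (t i) (t' i))
    (v : Val K) : E v (θ v) := by
  induction l generalizing t t' θ v with
  | nil => cases h; exact E.refl v
  | cons i l ih =>
    obtain ⟨z, θ', hz, hθ', rfl⟩ := unify_cons_eq_some h
    have hρ := Val.rel_replace E (hE i) hz
    have hE' (j) : E (Val.replace (t i) (t' i) z (t j)) (Val.replace (t i) (t' i) z (t' j)) :=
      E.trans (E.symm (hρ _)) (E.trans (hE j) (hρ _))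
    exact E.trans (hρ v) (ih hθ' hE' _)

theorem exists_rel_dom_of_unify_eq_none (E : Setoid (Val K)) (h : unify l t t' = none)
    (hE : ∀ i, E (t i) (t' i)) : ∃ c d, c ≠ d ∧ E (.dom c) (.dom d) := by
  induction l generalizing t t' with
  | nil => cases h
  | cons i l ih =>
    simp only [unify] at h
    split at h
    case h_1 hz =>
      obtain ⟨c, d, hcd, hc, hd⟩ := Val.exists_dom_of_combine_eq_none hz
      exact ⟨c, d, hcd, hc ▸ hd ▸ hE i⟩
    case h_2 z hz =>
      have hρ := Val.rel_replace E (hE i) hz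
      exact ih (Option.map_eq_none_iff.1 h) fun j =>
        E.trans (E.symm (hρ _)) (E.trans (hE j) (hρ _))

end Merging

/-! ## Atoms -/

section Atoms

variable {S : RelSchema} {T T' T'' : Type*}

theorem Atom.map_congr {f g : T → T'} {A : Atom S T} (h : ∀ i, f (A.args i) = g (A.args i)) :
    A.map f = A.map g :=
  congrArg (Atom.mk A.pred) (funext h)

theorem Atom.map_map (f : T → T') (g : T' → T'') (A : Atom S T) :
    (A.map f).map g = A.map (g ∘ f) := rfl

theorem Atom.map_eq_self {f : T → T} {A : Atom S T} (h : ∀ i, f (A.args i) = A.args i) :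
    A.map f = A :=
  Atom.map_congr (g := id) h

theorem Atom.mk_inj {p : S.Pred} {t t' : Fin (S.arity p) → T} :
    (⟨p, t⟩ : Atom S T) = ⟨p, t'⟩ ↔ t = t' := by
  simp

/-- The active domain of a database: the values that occur in its facts. -/
def activeValues (F : Set (Atom S T)) : Set T := {v | ∃ A ∈ F, ∃ i, A.args i = v}

theorem finite_activeValues {F : Set (Atom S T)} (hF : F.Finite) : (activeValues F).Finite := by
  have : activeValues F = ⋃ A ∈ F, Set.range A.args := by
    ext v; simp [activeValues]
  rw [this]
  exact hF.biUnion fun A _ => Set.finite_range _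

theorem finite_setOf_forall_args_mem [Finite S.Pred] {X : Set T} (hX : X.Finite) :
    {A : Atom S T | ∀ i, A.args i ∈ X}.Finite := by
  have : Finite X := hX
  refine (Set.finite_range fun x : Σ p : S.Pred, Fin (S.arity p) → X =>
    (⟨x.1, fun i => (x.2 i).1⟩ : Atom S T)).subset ?_
  intro A hA
  exact ⟨⟨A.pred, fun i => ⟨A.args i, hA i⟩⟩, rfl⟩

end Atoms

/-! ## The chase rules -/

theorem exists_lex_min_of_finite {X α β γ : Type*} [LinearOrder α] [LinearOrder β] [LinearOrder γ]
    {s : Set X} (hs : s.Finite) (hne : s.Nonempty) (f : X → α) (g : X → β) (h : X → γ) :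
    ∃ a ∈ s, ∀ b ∈ s, f a ≤ f b ∧ (f a = f b → g a ≤ g b ∧ (g a = g b → h a ≤ h b)) := by
  obtain ⟨a, ha, hmin⟩ :=
    Set.exists_min_image s (fun x => toLex (f x, toLex (g x, h x))) hs hne
  refine ⟨a, ha, fun b hb => ?_⟩
  have := hmin b hb
  simp only [Prod.Lex.toLex_le_toLex] at this
  grind

section ChaseRules

variable {S : RelSchema} {K : Type*} {I : Set (IncDep S)} {J : Set (KeyDep S)}
  {st st' : ChaseState S K}

theorem finite_setOf_mk_mem {T : Type*} {F : Set (Atom S T)} (hF : F.Finite) (p : S.Pred) :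
    {t | (⟨p, t⟩ : Atom S T) ∈ F}.Finite :=
  hF.preimage fun _ _ _ _ => Atom.mk_inj.1

theorem finite_kdApplicable (hJ : J.Finite) (hst : st.facts.Finite) :
    {x : Σ κ : KeyDep S, (Fin (S.arity κ.pred) → Val K) × (Fin (S.arity κ.pred) → Val K) |
      KDApplicable J st x.1 x.2.1 x.2.2}.Finite := by
  refine (hJ.biUnion fun κ _ => (((finite_setOf_mk_mem hst κ.pred).prod
    (finite_setOf_mk_mem hst κ.pred)).image (Sigma.mk κ))).subset ?_
  rintro ⟨κ, t, t'⟩ ⟨hκ, ht, ht', -⟩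
  exact Set.mem_biUnion hκ ⟨(t, t'), ⟨ht, ht'⟩, rfl⟩

theorem finite_idApplicable (hI : I.Finite) (hst : st.facts.Finite) :
    {x : Σ σ : IncDep S, Fin (S.arity σ.lhs) → Val K | IDApplicable I st x.1 x.2}.Finite := by
  refine (hI.biUnion fun σ _ => (finite_setOf_mk_mem hst σ.lhs).image (Sigma.mk σ)).subset ?_
  rintro ⟨σ, t⟩ ⟨hσ, ht, -⟩
  exact Set.mem_biUnion hσ ⟨t, ht, rfl⟩

theorem exists_kdSelected (ord : ChaseOrder S K) (hJ : J.Finite) (hst : st.facts.Finite)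
    (h : ∃ κ t t', KDApplicable J st κ t t') : ∃ κ t t', KDSelected ord J st κ t t' := by
  obtain ⟨κ, t, t', hκ⟩ := h
  let _ := ord.pair
  let _ := ord.kd
  obtain ⟨a, ha, hmin⟩ := exists_lex_min_of_finite (finite_kdApplicable hJ hst) ⟨⟨κ, t, t'⟩, hκ⟩
    (fun x => min (st.level ⟨x.1.pred, x.2.1⟩) (st.level ⟨x.1.pred, x.2.2⟩))
    (fun x => ((⟨x.1.pred, x.2.1⟩, ⟨x.1.pred, x.2.2⟩) : Atom S (Val K) × Atom S (Val K))) Sigma.fst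
  exact ⟨a.1, a.2.1, a.2.2, ha, fun κ' s s' hs => hmin ⟨κ', s, s'⟩ hs⟩

theorem exists_idSelected (ord : ChaseOrder S K) (hI : I.Finite) (hst : st.facts.Finite)
    (h : ∃ σ t, IDApplicable I st σ t) : ∃ σ t, IDSelected ord I st σ t := by
  have hne : {x : Σ σ : IncDep S, Fin (S.arity σ.lhs) → Val K |
      IDCandidate I st x.1 x.2}.Nonempty := by
    by_cases hfull : ∃ σ t, IDApplicable I st σ t ∧ σ.FullWidth
    · obtain ⟨σ, t, happ, hσ⟩ := hfull
      exact ⟨⟨σ, t⟩, happ, fun _ => hσ⟩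
    · obtain ⟨σ, t, happ⟩ := h
      exact ⟨⟨σ, t⟩, happ, fun hfull' => absurd hfull' hfull⟩
  let _ := ord.fact
  let _ := ord.id
  obtain ⟨a, ha, hmin⟩ := exists_lex_min_of_finite
    ((finite_idApplicable hI hst).subset fun _ hx => hx.1) hne
    (fun x => st.level ⟨x.1.lhs, x.2⟩) (fun x => (⟨x.1.lhs, x.2⟩ : Atom S (Val K))) Sigma.fst
  exact ⟨a.1, a.2, ha, fun σ' s hs => hmin ⟨σ', s⟩ hs⟩

section IncDep

variable {σ : IncDep S} {t : Fin (S.arity σ.lhs) → Val K}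

theorem newTuple_Y (hY : Function.Injective σ.Y) (t : Fin (S.arity σ.lhs) → Val K)
    (i : Fin σ.width) : newTuple st σ t (σ.Y i) = t (σ.X i) := by
  have h : ∃ i', σ.Y i' = σ.Y i := ⟨i, rfl⟩
  rw [newTuple, dif_pos h, hY h.choose_spec]

theorem newTuple_of_forall_ne {j : Fin (S.arity σ.rhs)} (h : ∀ i, σ.Y i ≠ j) :
    newTuple st σ t j = .fresh (st.next + j) :=
  dif_neg (not_exists.2 h)

theorem newTuple_eq_or_fresh (st : ChaseState S K) (t : Fin (S.arity σ.lhs) → Val K)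
    (j : Fin (S.arity σ.rhs)) :
    (∃ i, σ.Y i = j ∧ newTuple st σ t j = t (σ.X i)) ∨
      newTuple st σ t j = .fresh (st.next + j) := by
  unfold newTuple
  split_ifs with h
  exacts [.inl ⟨h.choose, h.choose_spec, rfl⟩, .inr rfl]

theorem IDApplicable.newFact_notMem (h : IDApplicable I st σ t) (hY : Function.Injective σ.Y) :
    (⟨σ.rhs, newTuple st σ t⟩ : Atom S (Val K)) ∉ st.facts :=
  fun hm => h.2.2 ⟨_, hm, newTuple_Y hY t⟩

theorem idApply_level_of_ne {A : Atom S (Val K)} (h : A ≠ ⟨σ.rhs, newTuple st σ t⟩) :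
    (idApply st σ t).level A = st.level A := by
  simp [idApply, h]

theorem IDApplicable.idApply_level (h : IDApplicable I st σ t) (hY : Function.Injective σ.Y)
    {A : Atom S (Val K)} (hA : A ∈ st.facts) : (idApply st σ t).level A = st.level A :=
  idApply_level_of_ne fun hAnew => h.newFact_notMem hY (hAnew ▸ hA)

theorem IDApplicable.of_idApply {σ' : IncDep S} {t' : Fin (S.arity σ'.lhs) → Val K}
    (h : IDApplicable I (idApply st σ t) σ' t') :
    (⟨σ'.lhs, t'⟩ : Atom S (Val K)) = ⟨σ.rhs, newTuple st σ t⟩ ∨ IDApplicable I st σ' t' :=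
  h.2.1.imp id fun ht' => ⟨h.1, ht', fun ⟨u, hu, hYX⟩ => h.2.2 ⟨u, .inr hu, hYX⟩⟩

theorem idApply_level_new :
    (idApply st σ t).level ⟨σ.rhs, newTuple st σ t⟩ = st.level ⟨σ.lhs, t⟩ + 1 := by
  simp [idApply]

theorem activeValues_idApply_subset (ht : (⟨σ.lhs, t⟩ : Atom S (Val K)) ∈ st.facts)
    (hY : Function.Surjective σ.Y) :
    activeValues (idApply st σ t).facts ⊆ activeValues st.facts := by
  rintro _ ⟨A, rfl | hA, j, rfl⟩
  · refine ⟨_, ht, σ.X (hY j).choose, ?_⟩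
    change _ = newTuple st σ t j
    rw [newTuple, dif_pos (hY j)]
  · exact ⟨A, hA, j, rfl⟩

end IncDep

section KeyDep

variable {κ : KeyDep S} {t t' : Fin (S.arity κ.pred) → Val K}

theorem exists_unify_of_kdApply_eq_some (h : kdApply st κ t t' = some st') :
    ∃ l θ, unify l t t' = some θ ∧ (∀ i ∉ κ.key, i ∈ l) ∧ st'.facts = Atom.map θ '' st.facts ∧
      (∀ A, st'.level A = sInf (st.level '' {A' | A' ∈ st.facts ∧ A'.map θ = A})) ∧
      st'.next = st.next := by
  obtain ⟨θ, hθ, rfl⟩ := Option.map_eq_some_iff.1 h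
  exact ⟨_, θ, hθ, fun i hi => by simpa using hi, rfl, fun _ => rfl, rfl⟩

theorem activeValues_image_map {T T' : Type*} (f : T → T') (F : Set (Atom S T)) :
    activeValues (Atom.map f '' F) = f '' activeValues F := by
  ext v
  constructor
  · rintro ⟨_, ⟨A, hA, rfl⟩, i, rfl⟩
    exact ⟨A.args i, ⟨A, hA, i, rfl⟩, rfl⟩
  · rintro ⟨_, ⟨A, hA, i, rfl⟩, rfl⟩
    exact ⟨_, ⟨A, hA, rfl⟩, i, rfl⟩

theorem KDApplicable.ncard_activeValues_lt (h : KDApplicable J st κ t t')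
    (hst : st.facts.Finite) (happ : kdApply st κ t t' = some st') :
    (activeValues st'.facts).ncard < (activeValues st.facts).ncard := by
  obtain ⟨l, θ, hθ, hl, hfacts, -⟩ := exists_unify_of_kdApply_eq_some happ
  obtain ⟨-, ht, ht', hne, hkey⟩ := h
  have hfin := finite_activeValues hst
  rw [hfacts, activeValues_image_map]
  refine lt_of_le_of_ne (Set.ncard_image_le hfin) fun heq => hne (funext fun i => ?_)
  by_cases hi : i ∈ κ.key
  · exact hkey i hi
  · exact (Set.ncard_image_iff hfin).1 heq ⟨_, ht, i, rfl⟩ ⟨_, ht', i, rfl⟩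
      (unify_apply_eq_apply hθ (hl i hi))

end KeyDep

/-- The invariant that makes the constants `st.next, st.next + 1, …` new: all the fresh constants
of the state are earlier. -/
def FreshBelow (st : ChaseState S K) : Prop :=
  ∀ A ∈ st.facts, ∀ i m, A.args i = .fresh m → m < st.next

theorem freshBelow_init (D : Set (Atom S K)) : FreshBelow (ChaseState.init D) := by
  rintro _ ⟨A, _, rfl⟩ i m h
  simp [Atom.map] at h

theorem FreshBelow.kdApply {κ : KeyDep S} {t t' : Fin (S.arity κ.pred) → Val K}
    (h : FreshBelow st) (happ : kdApply st κ t t' = some st') : FreshBelow st' := by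
  obtain ⟨_, θ, hθ, -, hfacts, -, hnext⟩ := exists_unify_of_kdApply_eq_some happ
  rintro A hA i m hm
  rw [hfacts] at hA
  obtain ⟨A, hA, rfl⟩ := hA
  replace hm : θ (A.args i) = .fresh m := hm
  rw [hnext]
  rcases unify_eq_or_rank_lt hθ (A.args i) with heq | hlt
  · exact h A hA i m (heq ▸ hm)
  · cases hv : A.args i with
    | dom c => simp [hv, Val.rank] at hlt
    | fresh m' =>
      have hm' := h A hA i m' hv
      rw [hm, hv] at hlt
      simp only [Val.rank] at hlt
      omega

theorem FreshBelow.idApply {σ : IncDep S} {t : Fin (S.arity σ.lhs) → Val K} (h : FreshBelow st)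
    (ht : (⟨σ.lhs, t⟩ : Atom S (Val K)) ∈ st.facts) : FreshBelow (idApply st σ t) := by
  rintro A (rfl | hA) i m hm
  all_goals change m < st.next + S.arity σ.rhs
  · replace hm : newTuple st σ t i = .fresh m := hm
    rcases newTuple_eq_or_fresh st t i with ⟨i', -, hi'⟩ | hi
    · have := h _ ht (σ.X i') m (hi'.symm.trans hm)
      omega
    · have hlt : (i : ℕ) < S.arity σ.rhs := i.2
      have : st.next + i = m := Val.fresh.inj (hi.symm.trans hm)
      omega
  · have := h A hA i m hm
    omega

variable {ord : ChaseOrder S K}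

theorem ChaseStep.freshBelow (h : ChaseStep ord I J st st') (hst : FreshBelow st) :
    FreshBelow st' := by
  cases h with
  | kd _ κ t t' hsel happ => exact hst.kdApply happ
  | id σ t hkd hsel => exact hst.idApply hsel.1.1.2.1

theorem ChaseStep.finite_facts (h : ChaseStep ord I J st st') (hst : st.facts.Finite) :
    st'.facts.Finite := by
  cases h with
  | kd _ κ t t' hsel happ =>
    obtain ⟨_, θ, -, -, hfacts, -⟩ := exists_unify_of_kdApply_eq_some happ
    exact hfacts ▸ hst.image _
  | id σ t hkd hsel => exact hst.insert _

/-- A map of values under which a state develops into a later one: it replaces values by preferred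
ones, carries facts to facts and does not raise levels. -/
structure IsStepMap (st st' : ChaseState S K) (θ : Val K → Val K) : Prop where
  eq_or_rank_lt : ∀ v, θ v = v ∨ (θ v).rank < v.rank
  map_mem : ∀ A ∈ st.facts, A.map θ ∈ st'.facts
  level_le : ∀ A ∈ st.facts, st'.level (A.map θ) ≤ st.level A

theorem IsStepMap.refl (st : ChaseState S K) : IsStepMap st st id :=
  ⟨fun _ => .inl rfl, fun _ hA => hA, fun _ _ => le_rfl⟩

theorem ChaseStep.exists_isStepMap (hY : ∀ σ ∈ I, Function.Injective σ.Y)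
    (h : ChaseStep ord I J st st') : ∃ θ, IsStepMap st st' θ := by
  cases h with
  | kd _ κ t t' hsel happ =>
    obtain ⟨_, θ, hθ, -, hfacts, hlevel, -⟩ := exists_unify_of_kdApply_eq_some happ
    refine ⟨θ, unify_eq_or_rank_lt hθ, fun A hA => hfacts ▸ ⟨A, hA, rfl⟩, fun A hA => ?_⟩
    exact hlevel _ ▸ Nat.sInf_le ⟨A, ⟨hA, rfl⟩, rfl⟩
  | id σ t hkd hsel =>
    exact ⟨_root_.id, fun _ => .inl rfl, fun A hA => .inr hA, fun A hA =>
      (hsel.1.1.idApply_level (hY σ hsel.1.1.1) hA).le⟩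

end ChaseRules

/-! ## The chase sequence and its limit -/

theorem exists_forall_ge_eq_of_succ_le {f : ℕ → ℕ} {i : ℕ} (h : ∀ j ≥ i, f (j + 1) ≤ f j) :
    ∃ i' ≥ i, ∀ j ≥ i', f j = f i' := by
  have hanti : Antitone fun m => f (i + m) :=
    antitone_nat_of_succ_le fun m => h _ (Nat.le_add_right i m)
  obtain ⟨m, hm⟩ := WellFoundedLT.antitone_chain_condition hanti
  refine ⟨i + m, by omega, fun j hj => ?_⟩
  obtain ⟨k, rfl⟩ := Nat.exists_eq_add_of_le (show i ≤ j by omega)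
  exact (hm k (by omega)).symm

theorem finite_keyDep (S : RelSchema) [Finite S.Pred] : Finite (KeyDep S) := by
  refine Finite.of_surjective
    (fun x : Σ p : S.Pred, Set (Fin (S.arity p)) => (⟨x.1, x.2⟩ : KeyDep S)) ?_
  rintro ⟨p, key⟩
  exact ⟨⟨p, key⟩, rfl⟩

theorem finite_of_forall_injective_Y {S : RelSchema} [Finite S.Pred] {I : Set (IncDep S)}
    (hY : ∀ σ ∈ I, Function.Injective σ.Y) : I.Finite := by
  refine (Set.finite_range fun x : Σ p : S.Pred × S.Pred, Σ w : Fin (S.arity p.2 + 1),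
    (Fin w → Fin (S.arity p.1)) × (Fin w → Fin (S.arity p.2)) =>
      (⟨x.1.1, x.1.2, x.2.1, x.2.2.1, x.2.2.2⟩ : IncDep S)).subset ?_
  intro σ hσ
  have hw : σ.width ≤ S.arity σ.rhs := by simpa using Fintype.card_le_of_injective _ (hY σ hσ)
  exact ⟨⟨(σ.lhs, σ.rhs), ⟨σ.width, Nat.lt_succ_of_le hw⟩, σ.X, σ.Y⟩, rfl⟩

section Sequence

variable {S : RelSchema} {K : Type*} (ord : ChaseOrder S K) (I : Set (IncDep S))
  (J : Set (KeyDep S)) (D : Set (Atom S K))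

open Classical in
/-- The stages of the chase; the last one, if any, is repeated forever. -/
noncomputable def chaseSeq : ℕ → ChaseState S K
  | 0 => ChaseState.init D
  | m + 1 => if h : ∃ st', ChaseStep ord I J (chaseSeq m) st' then h.choose else chaseSeq m

variable {ord I J D}

theorem chaseStep_chaseSeq_succ {m : ℕ} (h : ∃ st', ChaseStep ord I J (chaseSeq ord I J D m) st') :
    ChaseStep ord I J (chaseSeq ord I J D m) (chaseSeq ord I J D (m + 1)) := by
  rw [show chaseSeq ord I J D (m + 1) = h.choose by rw [chaseSeq, dif_pos h]]
  exact h.choose_spec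

theorem chaseStep_or_chaseSeq_succ_eq (ord : ChaseOrder S K) (I : Set (IncDep S))
    (J : Set (KeyDep S)) (D : Set (Atom S K)) (m : ℕ) :
    ChaseStep ord I J (chaseSeq ord I J D m) (chaseSeq ord I J D (m + 1)) ∨
      (¬ ∃ st', ChaseStep ord I J (chaseSeq ord I J D m) st') ∧
        chaseSeq ord I J D (m + 1) = chaseSeq ord I J D m := by
  by_cases h : ∃ st', ChaseStep ord I J (chaseSeq ord I J D m) st'
  · exact .inl (chaseStep_chaseSeq_succ h)
  · exact .inr ⟨h, by rw [chaseSeq, dif_neg h]⟩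

theorem chaseSeq_reachable (m : ℕ) :
    ReflTransGen (ChaseStep ord I J) (ChaseState.init D) (chaseSeq ord I J D m) := by
  induction m with
  | zero => exact .refl
  | succ m ih =>
    rcases chaseStep_or_chaseSeq_succ_eq ord I J D m with h | ⟨-, h⟩
    exacts [ih.tail h, h ▸ ih]

theorem finite_facts_of_reachable (hD : D.Finite) {st : ChaseState S K}
    (h : ReflTransGen (ChaseStep ord I J) (ChaseState.init D) st) : st.facts.Finite := by
  induction h with
  | refl => exact hD.image _
  | tail _ hstep ih => exact hstep.finite_facts ih

theorem freshBelow_of_reachable {st : ChaseState S K}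
    (h : ReflTransGen (ChaseStep ord I J) (ChaseState.init D) st) : FreshBelow st := by
  induction h with
  | refl => exact freshBelow_init D
  | tail _ hstep ih => exact hstep.freshBelow ih

theorem finite_facts_chaseSeq (hD : D.Finite) (m : ℕ) : (chaseSeq ord I J D m).facts.Finite :=
  finite_facts_of_reachable hD (chaseSeq_reachable m)

theorem exists_isStepMap_chaseSeq (ord : ChaseOrder S K) (J : Set (KeyDep S)) (D : Set (Atom S K))
    (hY : ∀ σ ∈ I, Function.Injective σ.Y) (m : ℕ) :
    ∃ θ, IsStepMap (chaseSeq ord I J D m) (chaseSeq ord I J D (m + 1)) θ := by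
  rcases chaseStep_or_chaseSeq_succ_eq ord I J D m with h | ⟨-, h⟩
  · exact h.exists_isStepMap hY
  · rw [h]; exact ⟨id, IsStepMap.refl _⟩

theorem exists_chaseSeq_succ_eq_kdApply (hJ : J.Finite) (hD : D.Finite)
    (hex : ChaseExists ord I J D) {m : ℕ}
    (h : ∃ κ t t', KDApplicable J (chaseSeq ord I J D m) κ t t') :
    ∃ κ t t', KDApplicable J (chaseSeq ord I J D m) κ t t' ∧
      kdApply (chaseSeq ord I J D m) κ t t' = some (chaseSeq ord I J D (m + 1)) := by
  obtain ⟨κ, t, t', hsel⟩ := exists_kdSelected ord hJ (finite_facts_chaseSeq hD m) h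
  obtain ⟨st', hst'⟩ := Option.ne_none_iff_exists'.1 (hex _ (chaseSeq_reachable m) κ t t' hsel)
  have hstep := chaseStep_chaseSeq_succ ⟨st', .kd _ _ κ t t' hsel hst'⟩
  generalize chaseSeq ord I J D (m + 1) = st'' at hstep
  cases hstep with
  | kd _ κ t t' hsel happ => exact ⟨κ, t, t', hsel.1, happ⟩
  | id _ _ hkd => exact absurd h (by push Not; exact hkd)

theorem exists_chaseSeq_succ_eq_idApply (hI : I.Finite) (hD : D.Finite) {m : ℕ}
    (hkd : ∀ κ t t', ¬ KDApplicable J (chaseSeq ord I J D m) κ t t')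
    (h : ∃ σ t, IDApplicable I (chaseSeq ord I J D m) σ t) :
    ∃ σ t, IDSelected ord I (chaseSeq ord I J D m) σ t ∧
      chaseSeq ord I J D (m + 1) = idApply (chaseSeq ord I J D m) σ t := by
  obtain ⟨σ, t, hsel⟩ := exists_idSelected ord hI (finite_facts_chaseSeq hD m) h
  have hstep := chaseStep_chaseSeq_succ ⟨_, .id _ σ t hkd hsel⟩
  generalize chaseSeq ord I J D (m + 1) = st'' at hstep
  cases hstep with
  | kd _ κ t t' hsel => exact absurd hsel.1 (hkd κ t t')
  | id σ t _ hsel => exact ⟨σ, t, hsel, rfl⟩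

theorem exists_stage_forall_not_kdApplicable (hJ : J.Finite) (hD : D.Finite)
    (hex : ChaseExists ord I J D) (i : ℕ) :
    ∃ j ≥ i, ∀ κ t t', ¬ KDApplicable J (chaseSeq ord I J D j) κ t t' := by
  by_contra! hcon
  have hlt (j) (hj : j ≥ i) : (activeValues (chaseSeq ord I J D (j + 1)).facts).ncard <
      (activeValues (chaseSeq ord I J D j).facts).ncard := by
    obtain ⟨κ, t, t', hκ, happ⟩ := exists_chaseSeq_succ_eq_kdApply hJ hD hex (hcon j hj)
    exact hκ.ncard_activeValues_lt (finite_facts_chaseSeq hD j) happ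
  obtain ⟨i', hi', hconst⟩ := exists_forall_ge_eq_of_succ_le
    (f := fun j => (activeValues (chaseSeq ord I J D j).facts).ncard) fun j hj => (hlt j hj).le
  exact (hlt i' hi').ne (hconst _ (Nat.le_succ i'))

section Violations

variable {st st' : ChaseState S K}

/-- The violations of inclusion dependencies by facts of level at most `l`. Their number bounds
how often the chase can still apply an inclusion dependency on a fact of level `l`. -/
def violations (I : Set (IncDep S)) (st : ChaseState S K) (l : ℕ) :
    Set (Σ σ : IncDep S, Fin (S.arity σ.lhs) → Val K) :=
  {x | IDApplicable I st x.1 x.2 ∧ st.level ⟨x.1.lhs, x.2⟩ ≤ l}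

theorem finite_violations (hI : I.Finite) (hst : st.facts.Finite) (l : ℕ) :
    (violations I st l).Finite :=
  (finite_idApplicable hI hst).subset fun _ hx => hx.1

theorem violations_kdApply_subset {κ : KeyDep S} {t t' : Fin (S.arity κ.pred) → Val K}
    (happ : kdApply st κ t t' = some st') (l : ℕ) :
    ∃ θ : Val K → Val K,
      violations I st' l ⊆ (fun x => ⟨x.1, θ ∘ x.2⟩) '' violations I st l := by
  obtain ⟨_, θ, -, -, hfacts, hlevel, -⟩ := exists_unify_of_kdApply_eq_some happ
  refine ⟨θ, ?_⟩
  rintro ⟨σ, s⟩ ⟨⟨hσ, hs, hno⟩, hl⟩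
  -- Among the facts merged into `σ.lhs(s)`, one of least level violates `σ` as well.
  have hne : (st.level '' {A | A ∈ st.facts ∧ A.map θ = ⟨σ.lhs, s⟩}).Nonempty := by
    rw [hfacts] at hs
    obtain ⟨A, hA, hAs⟩ := hs
    exact ⟨_, A, ⟨hA, hAs⟩, rfl⟩
  obtain ⟨⟨p, s'⟩, ⟨hA, hAs⟩, hlA⟩ := Nat.sInf_mem hne
  obtain ⟨rfl, hs'⟩ : p = σ.lhs ∧ HEq (fun i => θ (s' i)) s := by
    simpa only [Atom.map, Atom.mk.injEq] using hAs
  obtain rfl := eq_of_heq hs'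
  refine ⟨⟨σ, s'⟩, ⟨⟨hσ, hA, ?_⟩, ?_⟩, rfl⟩
  · rintro ⟨u, hu, hus⟩
    exact hno ⟨θ ∘ u, hfacts ▸ ⟨_, hu, rfl⟩, fun i => congrArg θ (hus i)⟩
  · rw [hlA, ← hlevel]
    exact hl

theorem ncard_violations_kdApply_le (hI : I.Finite) (hst : st.facts.Finite) {κ : KeyDep S}
    {t t' : Fin (S.arity κ.pred) → Val K} (happ : kdApply st κ t t' = some st') (l : ℕ) :
    (violations I st' l).ncard ≤ (violations I st l).ncard := by
  obtain ⟨θ, hθ⟩ := violations_kdApply_subset (I := I) happ l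
  have hfin := finite_violations hI hst l
  exact (Set.ncard_le_ncard hθ (hfin.image _)).trans (Set.ncard_image_le hfin)

variable {σ : IncDep S} {t : Fin (S.arity σ.lhs) → Val K} {l : ℕ}

theorem violations_idApply_subset (hl : l ≤ st.level ⟨σ.lhs, t⟩) :
    violations I (idApply st σ t) l ⊆ violations I st l := by
  rintro ⟨σ', s⟩ ⟨happ, hl'⟩
  have hne : (⟨σ'.lhs, s⟩ : Atom S (Val K)) ≠ ⟨σ.rhs, newTuple st σ t⟩ := by
    intro heq
    simp only [heq, idApply_level_new] at hl'
    omega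
  exact ⟨happ.of_idApply.resolve_left hne, (idApply_level_of_ne hne).symm.trans_le hl'⟩

theorem IDApplicable.ncard_violations_lt (h : IDApplicable I st σ t)
    (hY : Function.Injective σ.Y) (hI : I.Finite) (hst : st.facts.Finite) :
    (violations I (idApply st σ t) (st.level ⟨σ.lhs, t⟩)).ncard <
      (violations I st (st.level ⟨σ.lhs, t⟩)).ncard := by
  refine Set.ncard_lt_ncard ⟨violations_idApply_subset le_rfl, fun hsub => ?_⟩
    (finite_violations hI hst _)
  obtain ⟨hviol, -⟩ := hsub (show (⟨σ, t⟩ : Sigma _) ∈ _ from ⟨h, le_rfl⟩)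
  exact hviol.2.2 ⟨_, .inl rfl, newTuple_Y hY t⟩

end Violations

theorem ncard_violations_chaseSeq_succ_le (hI : I.Finite) (hD : D.Finite) {j l : ℕ}
    (hl : ∀ σ t, IDApplicable I (chaseSeq ord I J D j) σ t →
      chaseSeq ord I J D (j + 1) = idApply (chaseSeq ord I J D j) σ t →
      l ≤ (chaseSeq ord I J D j).level ⟨σ.lhs, t⟩) :
    (violations I (chaseSeq ord I J D (j + 1)) l).ncard ≤
      (violations I (chaseSeq ord I J D j) l).ncard := by
  have hfin := finite_facts_chaseSeq (ord := ord) (I := I) (J := J) hD j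
  rcases chaseStep_or_chaseSeq_succ_eq ord I J D j with h | ⟨-, h⟩
  · generalize chaseSeq ord I J D (j + 1) = st' at *
    cases h with
    | kd _ κ t t' hsel happ => exact ncard_violations_kdApply_le hI hfin happ l
    | id σ t hkd hsel =>
      exact Set.ncard_le_ncard (violations_idApply_subset (hl σ t hsel.1.1 rfl))
        (finite_violations hI hfin l)
  · rw [h]

theorem exists_stage_forall_le_level (hI : I.Finite) (hY : ∀ σ ∈ I, Function.Injective σ.Y)
    (hD : D.Finite) (l : ℕ) :
    ∃ i, ∀ j ≥ i, ∀ σ t, IDApplicable I (chaseSeq ord I J D j) σ t →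
      chaseSeq ord I J D (j + 1) = idApply (chaseSeq ord I J D j) σ t →
      l ≤ (chaseSeq ord I J D j).level ⟨σ.lhs, t⟩ := by
  induction l with
  | zero => exact ⟨0, fun _ _ _ _ _ _ => Nat.zero_le _⟩
  | succ l ih =>
    obtain ⟨i, hi⟩ := ih
    obtain ⟨i', hi', hconst⟩ := exists_forall_ge_eq_of_succ_le
      (f := fun j => (violations I (chaseSeq ord I J D j) l).ncard) fun j hj =>
        ncard_violations_chaseSeq_succ_le (J := J) hI hD (hi j hj)
    refine ⟨i', fun j hj σ t happ heq => (hi j (hi'.trans hj) σ t happ heq).lt_of_ne ?_⟩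
    rintro rfl
    refine (happ.ncard_violations_lt (hY σ happ.1) hI (finite_facts_chaseSeq hD j)).ne ?_
    rw [← heq, hconst _ (hj.trans (Nat.le_succ j)), hconst j hj]

theorem not_forall_fullWidth_idApply [Finite S.Pred] {s : ℕ → ChaseState S K}
    (h0 : (s 0).facts.Finite)
    (h : ∀ m, ∃ σ t, IDApplicable I (s m) σ t ∧ σ.FullWidth ∧ s (m + 1) = idApply (s m) σ t) :
    False := by
  have hvalues (m) : activeValues (s m).facts ⊆ activeValues (s 0).facts := by
    induction m with
    | zero => exact subset_rfl
    | succ m ih =>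
      obtain ⟨σ, t, happ, hfull, heq⟩ := h m
      exact heq ▸ (activeValues_idApply_subset happ.2.1 hfull.2.2).trans ih
  have hfacts : StrictMono fun m => (s m).facts := by
    refine strictMono_nat_of_lt_succ fun m => ?_
    obtain ⟨σ, t, happ, hfull, heq⟩ := h m
    exact heq ▸ Set.ssubset_insert (happ.newFact_notMem hfull.2.1)
  refine Set.infinite_of_injective_forall_mem hfacts.injective
    (s := {F | F ⊆ {A | ∀ i, A.args i ∈ activeValues (s 0).facts}})
    (fun m A hA i => hvalues m ⟨A, hA, i, rfl⟩)
    (finite_setOf_forall_args_mem (S := S) (finite_activeValues h0)).finite_subsets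

theorem not_eventually_kdApply_or_fullWidth_idApply [Finite S.Pred] (hD : D.Finite) (i : ℕ)
    (h : ∀ j ≥ i, (∃ κ t t', KDApplicable J (chaseSeq ord I J D j) κ t t' ∧
        kdApply (chaseSeq ord I J D j) κ t t' = some (chaseSeq ord I J D (j + 1))) ∨
      ∃ σ t, IDApplicable I (chaseSeq ord I J D j) σ t ∧ σ.FullWidth ∧
        chaseSeq ord I J D (j + 1) = idApply (chaseSeq ord I J D j) σ t) : False := by
  have hfin := finite_facts_chaseSeq (ord := ord) (I := I) (J := J) hD
  have hle (j) (hj : j ≥ i) : (activeValues (chaseSeq ord I J D (j + 1)).facts).ncard ≤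
      (activeValues (chaseSeq ord I J D j).facts).ncard := by
    rcases h j hj with ⟨κ, t, t', hκ, happ⟩ | ⟨σ, t, hσ, hfull, heq⟩
    · exact (hκ.ncard_activeValues_lt (hfin j) happ).le
    · exact heq ▸ Set.ncard_le_ncard (activeValues_idApply_subset hσ.2.1 hfull.2.2)
        (finite_activeValues (hfin j))
  obtain ⟨i', hi', hconst⟩ := exists_forall_ge_eq_of_succ_le
    (f := fun j => (activeValues (chaseSeq ord I J D j).facts).ncard) hle
  refine not_forall_fullWidth_idApply (I := I) (s := fun m => chaseSeq ord I J D (i' + m))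
    (hfin _) fun m => (h (i' + m) (by omega)).resolve_left ?_
  rintro ⟨κ, t, t', hκ, happ⟩
  refine (hκ.ncard_activeValues_lt (hfin _) happ).ne ?_
  rw [hconst _ (by omega), hconst _ (Nat.le_add_right i' m)]

/-- Fairness of the chase: key dependencies and full-width dependencies alone cannot keep it busy
forever, and otherwise it applies inclusion dependencies on facts of higher and higher levels. -/
theorem exists_stage_not_idApplicable [Finite S.Pred] (hY : ∀ σ ∈ I, Function.Injective σ.Y)
    (hD : D.Finite) (hex : ChaseExists ord I J D) {i : ℕ} {σ : IncDep S}
    {t : Fin (S.arity σ.lhs) → Val K} {l : ℕ}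
    (hl : ∀ j ≥ i, (chaseSeq ord I J D j).level ⟨σ.lhs, t⟩ ≤ l) :
    ∃ j ≥ i, ¬ IDApplicable I (chaseSeq ord I J D j) σ t := by
  by_contra! happ
  have hI : I.Finite := finite_of_forall_injective_Y hY
  have := finite_keyDep S
  obtain ⟨i₁, hi₁⟩ := exists_stage_forall_le_level (ord := ord) (J := J) hI hY hD (l + 1)
  refine not_eventually_kdApply_or_fullWidth_idApply (ord := ord) (I := I) (J := J) hD (max i i₁)
    fun j hj => ?_
  obtain ⟨hji, hji₁⟩ := max_le_iff.1 hj
  by_cases hkd : ∃ κ s s', KDApplicable J (chaseSeq ord I J D j) κ s s'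
  · exact .inl (exists_chaseSeq_succ_eq_kdApply J.toFinite hD hex hkd)
  · push Not at hkd
    obtain ⟨σ', t', hsel, hnext⟩ :=
      exists_chaseSeq_succ_eq_idApply hI hD hkd ⟨σ, t, happ j hji⟩
    refine .inr ⟨σ', t', hsel.1.1, ?_, hnext⟩
    by_contra hfull
    have hcand : IDCandidate I (chaseSeq ord I J D j) σ t :=
      ⟨happ j hji, fun h => absurd (hsel.1.2 h) hfull⟩
    have hlow := ((hsel.2 σ t hcand).1.trans (hl j hji))
    exact absurd (hi₁ j hji₁ σ' t' hsel.1.1 hnext) (by omega)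

section Limit

variable {s : ℕ → ChaseState S K} {θ : ℕ → Val K → Val K} {i : ℕ}

/-- The value that `v`, as it occurs at stage `i`, has become `m` stages later. -/
def trackValue (θ : ℕ → Val K → Val K) (i : ℕ) (v : Val K) : ℕ → Val K
  | 0 => v
  | m + 1 => θ (i + m) (trackValue θ i v m)

/-- The limit of the chase: the facts that are left unchanged from some stage on. -/
def chaseLimit (s : ℕ → ChaseState S K) (θ : ℕ → Val K → Val K) : Set (Atom S (Val K)) :=
  {A | ∃ i, ∀ j ≥ i, A ∈ (s j).facts ∧ ∀ k, θ j (A.args k) = A.args k}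

theorem trackValue_eq_self {v : Val K} (hv : ∀ j ≥ i, θ j v = v) (m : ℕ) :
    trackValue θ i v m = v := by
  induction m with
  | zero => rfl
  | succ m ih => rw [trackValue, ih, hv _ (Nat.le_add_right i m)]

theorem map_trackValue_mem (hθ : ∀ m, IsStepMap (s m) (s (m + 1)) (θ m)) {A : Atom S (Val K)}
    (hA : A ∈ (s i).facts) (m : ℕ) : A.map (fun v => trackValue θ i v m) ∈ (s (i + m)).facts := by
  induction m with
  | zero => exact hA
  | succ m ih => exact (hθ (i + m)).map_mem _ ih

theorem exists_forall_ge_trackValue_eq (hθ : ∀ m v, θ m v = v ∨ (θ m v).rank < v.rank) (i : ℕ)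
    (v : Val K) : ∃ m₀, ∀ m ≥ m₀, trackValue θ i v m = trackValue θ i v m₀ := by
  obtain ⟨m₀, -, hconst⟩ := exists_forall_ge_eq_of_succ_le (i := 0)
    (f := fun m => (trackValue θ i v m).rank) fun m _ => by
      rcases hθ (i + m) (trackValue θ i v m) with h | h
      exacts [(congrArg Val.rank h).le, h.le]
  refine ⟨m₀, fun m hm => ?_⟩
  induction m, hm using Nat.le_induction with
  | base => rfl
  | succ m hm ih =>
    refine ((hθ (i + m) (trackValue θ i v m)).resolve_right fun hlt => hlt.ne ?_).trans ih
    exact (hconst (m + 1) (hm.trans (Nat.le_succ m))).trans (hconst m hm).symm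

theorem exists_map_trackValue_mem_chaseLimit (hθ : ∀ m, IsStepMap (s m) (s (m + 1)) (θ m))
    {A : Atom S (Val K)} (hA : A ∈ (s i).facts) :
    ∃ M, A.map (fun v => trackValue θ i v M) ∈ chaseLimit s θ := by
  choose m₀ hm₀ using exists_forall_ge_trackValue_eq (fun m => (hθ m).eq_or_rank_lt) i
  let M := Finset.univ.sup fun k => m₀ (A.args k)
  have hM (k) (m) (hm : M ≤ m) : trackValue θ i (A.args k) m = trackValue θ i (A.args k) M := by
    have hk : m₀ (A.args k) ≤ M := Finset.le_sup (f := fun k => m₀ (A.args k)) (Finset.mem_univ k)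
    rw [hm₀ _ m (hk.trans hm), hm₀ _ M hk]
  refine ⟨M, i + M, fun j hj => ?_⟩
  obtain ⟨m, rfl⟩ := Nat.exists_eq_add_of_le ((Nat.le_add_right i M).trans hj)
  have hm : M ≤ m := by omega
  constructor
  · rw [← Atom.map_congr (f := fun v => trackValue θ i v m) fun k => hM k m hm]
    exact map_trackValue_mem hθ hA m
  · intro k
    change θ (i + m) (trackValue θ i (A.args k) M) = trackValue θ i (A.args k) M
    rw [← hM k m hm]
    exact (hM k (m + 1) (by omega)).trans (hM k m hm).symm

theorem exists_stage_of_subset_chaseLimit {F : Set (Atom S (Val K))} (hF : F.Finite)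
    (h : F ⊆ chaseLimit s θ) : ∃ m, F ⊆ (s m).facts := by
  choose! i hi using h
  exact ⟨hF.toFinset.sup i, fun A hA =>
    (hi hA _ (Finset.le_sup (f := i) (hF.mem_toFinset.2 hA))).1⟩

theorem embedDB_subset_chaseLimit (hθ : ∀ m, IsStepMap (s m) (s (m + 1)) (θ m))
    (hs : s 0 = ChaseState.init D) : embedDB D ⊆ chaseLimit s θ := by
  intro A hA
  have hA0 : A ∈ (s 0).facts := hs ▸ hA
  obtain ⟨M, hM⟩ := exists_map_trackValue_mem_chaseLimit hθ hA0
  obtain ⟨A', -, rfl⟩ := hA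
  rwa [Atom.map_eq_self fun k => trackValue_eq_self (fun j _ =>
    ((hθ j).eq_or_rank_lt _).resolve_right (Nat.not_lt_zero _)) M] at hM

theorem level_le_of_mem_of_fixed (hθ : ∀ m, IsStepMap (s m) (s (m + 1)) (θ m))
    {A : Atom S (Val K)} (hA : ∀ j ≥ i, A ∈ (s j).facts ∧ ∀ k, θ j (A.args k) = A.args k) {j : ℕ}
    (hj : i ≤ j) : (s j).level A ≤ (s i).level A := by
  induction j, hj using Nat.le_induction with
  | base => exact le_rfl
  | succ j hj ih =>
    have := (hθ j).level_le _ (hA j hj).1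
    rw [Atom.map_eq_self (hA j hj).2] at this
    exact this.trans ih

end Limit

section Model

variable [Finite S.Pred] {θ : ℕ → Val K → Val K}

theorem IncDep.sat_chaseLimit (hY : ∀ σ ∈ I, Function.Injective σ.Y) (hD : D.Finite)
    (hex : ChaseExists ord I J D)
    (hθ : ∀ m, IsStepMap (chaseSeq ord I J D m) (chaseSeq ord I J D (m + 1)) (θ m))
    {σ : IncDep S} (hσ : σ ∈ I) : σ.Sat (chaseLimit (chaseSeq ord I J D) θ) := by
  rintro t ⟨i, hi⟩
  obtain ⟨j, hj, hsat⟩ := exists_stage_not_idApplicable hY hD hex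
    fun j hj => level_le_of_mem_of_fixed hθ hi hj
  simp only [IDApplicable, hσ, (hi j hj).1, true_and, not_not] at hsat
  obtain ⟨t', ht', hYX⟩ := hsat
  obtain ⟨M, hM⟩ := exists_map_trackValue_mem_chaseLimit hθ ht'
  refine ⟨_, hM, fun k => ?_⟩
  change _ = trackValue θ j (t' (σ.Y k)) M
  rw [hYX, trackValue_eq_self fun j' hj' => (hi j' (hj.trans hj')).2 (σ.X k)]

theorem KeyDep.sat_chaseLimit (hD : D.Finite) (hex : ChaseExists ord I J D) {κ : KeyDep S}
    (hκ : κ ∈ J) : κ.Sat (chaseLimit (chaseSeq ord I J D) θ) := by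
  rintro t t' ⟨i, hi⟩ ⟨i', hi'⟩ hne
  by_contra! hkey
  have := finite_keyDep S
  obtain ⟨j, hj, hno⟩ := exists_stage_forall_not_kdApplicable J.toFinite hD hex (max i i')
  obtain ⟨hji, hji'⟩ := max_le_iff.1 hj
  exact hno κ t t' ⟨hκ, (hi j hji).1, (hi' j hji').1, hne, hkey⟩

theorem exists_chase_model (hY : ∀ σ ∈ I, Function.Injective σ.Y) (hD : D.Finite)
    (hex : ChaseExists ord I J D) :
    ∃ B : Set (Atom S (Val K)), (∀ σ ∈ I, σ.Sat B) ∧ (∀ κ ∈ J, κ.Sat B) ∧ embedDB D ⊆ B ∧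
      ∀ F ⊆ B, F.Finite → ∃ m, F ⊆ (chaseSeq ord I J D m).facts := by
  choose θ hθ using exists_isStepMap_chaseSeq ord J D hY
  exact ⟨chaseLimit (chaseSeq ord I J D) θ, fun σ hσ => σ.sat_chaseLimit hY hD hex hθ hσ,
    fun κ hκ => κ.sat_chaseLimit hD hex hκ, embedDB_subset_chaseLimit hθ rfl,
    fun F hF hfin => exists_stage_of_subset_chaseLimit hfin hF⟩

end Model

end Sequence

/-! ## Mapping the chase into models up to an equality -/

section Homomorphism

variable {S : RelSchema} {K W : Type*} {ord : ChaseOrder S K} {I : Set (IncDep S)}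
  {J : Set (KeyDep S)} {D : Set (Atom S K)}

/-- An increasing sequence of sets of facts that satisfies the dependencies up to an equality `E`
and, for inclusion dependencies, up to a passage from `T l` to `T (F l)`. The equality is only
required to work well up to index `N`. -/
structure GradedModel (I : Set (IncDep S)) (J : Set (KeyDep S)) (T : ℕ → Set (Atom S W))
    (E : W → W → Prop) (F : ℕ → ℕ) (N : ℕ) : Prop where
  mono : Monotone T
  le_F : ∀ l, l ≤ F l
  symm : ∀ {a b}, E a b → E b a
  trans : ∀ {a b c}, E a b → E b c → E a c
  refl : ∀ l ≤ N, ∀ A ∈ T l, ∀ i, E (A.args i) (A.args i)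
  kd : ∀ κ ∈ J, ∀ l ≤ N, ∀ t t', (⟨κ.pred, t⟩ : Atom S W) ∈ T l →
    (⟨κ.pred, t'⟩ : Atom S W) ∈ T l → (∀ i ∈ κ.key, E (t i) (t' i)) → ∀ i, E (t i) (t' i)
  id : ∀ σ ∈ I, ∀ l t, (⟨σ.lhs, t⟩ : Atom S W) ∈ T l →
    ∃ t', (⟨σ.rhs, t'⟩ : Atom S W) ∈ T (F l) ∧ ∀ i, t (σ.X i) = t' (σ.Y i)

/-- `h` extends `ι` and maps the facts `G` into the facts `M`, up to the equality `E`. -/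
structure IsHomUpTo (M : Set (Atom S W)) (E : W → W → Prop) (ι : K → W) (G : Set (Atom S (Val K)))
    (h : Val K → W) : Prop where
  map_dom : ∀ c, h (.dom c) = ι c
  exists_mem : ∀ A ∈ G, ∃ t, (⟨A.pred, t⟩ : Atom S W) ∈ M ∧ ∀ i, E (t i) (h (A.args i))

theorem IsHomUpTo.mono {M M' : Set (Atom S W)} {E : W → W → Prop} {ι : K → W}
    {G : Set (Atom S (Val K))} {h : Val K → W} (hh : IsHomUpTo M E ι G h) (hM : M ⊆ M') :
    IsHomUpTo M' E ι G h :=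
  ⟨hh.map_dom, fun A hA => (hh.exists_mem A hA).imp fun _ ht => ht.imp_left (@hM _)⟩

theorem IsHomUpTo.map_mem {M : Set (Atom S W)} {ι : K → W} {G : Set (Atom S (Val K))}
    {h : Val K → W} (hh : IsHomUpTo M (· = ·) ι G h) {A : Atom S (Val K)} (hA : A ∈ G) :
    A.map h ∈ M := by
  obtain ⟨t, ht, heq⟩ := hh.exists_mem A hA
  obtain rfl : t = fun i => h (A.args i) := funext heq
  exact ht

/-- Extend `h` by sending the fresh constants numbered from `a` on to the entries of `u`. -/
def extendFresh (h : Val K → W) (a : ℕ) {m : ℕ} (u : Fin m → W) : Val K → W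
  | .dom c => h (.dom c)
  | .fresh k => if hk : a ≤ k ∧ k - a < m then u ⟨k - a, hk.2⟩ else h (.fresh k)

theorem extendFresh_fresh_add (h : Val K → W) (a : ℕ) {m : ℕ} (u : Fin m → W) (j : Fin m) :
    extendFresh h a u (.fresh (a + j)) = u j := by
  simp [extendFresh]

theorem extendFresh_of_lt (h : Val K → W) {a : ℕ} {m : ℕ} (u : Fin m → W) {v : Val K}
    (hv : ∀ k, v = .fresh k → k < a) : extendFresh h a u v = h v := by
  cases v with
  | dom c => rfl
  | fresh k => exact dif_neg fun hk => (hv k rfl).not_ge hk.1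

namespace GradedModel

variable {T : ℕ → Set (Atom S W)} {E : W → W → Prop} {F : ℕ → ℕ} {N l : ℕ} {ι : K → W}
  {st : ChaseState S K} {h : Val K → W}

/-- Values with equal images. As `E` need not be reflexive, equal values are added. -/
def valueSetoid (hT : GradedModel I J T E F N) (h : Val K → W) : Setoid (Val K) where
  r v w := v = w ∨ E (h v) (h w)
  iseqv :=
    { refl := fun _ => .inl rfl
      symm := Or.imp Eq.symm hT.symm
      trans := by
        rintro v w x (rfl | hvw) (rfl | hwx)
        exacts [.inl rfl, .inr hwx, .inr hvw, .inr (hT.trans hvw hwx)] }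

theorem rel_of_kdApplicable (hT : GradedModel I J T E F N) (hl : l ≤ N)
    (hh : IsHomUpTo (T l) E ι st.facts h) {κ : KeyDep S} {t t' : Fin (S.arity κ.pred) → Val K}
    (happ : KDApplicable J st κ t t') (i : Fin (S.arity κ.pred)) : E (h (t i)) (h (t' i)) := by
  obtain ⟨hκ, ht, ht', -, hkey⟩ := happ
  obtain ⟨u, hu, hut⟩ := hh.exists_mem _ ht
  obtain ⟨u', hu', hut'⟩ := hh.exists_mem _ ht'
  have hkd : E (u i) (u' i) := hT.kd κ hκ l hl u u' hu hu' (fun k hk => hT.trans (hut k) <| by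
    simpa only [hkey k hk] using hT.symm (hut' k)) i
  exact hT.trans (hT.symm (hut i)) (hT.trans hkd (hut' i))

theorem isHomUpTo_kdApply (hT : GradedModel I J T E F N) (hl : l ≤ N)
    (hh : IsHomUpTo (T l) E ι st.facts h) {κ : KeyDep S} {t t' : Fin (S.arity κ.pred) → Val K}
    (happ : KDApplicable J st κ t t') {st' : ChaseState S K} (heq : kdApply st κ t t' = some st') :
    IsHomUpTo (T l) E ι st'.facts h := by
  obtain ⟨_, θ, hθ, -, hfacts, -⟩ := exists_unify_of_kdApply_eq_some heq
  have hrel := rel_unify (hT.valueSetoid h) hθ fun i => .inr (hT.rel_of_kdApplicable hl hh happ i)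
  refine ⟨hh.map_dom, fun A hA => ?_⟩
  rw [hfacts] at hA
  obtain ⟨A, hA, rfl⟩ := hA
  obtain ⟨u, hu, hut⟩ := hh.exists_mem A hA
  refine ⟨u, hu, fun i => ?_⟩
  change E (u i) (h (θ (A.args i)))
  rcases hrel (A.args i) with hv | hv
  · exact hv ▸ hut i
  · exact hT.trans (hut i) hv

theorem exists_isHomUpTo_idApply (hT : GradedModel I J T E F N) (hl : F l ≤ N)
    (hst : FreshBelow st) (hh : IsHomUpTo (T l) E ι st.facts h) {σ : IncDep S}
    (hY : Function.Injective σ.Y) {t : Fin (S.arity σ.lhs) → Val K}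
    (happ : IDApplicable I st σ t) :
    ∃ h', IsHomUpTo (T (F l)) E ι (idApply st σ t).facts h' := by
  obtain ⟨hσ, ht, -⟩ := happ
  obtain ⟨u, hu, hut⟩ := hh.exists_mem _ ht
  obtain ⟨u', hu', huu'⟩ := hT.id σ hσ l u hu
  have hold {A} (hA : A ∈ st.facts) (i) : extendFresh h st.next u' (A.args i) = h (A.args i) :=
    extendFresh_of_lt h u' (hst A hA i)
  refine ⟨extendFresh h st.next u', hh.map_dom, ?_⟩
  rintro A (rfl | hA)
  · refine ⟨u', hu', fun j => ?_⟩
    change E (u' j) (extendFresh h st.next u' (newTuple st σ t j))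
    by_cases hj : ∃ i, σ.Y i = j
    · obtain ⟨i, rfl⟩ := hj
      rw [newTuple_Y hY, hold ht, ← huu']
      exact hut (σ.X i)
    · rw [newTuple_of_forall_ne (not_exists.1 hj), extendFresh_fresh_add]
      exact hT.refl _ hl _ hu' j
  · obtain ⟨v, hv, hvt⟩ := hh.exists_mem A hA
    exact ⟨v, hT.mono (hT.le_F l) hv, fun i => hold hA i ▸ hvt i⟩

theorem exists_isHomUpTo_step (hT : GradedModel I J T E F N)
    (hY : ∀ σ ∈ I, Function.Injective σ.Y) (hl : F l ≤ N) (hst : FreshBelow st)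
    (hh : IsHomUpTo (T l) E ι st.facts h) {st' : ChaseState S K}
    (hstep : ChaseStep ord I J st st') : ∃ h', IsHomUpTo (T (F l)) E ι st'.facts h' := by
  cases hstep with
  | kd _ κ t t' hsel heq =>
    exact ⟨h, (hT.isHomUpTo_kdApply ((hT.le_F l).trans hl) hh hsel.1 heq).mono
      (hT.mono (hT.le_F l))⟩
  | id σ t _ hsel => exact hT.exists_isHomUpTo_idApply hl hst hh (hY σ hsel.1.1.1) hsel.1.1

theorem exists_isHomUpTo_init (hT : GradedModel I J T E F N) (hD : ∀ A ∈ D, A.map ι ∈ T 0)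
    [Nonempty W] : ∃ h, IsHomUpTo (T 0) E ι (ChaseState.init D).facts h := by
  refine ⟨fun v => match v with | .dom c => ι c | .fresh _ => Classical.arbitrary W,
    fun _ => rfl, ?_⟩
  rintro _ ⟨A, hA, rfl⟩
  exact ⟨_, hD A hA, hT.refl 0 (Nat.zero_le _) _ (hD A hA)⟩

theorem exists_isHomUpTo_chaseSeq (hT : GradedModel I J T E F N)
    (hY : ∀ σ ∈ I, Function.Injective σ.Y) [Nonempty W] (hD : ∀ A ∈ D, A.map ι ∈ T 0) (m : ℕ)
    (hm : F^[m] 0 ≤ N) : ∃ h, IsHomUpTo (T (F^[m] 0)) E ι (chaseSeq ord I J D m).facts h := by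
  induction m with
  | zero => exact hT.exists_isHomUpTo_init hD
  | succ m ih =>
    rw [Function.iterate_succ_apply'] at hm ⊢
    obtain ⟨h, hh⟩ := ih ((hT.le_F _).trans hm)
    rcases chaseStep_or_chaseSeq_succ_eq ord I J D m with hs | ⟨-, hs⟩
    · exact hT.exists_isHomUpTo_step hY hm (freshBelow_of_reachable (chaseSeq_reachable m)) hh hs
    · exact hs ▸ ⟨h, hh.mono (hT.mono (hT.le_F _))⟩

end GradedModel

variable {M : Set (Atom S W)} {ι : K → W}

theorem gradedModel_const (hI : ∀ σ ∈ I, σ.Sat M) (hJ : ∀ κ ∈ J, κ.Sat M) :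
    GradedModel I J (fun _ => M) (· = ·) id 0 where
  mono := monotone_const
  le_F _ := le_rfl
  symm := Eq.symm
  trans := Eq.trans
  refl _ _ _ _ _ := rfl
  kd κ hκ _ _ t t' ht ht' hkey i := by
    by_contra hi
    obtain ⟨k, hk, hne⟩ := hJ κ hκ t t' ht ht' fun heq => hi (congrFun heq i)
    exact hne (hkey k hk)
  id σ hσ _ t ht := hI σ hσ t ht

theorem exists_isHomUpTo_of_sat (hI : ∀ σ ∈ I, σ.Sat M) (hJ : ∀ κ ∈ J, κ.Sat M)
    (hY : ∀ σ ∈ I, Function.Injective σ.Y) [Nonempty W] (hD : ∀ A ∈ D, A.map ι ∈ M)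
    {st : ChaseState S K} (hst : ReflTransGen (ChaseStep ord I J) (ChaseState.init D) st) :
    ∃ h, IsHomUpTo M (· = ·) ι st.facts h := by
  have hT := gradedModel_const hI hJ
  induction hst with
  | refl => exact hT.exists_isHomUpTo_init hD
  | tail hst hstep ih =>
    obtain ⟨h, hh⟩ := ih
    exact hT.exists_isHomUpTo_step hY (l := 0) le_rfl (freshBelow_of_reachable hst) hh hstep

theorem chaseExists_of_sat (hI : ∀ σ ∈ I, σ.Sat M) (hJ : ∀ κ ∈ J, κ.Sat M)
    (hY : ∀ σ ∈ I, Function.Injective σ.Y) [Nonempty W] (hD : ∀ A ∈ D, A.map ι ∈ M)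
    (hι : Function.Injective ι) : ChaseExists ord I J D := by
  intro st hst κ t t' hsel hnone
  obtain ⟨h, hh⟩ := exists_isHomUpTo_of_sat hI hJ hY hD hst
  have hrel := (gradedModel_const hI hJ).rel_of_kdApplicable (l := 0) le_rfl hh hsel.1
  obtain ⟨c, d, hcd, heq⟩ :=
    exists_rel_dom_of_unify_eq_none (Setoid.ker h) (Option.map_eq_none_iff.1 hnone) hrel
  refine hcd (hι ?_)
  rw [← hh.map_dom, ← hh.map_dom]
  exact heq

end Homomorphism

/-! ## The chase under inclusion dependencies alone -/

section Inclusion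

variable {S : RelSchema} {K : Type*} {ord : ChaseOrder S K} {I : Set (IncDep S)}
  {J : Set (KeyDep S)} {D : Set (Atom S K)} {st st' : ChaseState S K} {σ : IncDep S}
  {t : Fin (S.arity σ.lhs) → Val K}

theorem KDSelected.unique {κ κ' : KeyDep S} {t t' : Fin (S.arity κ.pred) → Val K}
    {s s' : Fin (S.arity κ'.pred) → Val K} (h : KDSelected ord J st κ t t')
    (h' : KDSelected ord J st κ' s s') :
    (⟨κ, t, t'⟩ : Σ κ : KeyDep S, (Fin (S.arity κ.pred) → Val K) × (Fin (S.arity κ.pred) → Val K)) =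
      ⟨κ', s, s'⟩ := by
  obtain ⟨hlevel, hpair⟩ := h.2 κ' s s' h'.1
  obtain ⟨hlevel', hpair'⟩ := h'.2 κ t t' h.1
  have hlevel_eq := hlevel.antisymm hlevel'
  obtain ⟨hle, hkd⟩ := hpair hlevel_eq
  obtain ⟨hle', hkd'⟩ := hpair' hlevel_eq.symm
  have hpair_eq := ord.pair.le_antisymm _ _ hle hle'
  obtain rfl := ord.kd.le_antisymm _ _ (hkd hpair_eq) (hkd' hpair_eq.symm)
  obtain ⟨ht, ht'⟩ := Prod.mk.inj hpair_eq
  rw [Atom.mk_inj.1 ht, Atom.mk_inj.1 ht']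

theorem IDSelected.unique {σ' : IncDep S} {t' : Fin (S.arity σ'.lhs) → Val K}
    (h : IDSelected ord I st σ t) (h' : IDSelected ord I st σ' t') :
    (⟨σ, t⟩ : Σ σ : IncDep S, Fin (S.arity σ.lhs) → Val K) = ⟨σ', t'⟩ := by
  obtain ⟨hlevel, hfact⟩ := h.2 σ' t' h'.1
  obtain ⟨hlevel', hfact'⟩ := h'.2 σ t h.1
  have hlevel_eq := hlevel.antisymm hlevel'
  obtain ⟨hle, hid⟩ := hfact hlevel_eq
  obtain ⟨hle', hid'⟩ := hfact' hlevel_eq.symm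
  have hfact_eq := ord.fact.le_antisymm _ _ hle hle'
  obtain rfl := ord.id.le_antisymm _ _ (hid hfact_eq) (hid' hfact_eq.symm)
  rw [Atom.mk_inj.1 hfact_eq]

theorem chaseStep_rightUnique : Relator.RightUnique (ChaseStep ord I J) := by
  intro st st₁ st₂ h₁ h₂
  cases h₁ with
  | kd _ κ t t' hsel happ =>
    cases h₂ with
    | kd _ κ' s s' hsel' happ' =>
      cases hsel.unique hsel'
      exact Option.some.inj (happ.symm.trans happ')
    | id _ _ hkd => exact absurd hsel.1 (hkd κ t t')
  | id σ t hkd hsel =>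
    cases h₂ with
    | kd _ κ' s s' hsel' => exact absurd hsel'.1 (hkd κ' s s')
    | id σ' t' _ hsel' =>
      cases hsel.unique hsel'
      rfl

theorem exists_eq_chaseSeq_of_reachable
    (h : ReflTransGen (ChaseStep ord I J) (ChaseState.init D) st) :
    ∃ m, st = chaseSeq ord I J D m := by
  induction h with
  | refl => exact ⟨0, rfl⟩
  | tail _ hstep ih =>
    obtain ⟨m, rfl⟩ := ih
    exact ⟨m + 1, chaseStep_rightUnique hstep (chaseStep_chaseSeq_succ ⟨_, hstep⟩)⟩

theorem IDSelected.chaseStep (h : IDSelected ord I st σ t) :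
    ChaseStep ord I ∅ st (idApply st σ t) :=
  .id st σ t (fun _ _ _ hκ => hκ.1) h

theorem ChaseStep.exists_idSelected (h : ChaseStep ord I ∅ st st') :
    ∃ σ t, IDSelected ord I st σ t ∧ st' = idApply st σ t := by
  cases h with
  | kd _ κ t t' hsel => exact absurd hsel.1.1 (Set.notMem_empty κ)
  | id σ t _ hsel => exact ⟨σ, t, hsel, rfl⟩

theorem chaseExists_empty : ChaseExists ord I ∅ D :=
  fun _ _ κ _ _ h => absurd h.1.1 (Set.notMem_empty κ)

theorem facts_subset_of_reflTransGen (h : ReflTransGen (ChaseStep ord I ∅) st st') :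
    st.facts ⊆ st'.facts := by
  induction h with
  | refl => exact subset_rfl
  | tail _ hstep ih =>
    obtain ⟨σ, t, -, rfl⟩ := hstep.exists_idSelected
    exact ih.trans (Set.subset_insert _ _)

theorem level_eq_of_reflTransGen (hY : ∀ σ ∈ I, Function.Injective σ.Y)
    (h : ReflTransGen (ChaseStep ord I ∅) st st') {A : Atom S (Val K)} (hA : A ∈ st.facts) :
    st'.level A = st.level A := by
  induction h with
  | refl => rfl
  | tail hst hstep ih =>
    obtain ⟨σ, t, hsel, rfl⟩ := hstep.exists_idSelected
    rw [hsel.1.1.idApply_level (hY σ hsel.1.1.1) (facts_subset_of_reflTransGen hst hA), ih]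

theorem next_le_of_reflTransGen (h : ReflTransGen (ChaseStep ord I ∅) st st') :
    st.next ≤ st'.next := by
  induction h with
  | refl => exact le_rfl
  | tail _ hstep ih =>
    obtain ⟨σ, t, -, rfl⟩ := hstep.exists_idSelected
    exact ih.trans (Nat.le_add_right _ _)

section LevelGap

/-- A bound for the number of facts over the values of a given fact: the number of ways to write
such a fact. -/
noncomputable def tupleBound (S : RelSchema) : ℕ :=
  Nat.card (Σ p₀ p : S.Pred, Fin (S.arity p) → Fin (S.arity p₀))

theorem ncard_le_tupleBound [Finite S.Pred] {T : Type*} (A : Atom S T) {G : Set (Atom S T)}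
    (hG : ∀ A' ∈ G, Set.range A'.args ⊆ Set.range A.args) : G.ncard ≤ tupleBound S := by
  let f : (Σ p₀ p : S.Pred, Fin (S.arity p) → Fin (S.arity p₀)) → Set (Atom S T) :=
    fun x => {A' | ∃ h : x.1 = A.pred, A' = ⟨x.2.1, fun i => A.args (h ▸ x.2.2 i)⟩}
  have hcode : ∀ A' : G, ∃ x, A'.1 ∈ f x := by
    rintro ⟨⟨p, u⟩, hA'⟩
    choose g hg using fun i => hG _ hA' ⟨i, rfl⟩
    exact ⟨⟨A.pred, p, g⟩, rfl, congrArg (Atom.mk p) (funext fun i => (hg i).symm)⟩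
  choose code hcode using hcode
  refine (Nat.card_coe_set_eq G).symm.trans_le (Nat.card_le_card_of_injective code ?_)
  intro A₁ A₂ h
  obtain ⟨h₁, hA₁⟩ := hcode A₁
  obtain ⟨h₂, hA₂⟩ := h ▸ hcode A₂
  exact Subtype.ext (hA₁.trans hA₂.symm)

/-- The number `b` is at most one more than the level of every violation. -/
def IsViolationBound (I : Set (IncDep S)) (st : ChaseState S K) (b : ℕ) : Prop :=
  ∀ σ t, IDApplicable I st σ t → b ≤ st.level ⟨σ.lhs, t⟩ + 1

/-- The fact `A` has been obtained, by means of full-width dependencies alone, from a fact whose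
level is at most one more than that of any violation. Since full-width dependencies create no
values, all the facts `G` on the way are over the values of `A`. -/
def HasLevelGap (I : Set (IncDep S)) (st : ChaseState S K) (A : Atom S (Val K)) : Prop :=
  ∃ b, IsViolationBound I st b ∧ ∃ G ⊆ st.facts,
    (∀ A' ∈ G, Set.range A'.args ⊆ Set.range A.args) ∧ st.level A + 1 ≤ b + G.ncard

theorem HasLevelGap.level_le [Finite S.Pred] {A : Atom S (Val K)} (h : HasLevelGap I st A)
    (ht : IDApplicable I st σ t) : st.level A ≤ st.level ⟨σ.lhs, t⟩ + tupleBound S := by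
  obtain ⟨b, hb, G, -, hrange, hcard⟩ := h
  have hbt := hb σ t ht
  have hG := ncard_le_tupleBound A hrange
  omega

theorem IsViolationBound.idApply {b : ℕ} (hb : IsViolationBound I st b)
    (hY : Function.Injective σ.Y) (happ : IDApplicable I st σ t) :
    IsViolationBound I (idApply st σ t) b := by
  intro σ' t' happ'
  rcases happ'.of_idApply with hnew | hold
  · rw [hnew, idApply_level_new]
    exact (hb σ t happ).trans (Nat.le_succ _)
  · rw [happ.idApply_level hY hold.2.1]
    exact hb σ' t' hold

theorem HasLevelGap.idApply {A : Atom S (Val K)} (h : HasLevelGap I st A) (hA : A ∈ st.facts)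
    (hY : Function.Injective σ.Y) (happ : IDApplicable I st σ t) :
    HasLevelGap I (idApply st σ t) A := by
  obtain ⟨b, hb, G, hG, hrange, hcard⟩ := h
  refine ⟨b, hb.idApply hY happ, G, hG.trans (Set.subset_insert _ _), hrange, ?_⟩
  rwa [happ.idApply_level hY hA]

theorem HasLevelGap.newFact_of_fullWidth (h : HasLevelGap I st ⟨σ.lhs, t⟩)
    (hst : st.facts.Finite) (hfull : σ.FullWidth) (happ : IDApplicable I st σ t) :
    HasLevelGap I (_root_.idApply st σ t) ⟨σ.rhs, newTuple st σ t⟩ := by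
  obtain ⟨b, hb, G, hG, hrange, hcard⟩ := h
  have hY := hfull.2.1
  have hlhs : Set.range t ⊆ Set.range (newTuple st σ t) := by
    rintro _ ⟨k, rfl⟩
    obtain ⟨i, rfl⟩ := hfull.1.2 k
    exact ⟨σ.Y i, newTuple_Y hY t i⟩
  refine ⟨b, hb.idApply hY happ, insert ⟨σ.rhs, newTuple st σ t⟩ G, Set.insert_subset_insert hG,
    ?_, ?_⟩
  · rintro A' (rfl | hA')
    exacts [subset_rfl, (hrange A' hA').trans hlhs]
  · rw [idApply_level_new, Set.ncard_insert_of_notMem (fun h => happ.newFact_notMem hY (hG h))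
      (hst.subset hG)]
    omega

theorem hasLevelGap_newFact_of_not_fullWidth (hY : Function.Injective σ.Y)
    (hsel : IDSelected ord I st σ t) (hfull : ¬ σ.FullWidth) :
    HasLevelGap I (idApply st σ t) ⟨σ.rhs, newTuple st σ t⟩ := by
  refine ⟨st.level ⟨σ.lhs, t⟩ + 1, ?_, {⟨σ.rhs, newTuple st σ t⟩}, ?_, ?_, ?_⟩
  · intro σ' t' happ'
    rcases happ'.of_idApply with hnew | hold
    · rw [hnew, idApply_level_new]
      omega
    · have hcand : IDCandidate I st σ' t' := ⟨hold, fun h => absurd (hsel.1.2 h) hfull⟩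
      rw [hsel.1.1.idApply_level hY hold.2.1]
      exact Nat.succ_le_succ (hsel.2 σ' t' hcand).1
  · exact Set.singleton_subset_iff.2 (.inl rfl)
  · rintro _ rfl
    exact subset_rfl
  · rw [idApply_level_new, Set.ncard_singleton]

theorem hasLevelGap_of_reachable (hY : ∀ σ ∈ I, Function.Injective σ.Y) (hD : D.Finite)
    (h : ReflTransGen (ChaseStep ord I ∅) (ChaseState.init D) st) :
    ∀ A ∈ st.facts, HasLevelGap I st A := by
  induction h with
  | refl =>
    refine fun A hA => ⟨0, fun _ _ _ => Nat.zero_le _, {A}, Set.singleton_subset_iff.2 hA, ?_, ?_⟩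
    · rintro _ rfl
      exact subset_rfl
    · exact (Set.ncard_singleton A).symm ▸ le_rfl
  | tail hst hstep ih =>
    obtain ⟨σ, t, hsel, rfl⟩ := hstep.exists_idSelected
    have happ := hsel.1.1
    have hYσ := hY σ happ.1
    rintro A (rfl | hA)
    · by_cases hfull : σ.FullWidth
      · exact (ih _ happ.2.1).newFact_of_fullWidth (finite_facts_of_reachable hD hst) hfull happ
      · exact hasLevelGap_newFact_of_not_fullWidth hYσ hsel hfull
    · exact (ih A hA).idApply hA hYσ happ

end LevelGap

section Witness

/-- The fact `σ.lhs(t)` has a witness for `σ` of level at most `b` more than its own. -/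
def HasCloseWitness (st : ChaseState S K) (b : ℕ) (σ : IncDep S)
    (t : Fin (S.arity σ.lhs) → Val K) : Prop :=
  ∃ t', (⟨σ.rhs, t'⟩ : Atom S (Val K)) ∈ st.facts ∧ (∀ i, t' (σ.Y i) = t (σ.X i)) ∧
    st.level ⟨σ.rhs, t'⟩ ≤ st.level ⟨σ.lhs, t⟩ + b

theorem HasCloseWitness.idApply {b : ℕ} {σ' : IncDep S} {t' : Fin (S.arity σ'.lhs) → Val K}
    (h : HasCloseWitness st b σ' t') (ht' : (⟨σ'.lhs, t'⟩ : Atom S (Val K)) ∈ st.facts)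
    (hY : Function.Injective σ.Y) (happ : IDApplicable I st σ t) :
    HasCloseWitness (idApply st σ t) b σ' t' := by
  obtain ⟨u, hu, hYX, hlevel⟩ := h
  refine ⟨u, .inr hu, hYX, ?_⟩
  rwa [happ.idApply_level hY hu, happ.idApply_level hY ht']

theorem idApplicable_or_hasCloseWitness_idApply [Finite S.Pred] (hY : Function.Injective σ.Y)
    (hgap : ∀ A ∈ st.facts, HasLevelGap I st A) (happ : IDApplicable I st σ t)
    (ih : ∀ σ' ∈ I, ∀ t', (⟨σ'.lhs, t'⟩ : Atom S (Val K)) ∈ st.facts →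
      IDApplicable I st σ' t' ∨ HasCloseWitness st (tupleBound S + 1) σ' t') {σ' : IncDep S}
    (hσ' : σ' ∈ I) {t' : Fin (S.arity σ'.lhs) → Val K}
    (ht' : (⟨σ'.lhs, t'⟩ : Atom S (Val K)) ∈ (idApply st σ t).facts) :
    IDApplicable I (idApply st σ t) σ' t' ∨
      HasCloseWitness (idApply st σ t) (tupleBound S + 1) σ' t' := by
  refine or_iff_not_imp_left.2 fun hno => ?_
  obtain ⟨u, hu, hYX⟩ := not_not.1 fun h => hno ⟨hσ', ht', h⟩
  rcases ht' with hnew | hold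
  · refine ⟨u, hu, hYX, ?_⟩
    rcases hu with hu | hu
    · rw [hnew, hu]
      exact Nat.le_add_right _ _
    · have hle := (hgap _ hu).level_le happ
      rw [hnew, idApply_level_new, happ.idApply_level hY hu]
      omega
  · rcases ih σ' hσ' t' hold with happ' | hwit
    · have hnewu := hu.resolve_right fun hu => happ'.2.2 ⟨u, hu, hYX⟩
      have hle := (hgap _ happ.2.1).level_le happ'
      refine ⟨u, hu, hYX, ?_⟩
      rw [hnewu, idApply_level_new, happ.idApply_level hY hold]
      omega
    · exact hwit.idApply hold hY happ

theorem idApplicable_or_hasCloseWitness_of_reachable [Finite S.Pred]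
    (hY : ∀ σ ∈ I, Function.Injective σ.Y) (hD : D.Finite)
    (h : ReflTransGen (ChaseStep ord I ∅) (ChaseState.init D) st) :
    ∀ σ ∈ I, ∀ t, (⟨σ.lhs, t⟩ : Atom S (Val K)) ∈ st.facts →
      IDApplicable I st σ t ∨ HasCloseWitness st (tupleBound S + 1) σ t := by
  induction h with
  | refl =>
    refine fun σ hσ t ht => or_iff_not_imp_left.2 fun hno => ?_
    obtain ⟨u, hu, hYX⟩ := not_not.1 fun h => hno ⟨hσ, ht, h⟩
    exact ⟨u, hu, hYX, Nat.zero_le _⟩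
  | tail hst hstep ih =>
    obtain ⟨σ₀, t₀, hsel, rfl⟩ := hstep.exists_idSelected
    exact fun σ hσ t ht => idApplicable_or_hasCloseWitness_idApply (hY σ₀ hsel.1.1.1)
      (hasLevelGap_of_reachable hY hD hst) hsel.1.1 ih hσ ht

theorem exists_reachable_hasCloseWitness [Finite S.Pred] (hY : ∀ σ ∈ I, Function.Injective σ.Y)
    (hD : D.Finite) (hσ : σ ∈ I) (h : ReflTransGen (ChaseStep ord I ∅) (ChaseState.init D) st)
    (ht : (⟨σ.lhs, t⟩ : Atom S (Val K)) ∈ st.facts) :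
    ∃ st', ReflTransGen (ChaseStep ord I ∅) st st' ∧
      HasCloseWitness st' (tupleBound S + 1) σ t := by
  obtain ⟨m, rfl⟩ := exists_eq_chaseSeq_of_reachable h
  have hreach (j) (hj : j ≥ m) : ReflTransGen (ChaseStep ord I ∅) (chaseSeq ord I ∅ D m)
      (chaseSeq ord I ∅ D j) := by
    induction j, hj using Nat.le_induction with
    | base => exact .refl
    | succ j _ ih =>
      rcases chaseStep_or_chaseSeq_succ_eq ord I ∅ D j with hstep | ⟨-, heq⟩
      exacts [ih.tail hstep, heq.symm ▸ ih]
  obtain ⟨j, hj, hno⟩ := exists_stage_not_idApplicable hY hD chaseExists_empty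
    fun j hj => (level_eq_of_reflTransGen hY (hreach j hj) ht).le
  exact ⟨_, hreach j hj, (idApplicable_or_hasCloseWitness_of_reachable hY hD
    (chaseSeq_reachable j) σ hσ t (facts_subset_of_reflTransGen (hreach j hj) ht)).resolve_left hno⟩

end Witness

end Inclusion

/-! ## The chase of the dummy database in Skolem terms -/

section Skolem

variable {S : RelSchema} {K K' : Type*}

/-- Apply a map to the innermost constant of a term. -/
def SkTerm.map (f : K → K') : SkTerm S K → SkTerm S K'
  | .base c => .base (f c)
  | .fn σ j τ => .fn σ j (τ.map f)

theorem SkTerm.ann_map (f : K → K') (τ : SkTerm S K) : (τ.map f).ann = τ.ann := by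
  induction τ with
  | base c => rfl
  | fn σ j τ ih => exact congrArg (SkTerm.fn σ j) ih

theorem SkTerm.root_map (f : K → K') (τ : SkTerm S K) : (τ.map f).root = f τ.root := by
  induction τ with
  | base c => rfl
  | fn _ _ _ ih => exact ih

/-- The shape of the inclusion dependencies of a conceptual schema: they are unary, or else every
attribute of the right-hand side occurs in them, so that only the unary ones create values. -/
structure UnaryOrFull (I : Set (IncDep S)) : Prop where
  injective : ∀ σ ∈ I, Function.Injective σ.Y
  width_pos : ∀ σ ∈ I, 0 < σ.width
  unary_or_surjective : ∀ σ ∈ I, σ.width = 1 ∨ Function.Surjective σ.Y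

variable {ord : ChaseOrder S (DummyConst S)} {I : Set (IncDep S)}
  {st st' : ChaseState S (DummyConst S)} {σ σ' : IncDep S}
  {t : Fin (S.arity σ.lhs) → Val (DummyConst S)} {t' : Fin (S.arity σ'.lhs) → Val (DummyConst S)}

theorem IDSelected.eq_or_next_add_arity_le (h : IDSelected ord I st σ t)
    (hst : ReflTransGen (ChaseStep ord I ∅) st st') :
    st = st' ∨ st.next + S.arity σ.rhs ≤ st'.next := by
  rcases hst.cases_head with heq | ⟨st₁, hstep, hst₁⟩
  · exact .inl heq
  · rw [← chaseStep_rightUnique h.chaseStep hstep] at hst₁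
    exact .inr (next_le_of_reflTransGen hst₁)

theorem DummyApplied.state_eq (h : DummyApplied ord I st σ t) (h' : DummyApplied ord I st' σ' t')
    {j : Fin (S.arity σ.rhs)} {j' : Fin (S.arity σ'.rhs)} (hj : st.next + j = st'.next + j') :
    st = st' := by
  rcases ReflTransGen.total_of_right_unique chaseStep_rightUnique h.1 h'.1 with hst | hst
  · exact (h.2.eq_or_next_add_arity_le hst).resolve_right fun hle => by have := j.2; omega
  · exact ((h'.2.eq_or_next_add_arity_le hst).resolve_right
      fun hle => by have := j'.2; omega).symm

theorem SkolemOf.eq_base_or_eq_fn {v : Val (DummyConst S)} {τ : SkTerm S (DummyConst S)}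
    (h : SkolemOf ord I v τ) :
    (∃ c, v = .dom c ∧ τ = .base c) ∨ ∃ st σ t i j τ', DummyApplied ord I st σ t ∧ σ.width = 1 ∧
      SkolemOf ord I (t (σ.X i)) τ' ∧ v = .fresh (st.next + (j : Fin (S.arity σ.rhs))) ∧
      τ = .fn σ j τ' := by
  cases h with
  | base c => exact .inl ⟨c, rfl, rfl⟩
  | fn st σ t i j τ' happ hwidth hj hτ' =>
    exact .inr ⟨st, σ, t, i, j, τ', happ, hwidth, hτ', newTuple_of_forall_ne hj, rfl⟩

theorem SkolemOf.unique {v : Val (DummyConst S)} {τ τ' : SkTerm S (DummyConst S)}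
    (h : SkolemOf ord I v τ) (h' : SkolemOf ord I v τ') : τ = τ' := by
  induction h generalizing τ' with
  | base c =>
    rcases h'.eq_base_or_eq_fn with ⟨c', hc, rfl⟩ | ⟨_, _, _, _, _, _, -, -, -, hv, -⟩
    · rw [Val.dom.inj hc]
    · cases hv
  | fn st σ t i j τ happ hwidth hY _ ih =>
    rw [newTuple_of_forall_ne hY] at h'
    rcases h'.eq_base_or_eq_fn with
      ⟨_, hc, -⟩ | ⟨st', σ', t', i', j', τ'', happ', -, hτ'', hv, rfl⟩
    · cases hc
    · have hnext := Val.fresh.inj hv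
      obtain rfl := happ.state_eq happ' hnext
      cases happ.2.unique happ'.2
      obtain rfl : j = j' := Fin.ext (Nat.add_left_cancel hnext)
      obtain rfl : i = i' := by
        have := i.2
        have := i'.2
        exact Fin.ext (by omega)
      rw [ih hτ'']

theorem SkolemOf.eq_of_newTuple_Y {st : ChaseState S (DummyConst S)} {σ : IncDep S}
    (hY : Function.Injective σ.Y) {t : Fin (S.arity σ.lhs) → Val (DummyConst S)} {i : Fin σ.width}
    {τ τ' : SkTerm S (DummyConst S)} (h : SkolemOf ord I (newTuple st σ t (σ.Y i)) τ)
    (h' : SkolemOf ord I (t (σ.X i)) τ') : τ = τ' := by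
  rw [newTuple_Y hY] at h
  exact h.unique h'

theorem finite_dummyDB [Finite S.Pred] : (dummyDB S).Finite := Set.finite_range _

/-- All the innermost constants come from the same fact of the dummy database, because every unary
dependency passes on a single value and the others create none. -/
theorem exists_skolemOf_of_reachable (hI : UnaryOrFull I)
    (h : ReflTransGen (ChaseStep ord I ∅) (ChaseState.init (dummyDB S)) st) :
    ∀ A ∈ st.facts, ∃ (a : Fin (S.arity A.pred) → SkTerm S (DummyConst S)) (p : S.Pred),
      (∀ i, SkolemOf ord I (A.args i) (a i)) ∧ ∀ i, (a i).root.1 = p := by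
  induction h with
  | refl =>
    rintro _ ⟨_, ⟨p, rfl⟩, rfl⟩
    exact ⟨fun i => .base ⟨p, i⟩, p, fun i => .base _, fun i => rfl⟩
  | @tail st _ hst hstep ih =>
    obtain ⟨σ, t, hsel, rfl⟩ := hstep.exists_idSelected
    rintro A (rfl | hA)
    · obtain ⟨hσ, ht, -⟩ := hsel.1.1
      obtain ⟨a, p, ha, hp⟩ := ih _ ht
      have hnew (j) : ∃ τ, SkolemOf ord I (newTuple st σ t j) τ ∧ τ.root.1 = p := by
        by_cases hj : ∃ i, σ.Y i = j
        · obtain ⟨i, rfl⟩ := hj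
          rw [newTuple_Y (hI.injective σ hσ)]
          exact ⟨a (σ.X i), ha _, hp _⟩
        · have hwidth := (hI.unary_or_surjective σ hσ).resolve_right fun hsurj => hj (hsurj j)
          exact ⟨_, .fn st σ t ⟨0, hI.width_pos σ hσ⟩ j _ ⟨hst, hsel⟩ hwidth (not_exists.1 hj)
            (ha _), hp _⟩
      choose b hb hbp using hnew
      exact ⟨b, p, hb, hbp⟩
    · exact ih A hA

/-- The atom `p(a₁,…,a_m)`, in Skolem terms, is a fact of level `l` of the chase of the dummy
database. -/
def IsDummyFact (ord : ChaseOrder S (DummyConst S)) (I : Set (IncDep S)) (l : ℕ) (p : S.Pred)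
    (a : Fin (S.arity p) → SkTerm S (DummyConst S)) : Prop :=
  ∃ st t, ReflTransGen (ChaseStep ord I ∅) (ChaseState.init (dummyDB S)) st ∧
    (⟨p, t⟩ : Atom S (Val (DummyConst S))) ∈ st.facts ∧ st.level ⟨p, t⟩ = l ∧
    ∀ i, SkolemOf ord I (t i) (a i)

theorem IsDummyFact.exists_witness [Finite S.Pred] (hI : UnaryOrFull I) (hσ : σ ∈ I) {l : ℕ}
    {a : Fin (S.arity σ.lhs) → SkTerm S (DummyConst S)} (ha : IsDummyFact ord I l σ.lhs a)
    {p : S.Pred} (hp : ∀ i, (a i).root.1 = p) :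
    ∃ l' ≤ l + (tupleBound S + 1), ∃ a', IsDummyFact ord I l' σ.rhs a' ∧
      (∀ i, (a' i).root.1 = p) ∧ ∀ i, a (σ.X i) = a' (σ.Y i) := by
  obtain ⟨st, u, hst, hu, rfl, ha⟩ := ha
  obtain ⟨st', hst', u', hu', hYX, hlevel⟩ :=
    exists_reachable_hasCloseWitness hI.injective finite_dummyDB hσ hst hu
  obtain ⟨a', p', ha', hp'⟩ := exists_skolemOf_of_reachable hI (hst.trans hst') _ hu'
  have haY (i) : a (σ.X i) = a' (σ.Y i) :=
    (ha _).unique ((congrArg (SkolemOf ord I · _) (hYX i)).mp (ha' (σ.Y i)))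
  obtain rfl : p' = p := by
    rw [← hp' (σ.Y ⟨0, hI.width_pos σ hσ⟩), ← haY, hp]
  rw [level_eq_of_reflTransGen hI.injective hst' hu] at hlevel
  exact ⟨_, hlevel, a', ⟨st', u', hst.trans hst', hu', rfl, ha'⟩, hp', haY⟩

/-- The instances over `D` of the facts of level at most `l` of the chase of the dummy database: the
constants of the dummy fact for `p` are replaced by those of a fact `p(f)` of `D`. -/
def dummyInstances (ord : ChaseOrder S (DummyConst S)) (I : Set (IncDep S)) (D : Set (Atom S K))
    (l : ℕ) : Set (Atom S (SkTerm S K)) :=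
  {A | ∃ (p : S.Pred) (f : DummyConst S → K), (⟨p, fun i => f ⟨p, i⟩⟩ : Atom S K) ∈ D ∧
    ∃ l' ≤ l, ∃ a : Fin (S.arity A.pred) → SkTerm S (DummyConst S),
      IsDummyFact ord I l' A.pred a ∧ (∀ i, (a i).root.1 = p) ∧ A.args = fun i => (a i).map f}

theorem dummyInstances_mono (D : Set (Atom S K)) : Monotone (dummyInstances ord I D) := by
  rintro l₁ l₂ hl A ⟨p, f, hD, l', hl', h⟩
  exact ⟨p, f, hD, l', hl'.trans hl, h⟩

theorem exists_extend_attributes [Nonempty K] {p : S.Pred} (c : Fin (S.arity p) → K) :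
    ∃ f : DummyConst S → K, ∀ i, f ⟨p, i⟩ = c i := by
  have hinj : Function.Injective fun i => (⟨p, i⟩ : DummyConst S) :=
    sigma_mk_injective (β := fun p => Fin (S.arity p))
  exact ⟨_, fun i => hinj.extend_apply c (Function.const _ (Classical.arbitrary K)) i⟩

theorem map_base_mem_dummyInstances [Nonempty K] {D : Set (Atom S K)} {A : Atom S K} (hA : A ∈ D) :
    A.map SkTerm.base ∈ dummyInstances ord I D 0 := by
  obtain ⟨f, hf⟩ := exists_extend_attributes A.args
  have hargs : (fun i => f ⟨A.pred, i⟩) = A.args := funext hf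
  refine ⟨A.pred, f, hargs.symm ▸ hA, 0, le_rfl, fun i => .base ⟨A.pred, i⟩,
    ⟨_, fun i => .dom ⟨A.pred, i⟩, .refl, ⟨_, ⟨A.pred, rfl⟩, rfl⟩, rfl, fun i => .base _⟩,
    fun i => rfl, ?_⟩
  exact funext fun i => congrArg SkTerm.base (hf i).symm

theorem exists_witness_mem_dummyInstances [Finite S.Pred] (hI : UnaryOrFull I)
    {D : Set (Atom S K)} (hσ : σ ∈ I) {l : ℕ} {t : Fin (S.arity σ.lhs) → SkTerm S K}
    (ht : (⟨σ.lhs, t⟩ : Atom S (SkTerm S K)) ∈ dummyInstances ord I D l) :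
    ∃ t', (⟨σ.rhs, t'⟩ : Atom S (SkTerm S K)) ∈
        dummyInstances ord I D (l + (tupleBound S + 1)) ∧ ∀ i, t (σ.X i) = t' (σ.Y i) := by
  obtain ⟨p, f, hD, l', hl', a, ha, hp, ht⟩ := ht
  obtain ⟨l'', hl'', a', ha', hp', haY⟩ := ha.exists_witness hI hσ hp
  exact ⟨fun i => (a' i).map f, ⟨p, f, hD, l'', by omega, a', ha', hp', rfl⟩, fun i =>
    (congrFun ht _).trans (congrArg (SkTerm.map f) (haY i))⟩

end Skolem

/-! ## Derivations of the rewriting, in Skolem terms -/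

section Assignment

variable {S : RelSchema} {V T : Type*}

/-- Extend a tuple to all positions by a default value. -/
def padTuple (d : T) {m : ℕ} (u : Fin m → T) (i : ℕ) : T :=
  if h : i < m then u ⟨i, h⟩ else d

theorem padTuple_val (d : T) {m : ℕ} (u : Fin m → T) (i : Fin m) : padTuple d u i = u i :=
  dif_pos i.2

theorem padTuple_induction {P : T → Prop} {d : T} {m : ℕ} {u : Fin m → T} (hd : P d)
    (hu : ∀ i, P (u i)) (i : ℕ) : P (padTuple d u i) := by
  unfold padTuple
  split_ifs with h
  exacts [hu _, hd]

/-- The assignment for the variables of the rewriting that sends the variables of the query to `g`,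
the new variables `X_{k,i}` to `u k i`, and all others to `d`. -/
def RVar.assign (d : T) (g : V → T) (u : ℕ → ℕ → T) : RVar S V → T
  | .orig x => g x
  | .new k i => u k i
  | .dummy _ => d

theorem RVar.assign_induction {P : T → Prop} {d : T} {g : V → T} {u : ℕ → ℕ → T} (hd : P d)
    (hg : ∀ x, P (g x)) (hu : ∀ k i, P (u k i)) (x : RVar S V) : P (x.assign d g u) := by
  cases x with
  | orig x => exact hg x
  | new k i => exact hu k i
  | dummy c => exact hd

end Assignment

section Derivation

variable {S : RelSchema} {V K : Type*} {n : ℕ}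

/-- The annotated fact that stands for a fact over Skolem terms: the annotation records the function
symbols, and the arguments are the innermost constants. -/
def termAtom (A : Atom (baseSchema S n) (SkTerm S K)) : Atom (annSchema S n) K :=
  ⟨AnnPred.ann A.pred fun i => (A.args i).ann, fun i => (A.args i).root⟩

/-- The value of a term of a rule when its variables stand for Skolem terms. -/
def DTerm.skolem {W : Type*} (β : W → SkTerm S K) : DTerm W K → SkTerm S K
  | .var x => β x
  | .const c => .base c

theorem annAtom_congr {b : BasePred S} {η η' : Fin ((baseSchema S n).arity b) → Ann S}
    {c c' : Fin ((baseSchema S n).arity b) → K} (h : η = η') (h' : c = c') :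
    (⟨AnnPred.ann b η, c⟩ : Atom (annSchema S n) K) = ⟨AnnPred.ann b η', c'⟩ := by
  subst h h'
  rfl

theorem annotate_map_eval {W : Type*} (β : W → SkTerm S K)
    (A : Atom (baseSchema S n) (DTerm W K)) :
    (A.annotate fun x => (β x).ann).map (DTerm.eval fun x => (β x).root) =
      termAtom (A.map (DTerm.skolem β)) := by
  have hann (u : DTerm W K) : u.annBy (fun x => (β x).ann) = (u.skolem β).ann := by cases u <;> rfl
  have hroot (u : DTerm W K) : u.eval (fun x => (β x).root) = (u.skolem β).root := by
    cases u <;> rfl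
  exact annAtom_congr (funext fun _ => hann _) (funext fun _ => hroot _)

theorem map_eqAtom {T T' : Type*} (g : T → T') (a b : T) :
    (eqAtom S n a b).map g = eqAtom S n (g a) (g b) :=
  congrArg (Atom.mk (S := baseSchema S n) BasePred.eq)
    (funext (Fin.forall_fin_two.2 ⟨rfl, rfl⟩ : ∀ i : Fin 2, g (![a, b] i) = ![g a, g b] i))

theorem map_relAtom {T T' : Type*} {g : T → T'} {p : S.Pred} {u : Fin (S.arity p) → T}
    {t : Fin (S.arity p) → T'} (h : ∀ j, g (u j) = t j) :
    (relAtom n p u).map g = relAtom n p t :=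
  congrArg (Atom.mk (S := baseSchema S n) (BasePred.rel p)) (funext h)

/-- The annotation of a Skolem term is available for the rewriting. -/
def TermAvailable (V : Type*) (n : ℕ) (ord : ChaseOrder S (DummyConst S)) (I : Set (IncDep S))
    (N : ℕ) (τ : SkTerm S K) : Prop :=
  AnnAvailable V K n ord I N τ.ann

section Rules

variable (ord : ChaseOrder S (DummyConst S)) (I : Set (IncDep S)) (J : Set (KeyDep S))
  (q : CQ S V K n) (N : ℕ) (D : Set (Atom S K))

/-- The rewriting derives a fact over Skolem terms. -/
def Derives (A : Atom (baseSchema S n) (SkTerm S K)) : Prop :=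
  LeastModel (finProgram ord I J q N) (plainFacts n D) (termAtom A)

/-- The rewriting derives an equation between terms whose annotations are available to it. -/
def DerivesEq (τ τ' : SkTerm S K) : Prop :=
  TermAvailable V n ord I N τ ∧ TermAvailable V n ord I N τ' ∧
    Derives ord I J q N D (eqAtom S n τ τ')

end Rules

variable {ord : ChaseOrder S (DummyConst S)} {I : Set (IncDep S)} {J : Set (KeyDep S)}
  {q : CQ S V K n} {N : ℕ} {D : Set (Atom S K)}

theorem Derives.rule {ρ : Rule (baseSchema S n) (RVar S V) K}
    (hρ : IsKDRule J ρ ∨ IsEqRule ρ ∨ ρ = q.maquillage) {β : RVar S V → SkTerm S K}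
    (hβ : ∀ x, TermAvailable V n ord I N (β x))
    (h : ∀ A ∈ ρ.body, Derives ord I J q N D (A.map (DTerm.skolem β))) :
    Derives ord I J q N D (ρ.head.map (DTerm.skolem β)) := by
  have hbody : ∀ A ∈ (ρ.annotate fun x => (β x).ann).body, LeastModel (finProgram ord I J q N)
      (plainFacts n D) (A.map (DTerm.eval fun x => (β x).root)) := by
    refine List.forall_mem_map.2 fun A hA => ?_
    rw [annotate_map_eval]
    exact h A hA
  have hhead := LeastModel.rule _ _ (.inr ⟨ρ, _, hρ, hβ, rfl⟩) hbody
  rwa [Rule.annotate, annotate_map_eval] at hhead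

theorem termAvailable_base (c : K) : TermAvailable V n ord I N (.base c : SkTerm S K) := .inl rfl

section Equality

variable {τ τ' τ'' : SkTerm S K}

theorem DerivesEq.symm (h : DerivesEq ord I J q N D τ τ') : DerivesEq ord I J q N D τ' τ := by
  have hpad := padTuple_induction (u := ![τ, τ']) h.1 (Fin.forall_fin_two.2 ⟨h.1, h.2.1⟩)
  have hder := Derives.rule (q := q) (J := J) (D := D) (.inr (.inl .symm))
    (RVar.assign_induction h.1 (fun _ => h.1) fun _ => hpad)
    (List.forall_mem_singleton.2 (by rw [map_eqAtom]; exact h.2.2))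
  rw [map_eqAtom] at hder
  exact ⟨h.2.1, h.1, hder⟩

theorem DerivesEq.trans (h : DerivesEq ord I J q N D τ τ') (h' : DerivesEq ord I J q N D τ' τ'') :
    DerivesEq ord I J q N D τ τ'' := by
  have hpad := padTuple_induction (u := ![τ, τ', τ'']) h.1
    (Fin.forall_fin_succ.2 ⟨h.1, Fin.forall_fin_two.2 ⟨h.2.1, h'.2.1⟩⟩)
  have hder := Derives.rule (q := q) (J := J) (D := D) (.inr (.inl .trans))
    (RVar.assign_induction h.1 (fun _ => h.1) fun _ => hpad)
    (List.forall_mem_cons.2 ⟨by rw [map_eqAtom]; exact h.2.2,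
      List.forall_mem_singleton.2 (by rw [map_eqAtom]; exact h'.2.2)⟩)
  rw [map_eqAtom] at hder
  exact ⟨h.1, h'.2.1, hder⟩

theorem derivesEq_refl [Nonempty K] {p : S.Pred} {t : Fin (S.arity p) → SkTerm S K}
    (hav : ∀ i, TermAvailable V n ord I N (t i))
    (h : Derives ord I J q N D (relAtom n p t)) (i : Fin (S.arity p)) :
    DerivesEq ord I J q N D (t i) (t i) := by
  let d : SkTerm S K := .base (Classical.arbitrary K)
  let β : RVar S V → SkTerm S K := RVar.assign d (fun _ => d) fun _ => padTuple d t
  have hβ (j : Fin (S.arity p)) : DTerm.skolem β (nv S V K 0 j) = t j := padTuple_val d t j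
  have hder := Derives.rule (q := q) (J := J) (D := D) (.inr (.inl (.refl p i)))
    (RVar.assign_induction (termAvailable_base _) (fun _ => termAvailable_base _) fun _ =>
      padTuple_induction (termAvailable_base _) hav)
    (by rwa [List.forall_mem_singleton, map_relAtom hβ])
  rw [map_eqAtom, hβ] at hder
  exact ⟨hav i, hav i, hder⟩

theorem derivesEq_of_key [Nonempty K] {κ : KeyDep S} (hκ : κ ∈ J) {k : Fin (S.arity κ.pred)}
    (hk : κ.key = {k}) {t t' : Fin (S.arity κ.pred) → SkTerm S K}
    (hav : ∀ i, TermAvailable V n ord I N (t i))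
    (hav' : ∀ i, TermAvailable V n ord I N (t' i))
    (h : Derives ord I J q N D (relAtom n κ.pred t))
    (h' : Derives ord I J q N D (relAtom n κ.pred t'))
    (heq : DerivesEq ord I J q N D (t k) (t' k)) (i : Fin (S.arity κ.pred)) :
    DerivesEq ord I J q N D (t i) (t' i) := by
  by_cases hik : i = k
  · rwa [hik]
  let d : SkTerm S K := .base (Classical.arbitrary K)
  let u : ℕ → ℕ → SkTerm S K
    | 0 => padTuple d t
    | _ + 1 => padTuple d t'
  let β : RVar S V → SkTerm S K := RVar.assign d (fun _ => d) u
  have hβ₀ (j : Fin (S.arity κ.pred)) : DTerm.skolem β (nv S V K 0 j) = t j := padTuple_val d t j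
  have hβ₁ (j : Fin (S.arity κ.pred)) : DTerm.skolem β (nv S V K 1 j) = t' j := padTuple_val d t' j
  have hu : ∀ k i, TermAvailable V n ord I N (u k i)
    | 0 => padTuple_induction (termAvailable_base _) hav
    | _ + 1 => padTuple_induction (termAvailable_base _) hav'
  have hder := Derives.rule (q := q) (J := J) (D := D) (β := β) (.inl (.mk κ k i hκ hk hik))
    (RVar.assign_induction (termAvailable_base _) (fun _ => termAvailable_base _) hu)
    (by
      rw [List.forall_mem_cons, List.forall_mem_cons, List.forall_mem_singleton, map_relAtom hβ₀,
        map_relAtom hβ₁, map_eqAtom, hβ₀, hβ₁]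
      exact ⟨h, h', heq.2.2⟩)
  rw [map_eqAtom, hβ₀, hβ₁] at hder
  exact ⟨hav i, hav' i, hder⟩

theorem derives_queryAtom [Nonempty K] {g : V → SkTerm S K}
    (hg : ∀ x, TermAvailable V n ord I N (g x))
    {u : ∀ A : Atom S (DTerm V K), Fin (S.arity A.pred) → SkTerm S K}
    (hu : ∀ A ∈ q.body, Derives ord I J q N D (relAtom n A.pred (u A)))
    (heq : ∀ A ∈ q.body, ∀ i, DerivesEq ord I J q N D (u A i) (DTerm.skolem g (A.args i))) :
    Derives ord I J q N D (queryAtom S fun i => g (q.head i)) := by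
  let d : SkTerm S K := .base (Classical.arbitrary K)
  let v (a : ℕ) : ℕ → SkTerm S K := q.body[a]?.elim (fun _ => d) fun A => padTuple d (u A)
  let β : RVar S V → SkTerm S K := RVar.assign d g v
  have hnew {a A} (hA : q.body[a]? = some A) (i : Fin (S.arity A.pred)) :
      DTerm.skolem β (nv S V K a i) = u A i := by
    change v a i = u A i
    simp only [v, hA, Option.elim_some, padTuple_val]
  have horig (x : DTerm V K) : DTerm.skolem β x.orig = x.skolem g := by cases x <;> rfl
  have hv (a i) : TermAvailable V n ord I N (v a i) := by
    cases hA : q.body[a]? with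
    | none => simpa only [v, hA, Option.elim_none] using termAvailable_base _
    | some A =>
      simpa only [v, hA, Option.elim_some] using padTuple_induction (termAvailable_base _)
        (fun j => (heq A (List.mem_of_getElem? hA) j).1) i
  refine Derives.rule (q := q) (β := β) (.inr (.inr rfl))
    (RVar.assign_induction (termAvailable_base _) hg hv) ?_
  refine List.forall_mem_flatMap.2 fun ⟨A, a⟩ hAa => ?_
  have hget : q.body[a]? = some A := List.mem_zipIdx_iff_getElem?.1 hAa
  have hA := List.mem_of_getElem? hget
  refine List.forall_mem_cons.2 ⟨?_, List.forall_mem_map.2 fun i _ => ?_⟩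
  · rw [map_relAtom (hnew hget)]
    exact hu A hA
  · rw [map_eqAtom, hnew hget, horig]
    exact (heq A hA i).2.2

end Equality

section DummyChase

variable [Nonempty K]

theorem derives_of_mem {p : S.Pred} {c : Fin (S.arity p) → K} (hc : (⟨p, c⟩ : Atom S K) ∈ D) :
    Derives ord I J q N D (relAtom n p fun i => .base (c i)) := by
  let d := Classical.arbitrary K
  let θ : RVar S V → K := RVar.assign d (fun _ => d) fun _ => padTuple d c
  have hθ : (fun i : Fin (S.arity p) => DTerm.eval θ (nv S V K 0 i)) = c :=
    funext (padTuple_val d c)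
  have hfact : LeastModel (finProgram ord I J q N) (plainFacts n D)
      ⟨AnnPred.plain (.rel p), fun i : Fin (S.arity p) => DTerm.eval θ (nv S V K 0 i)⟩ :=
    .fact _ ⟨_, hc, congrArg (Atom.mk (S := annSchema S n) (.plain (.rel p))) hθ.symm⟩
  have hder := LeastModel.rule (P := finProgram ord I J q N) _ θ
    (Or.inl (Or.inr (IsBaseRule.mk (.rel p) nofun))) (List.forall_mem_singleton.2 hfact)
  have heq : termAtom (relAtom n p fun i => .base (c i)) =
      (⟨.ann (.rel p) fun _ => Ann.bullet, fun i : Fin (S.arity p) =>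
        DTerm.eval θ (nv S V K 0 i)⟩ : Atom (annSchema S n) K) := annAtom_congr rfl hθ.symm
  exact (congrArg (LeastModel _ _) heq).mpr hder

theorem derives_of_isDummyRule {p p' : S.Pred} {a : Fin (S.arity p) → SkTerm S (DummyConst S)}
    {a' : Fin (S.arity p') → SkTerm S (DummyConst S)}
    (hρ : IsDummyRule (V := V) (K := K) ord I N
      ⟨annotatedVersion V K n p' a', [annotatedVersion V K n p a]⟩) (f : DummyConst S → K)
    (h : Derives ord I J q N D (relAtom n p fun i => (a i).map f)) :
    Derives ord I J q N D (relAtom n p' fun i => (a' i).map f) := by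
  let θ : RVar S V → K
    | .dummy c => f c
    | _ => Classical.arbitrary K
  have hversion {p : S.Pred} (a : Fin (S.arity p) → SkTerm S (DummyConst S)) :
      termAtom (relAtom n p fun i => (a i).map f) =
        (annotatedVersion V K n p a).map (DTerm.eval θ) :=
    annAtom_congr (funext fun i => SkTerm.ann_map f (a i))
      (funext fun i => SkTerm.root_map f (a i))
  unfold Derives at h ⊢
  rw [hversion] at h ⊢
  exact LeastModel.rule (P := finProgram ord I J q N) ⟨_, [_]⟩ θ (Or.inl (Or.inl hρ))
    (List.forall_mem_singleton.2 h)

theorem derives_of_reachable (hI : UnaryOrFull I) (hS : ∀ p, 0 < S.arity p) {p : S.Pred}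
    {f : DummyConst S → K} (hD : (⟨p, fun i => f ⟨p, i⟩⟩ : Atom S K) ∈ D)
    {st : ChaseState S (DummyConst S)}
    (h : ReflTransGen (ChaseStep ord I ∅) (ChaseState.init (dummyDB S)) st) :
    ∀ A ∈ st.facts, st.level A ≤ N → ∀ a : Fin (S.arity A.pred) → SkTerm S (DummyConst S),
      (∀ i, SkolemOf ord I (A.args i) (a i)) → (∀ i, (a i).root.1 = p) →
      (∀ i, AnnAvailable V K n ord I N (a i).ann) ∧
        Derives ord I J q N D (relAtom n A.pred fun i => (a i).map f) := by
  induction h with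
  | refl =>
    rintro _ ⟨_, ⟨p', rfl⟩, rfl⟩ - a ha hp
    obtain rfl : a = fun i => .base ⟨p', i⟩ := funext fun i => (ha i).unique (.base _)
    obtain rfl : p' = p := hp ⟨0, hS p'⟩
    exact ⟨fun i => .inl rfl, derives_of_mem hD⟩
  | tail hst hstep ih =>
    obtain ⟨σ, t, hsel, rfl⟩ := hstep.exists_idSelected
    obtain ⟨hσ, ht, -⟩ := hsel.1.1
    have hY := hI.injective σ hσ
    rintro A (rfl | hA) hl a ha hp
    · obtain ⟨a₁, p₁, ha₁, hp₁⟩ := exists_skolemOf_of_reachable hI hst _ ht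
      let k : Fin σ.width := ⟨0, hI.width_pos σ hσ⟩
      have hroot : a (σ.Y k) = a₁ (σ.X k) := (ha (σ.Y k)).eq_of_newTuple_Y hY (ha₁ (σ.X k))
      obtain rfl : p₁ = p := by rw [← hp₁ (σ.X k), ← hroot, hp]
      rw [idApply_level_new] at hl
      have hrule := IsDummyRule.mk (N := N) (n := n) (V := V) (K := K) _ σ t a₁ a ⟨hst, hsel⟩ hl
        ha₁ ha
      exact ⟨fun i => .inr ⟨_, hrule, .inl ⟨_, _, rfl, i, rfl⟩⟩,
        derives_of_isDummyRule hrule f (ih _ ht (Nat.le_of_succ_le hl) a₁ ha₁ hp₁).2⟩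
    · rw [hsel.1.1.idApply_level hY hA] at hl
      exact ih A hA hl a ha hp

theorem derives_of_mem_dummyInstances (hI : UnaryOrFull I) (hS : ∀ p, 0 < S.arity p) {l : ℕ}
    (hl : l ≤ N) {A : Atom S (SkTerm S K)} (hA : A ∈ dummyInstances ord I D l) :
    (∀ i, TermAvailable V n ord I N (A.args i)) ∧
      Derives ord I J q N D (relAtom n A.pred A.args) := by
  obtain ⟨p, f, hD, l', hl', a, ⟨st, t, hst, ht, rfl, ha⟩, hp, hargs⟩ := hA
  obtain ⟨hav, hder⟩ := derives_of_reachable (V := V) (J := J) (q := q) hI hS hD hst _ ht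
    (hl'.trans hl) a ha hp
  rw [hargs]
  exact ⟨fun i => (congrArg (AnnAvailable V K n ord I N) (SkTerm.ann_map f (a i))).mpr (hav i),
    hder⟩

theorem gradedModel_dummyInstances [Finite S.Pred] (hI : UnaryOrFull I)
    (hS : ∀ p, 0 < S.arity p) (hJ : ∀ κ ∈ J, ∃ k, κ.key = {k}) (q : CQ S V K n) (N : ℕ) :
    GradedModel I J (dummyInstances ord I D) (DerivesEq ord I J q N D)
      (fun l => l + (tupleBound S + 1)) N where
  mono := dummyInstances_mono D
  le_F l := Nat.le_add_right _ _
  symm := DerivesEq.symm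
  trans := DerivesEq.trans
  refl l hl A hA i := by
    obtain ⟨hav, hder⟩ := derives_of_mem_dummyInstances (J := J) (q := q) hI hS hl hA
    exact derivesEq_refl hav hder i
  kd κ hκ l hl t t' ht ht' hkey i := by
    obtain ⟨k, hk⟩ := hJ κ hκ
    obtain ⟨hav, hder⟩ := derives_of_mem_dummyInstances (J := J) (q := q) hI hS hl ht
    obtain ⟨hav', hder'⟩ := derives_of_mem_dummyInstances (J := J) (q := q) hI hS hl ht'
    exact derivesEq_of_key hκ hk hav hav' hder hder' (hkey k (hk ▸ rfl)) i
  id σ hσ l t ht := exists_witness_mem_dummyInstances hI hσ ht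

end DummyChase

end Derivation

/-! ## Completeness for a single database -/

section Completeness

variable {S : RelSchema} {V K : Type*} {n : ℕ} {I : Set (IncDep S)}
  {J : Set (KeyDep S)} {D : Set (Atom S K)} {q : CQ S V K n} {t : Fin n → K}

theorem mem_evalProgram_of_isHomUpTo [Nonempty K] (hI : UnaryOrFull I) (hS : ∀ p, 0 < S.arity p)
    {ord : ChaseOrder S (DummyConst S)} {N l : ℕ} (hl : l ≤ N) {G : Set (Atom S (Val K))}
    {h : Val K → SkTerm S K}
    (hh : IsHomUpTo (dummyInstances ord I D l) (DerivesEq ord I J q N D) SkTerm.base G h)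
    {g : V → Val K} (hg : ∀ A ∈ q.body, A.map (DTerm.value g) ∈ G)
    (hgt : ∀ i, g (q.head i) = .dom (t i)) :
    t ∈ evalProgram (finProgram ord I J q N) D := by
  classical
  have hwit (A : Atom S (DTerm V K)) : ∃ u : Fin (S.arity A.pred) → SkTerm S K, A ∈ q.body →
      (⟨A.pred, u⟩ : Atom S (SkTerm S K)) ∈ dummyInstances ord I D l ∧
        ∀ i, DerivesEq ord I J q N D (u i) (h ((A.args i).value g)) := by
    by_cases hA : A ∈ q.body
    · obtain ⟨u, hu⟩ := hh.exists_mem _ (hg A hA)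
      exact ⟨u, fun _ => hu⟩
    · exact ⟨fun _ => .base (Classical.arbitrary K), fun hA' => absurd hA' hA⟩
  choose u hu using hwit
  let g' (x : V) : SkTerm S K :=
    if TermAvailable V n ord I N (h (g x)) then h (g x) else .base (Classical.arbitrary K)
  have hg' (x : V) : TermAvailable V n ord I N (g' x) := by
    unfold g'
    split_ifs with hx
    exacts [hx, termAvailable_base _]
  have hskolem (x : DTerm V K) (hx : TermAvailable V n ord I N (h (x.value g))) :
      x.skolem g' = h (x.value g) := by
    cases x with
    | var x => exact if_pos hx
    | const c => exact (hh.map_dom c).symm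
  have hhead (i : Fin n) : g' (q.head i) = .base (t i) := by
    have hval : h (g (q.head i)) = .base (t i) := by rw [hgt, hh.map_dom]
    exact (hskolem (.var (q.head i)) (hval ▸ termAvailable_base _)).trans hval
  have hder := derives_queryAtom (q := q) (D := D) hg'
    (fun A hA => (derives_of_mem_dummyInstances hI hS hl (hu A hA).1).2) fun A hA i => by
      have heq := (hu A hA).2 i
      rwa [hskolem _ heq.2.1]
  rwa [funext hhead] at hder

theorem exists_chaseSeq_match [Finite S.Pred] (hI : UnaryOrFull I) {ord : ChaseOrder S K}
    (hD : D.Finite) (hex : ChaseExists ord I J D) (ht : t ∈ certainAnswers I J q D) :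
    ∃ (m : ℕ) (g : V → Val K), (∀ i, g (q.head i) = .dom (t i)) ∧
      ∀ A ∈ q.body, A.map (DTerm.value g) ∈ (chaseSeq ord I J D m).facts := by
  obtain ⟨B, hBI, hBJ, hDB, hB⟩ := exists_chase_model hI.injective hD hex
  obtain ⟨g, hg, hgt⟩ := ht B hBI hBJ hDB
  obtain ⟨m, hm⟩ := hB ((fun A => A.map (DTerm.value g)) '' {A | A ∈ q.body})
    (by rintro _ ⟨A, hA, rfl⟩; exact hg A hA) (q.body.finite_toSet.image _)
  exact ⟨m, g, fun i => (congrFun hgt i).symm, fun A hA => hm ⟨A, hA, rfl⟩⟩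

theorem eventually_mem_evalProgram [Nonempty K] [Finite S.Pred] (hI : UnaryOrFull I)
    (hS : ∀ p, 0 < S.arity p) (hJ : ∀ κ ∈ J, ∃ k, κ.key = {k}) {ord : ChaseOrder S K}
    (hD : D.Finite) (hex : ChaseExists ord I J D) (ht : t ∈ certainAnswers I J q D) :
    ∀ᶠ N in Filter.atTop, ∀ ordB : ChaseOrder S (DummyConst S),
      t ∈ evalProgram (finProgram ordB I J q N) D := by
  obtain ⟨m, g, hgt, hg⟩ := exists_chaseSeq_match hI hD hex ht
  filter_upwards [Filter.eventually_ge_atTop ((fun l => l + (tupleBound S + 1))^[m] 0)]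
    with N hN ordB
  have : Nonempty (SkTerm S K) := ⟨.base (Classical.arbitrary K)⟩
  obtain ⟨h, hh⟩ := (gradedModel_dummyInstances (ord := ordB) (D := D) hI hS hJ q
    N).exists_isHomUpTo_chaseSeq (ord := ord) hI.injective
      (fun A hA => map_base_mem_dummyInstances hA) m hN
  exact mem_evalProgram_of_isHomUpTo hI hS hN hh hg hgt

end Completeness

/-! ## Soundness -/

section Soundness

variable {S : RelSchema} {V K K' : Type*} {n : ℕ} {I : Set (IncDep S)} {J : Set (KeyDep S)}
  {q : CQ S V K n} {B : Set (Atom S (Val K))}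

open Classical in
/-- The interpretation in `B` of the Skolem function `f_{σ,j}`: the `j`-th component of a chosen
witness for `σ`, and a junk value where `B` has no witness. -/
noncomputable def skolemFun (B : Set (Atom S (Val K))) (σ : IncDep S) (j : Fin (S.arity σ.rhs))
    (v : Val K) : Val K :=
  if h : ∃ t, (⟨σ.rhs, t⟩ : Atom S (Val K)) ∈ B ∧ ∀ i, t (σ.Y i) = v then h.choose j else v

theorem skolemFun_spec {σ : IncDep S} {v : Val K}
    (h : ∃ t, (⟨σ.rhs, t⟩ : Atom S (Val K)) ∈ B ∧ ∀ i, t (σ.Y i) = v) :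
    (⟨σ.rhs, fun j => skolemFun B σ j v⟩ : Atom S (Val K)) ∈ B ∧
      ∀ i, skolemFun B σ (σ.Y i) v = v := by
  simp only [skolemFun, dif_pos h]
  exact h.choose_spec

/-- The value in `B` of a Skolem term, given the values of the constants. -/
noncomputable def SkTerm.valueIn (B : Set (Atom S (Val K))) (s : K' → Val K) :
    SkTerm S K' → Val K
  | .base c => s c
  | .fn σ j τ => skolemFun B σ j (τ.valueIn B s)

theorem SkTerm.valueIn_ann (s : K' → Val K) (τ : SkTerm S K') :
    τ.ann.valueIn B (fun _ => s τ.root) = τ.valueIn B s := by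
  induction τ with
  | base c => rfl
  | fn σ j τ ih => exact congrArg (skolemFun B σ j) ih

/-- Truth in `B` of a fact over the predicates of the rewriting. -/
def BaseHolds (q : CQ S V K n) (B : Set (Atom S (Val K))) : Atom (baseSchema S n) (Val K) → Prop
  | ⟨.rel p, t⟩ => (⟨p, t⟩ : Atom S (Val K)) ∈ B
  | ⟨.eq, t⟩ => t (0 : Fin 2) = t (1 : Fin 2)
  | ⟨.query, t⟩ => t ∈ q.answers B

/-- Truth in `B` of a plain or annotated fact: an annotated argument stands for the value of its
Skolem term. -/
def AnnHolds (q : CQ S V K n) (B : Set (Atom S (Val K))) : Atom (annSchema S n) K → Prop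
  | ⟨.plain b, c⟩ => BaseHolds q B ⟨b, fun i => .dom (c i)⟩
  | ⟨.ann b η, c⟩ => BaseHolds q B ⟨b, fun i => (η i).valueIn B fun _ => .dom (c i)⟩

theorem annHolds_annotate {W : Type*} (α : W → Ann S) (θ : W → K)
    (A : Atom (baseSchema S n) (DTerm W K)) :
    AnnHolds q B ((A.annotate α).map (DTerm.eval θ)) ↔
      BaseHolds q B (A.map (DTerm.value fun x => (α x).valueIn B fun _ => .dom (θ x))) := by
  obtain ⟨b, t⟩ := A
  have hvalue (u : DTerm W K) : ((u.annBy α).valueIn B fun _ => .dom (u.eval θ)) =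
      u.value fun x => (α x).valueIn B fun _ => .dom (θ x) := by cases u <;> rfl
  exact iff_of_eq (congrArg (fun t => BaseHolds q B ⟨b, t⟩) (funext fun i => hvalue (t i)))

theorem annHolds_annotatedVersion (θ : RVar S V → K) (p : S.Pred)
    (a : Fin (S.arity p) → SkTerm S (DummyConst S)) :
    AnnHolds q B ((annotatedVersion V K n p a).map (DTerm.eval θ)) ↔
      (⟨p, fun i => (a i).valueIn B fun c => .dom (θ (.dummy c))⟩ : Atom S (Val K)) ∈ B :=
  iff_of_eq (congrArg (fun t => (⟨p, t⟩ : Atom S (Val K)) ∈ B)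
    (funext fun i => (a i).valueIn_ann fun c => .dom (θ (.dummy c))))

theorem baseHolds_eqAtom {a b : Val K} : BaseHolds q B (eqAtom S n a b) ↔ a = b := Iff.rfl

theorem baseHolds_relAtom {p : S.Pred} {t : Fin (S.arity p) → Val K} :
    BaseHolds q B (relAtom n p t) ↔ (⟨p, t⟩ : Atom S (Val K)) ∈ B := Iff.rfl

section BaseRules

variable {ρ : Rule (baseSchema S n) (RVar S V) K} {h : RVar S V → Val K}

theorem baseHolds_head_of_isKDRule (hJ : ∀ κ ∈ J, κ.Sat B) (hρ : IsKDRule J ρ)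
    (hbody : ∀ A ∈ ρ.body, BaseHolds q B (A.map (DTerm.value h))) :
    BaseHolds q B (ρ.head.map (DTerm.value h)) := by
  obtain ⟨κ, k, i, hκ, hk, -⟩ := hρ
  rw [List.forall_mem_cons, List.forall_mem_cons, List.forall_mem_singleton, map_eqAtom,
    baseHolds_eqAtom, map_relAtom fun _ => rfl, map_relAtom fun _ => rfl, baseHolds_relAtom,
    baseHolds_relAtom] at hbody
  obtain ⟨ht, ht', hkey⟩ := hbody
  rw [map_eqAtom, baseHolds_eqAtom]
  by_contra hne
  obtain ⟨k', hk', hne'⟩ := hJ κ hκ _ _ ht ht' fun heq => hne (congrFun heq i)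
  rw [hk] at hk'
  obtain rfl := hk'
  exact hne' hkey

theorem baseHolds_head_of_isEqRule (hρ : IsEqRule ρ)
    (hbody : ∀ A ∈ ρ.body, BaseHolds q B (A.map (DTerm.value h))) :
    BaseHolds q B (ρ.head.map (DTerm.value h)) := by
  cases hρ with
  | refl p i => rw [map_eqAtom, baseHolds_eqAtom]
  | symm =>
    rw [List.forall_mem_singleton, map_eqAtom, baseHolds_eqAtom] at hbody
    rw [map_eqAtom, baseHolds_eqAtom]
    exact hbody.symm
  | trans =>
    rw [List.forall_mem_cons, List.forall_mem_singleton, map_eqAtom, map_eqAtom, baseHolds_eqAtom,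
      baseHolds_eqAtom] at hbody
    rw [map_eqAtom, baseHolds_eqAtom]
    exact hbody.1.trans hbody.2

theorem baseHolds_head_maquillage
    (hbody : ∀ A ∈ q.maquillage.body, BaseHolds q B (A.map (DTerm.value h))) :
    BaseHolds q B (q.maquillage.head.map (DTerm.value h)) := by
  refine ⟨fun x => h (.orig x), fun A hA => ?_, rfl⟩
  obtain ⟨a, ha⟩ := List.mem_iff_getElem?.1 hA
  obtain ⟨hrel, heq⟩ := List.forall_mem_cons.1
    (List.forall_mem_flatMap.1 hbody (A, a) (List.mem_zipIdx_iff_getElem?.2 ha))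
  have hargs (i : Fin (S.arity A.pred)) :
      h (.new a i) = (A.args i).value fun x => h (.orig x) := by
    have hi := List.forall_mem_map.1 heq i (List.mem_finRange i)
    rw [map_eqAtom, baseHolds_eqAtom] at hi
    refine hi.trans ?_
    cases A.args i <;> rfl
  exact (congrArg (fun t => (⟨A.pred, t⟩ : Atom S (Val K)) ∈ B) (funext hargs)).mp hrel

theorem baseHolds_head (hJ : ∀ κ ∈ J, κ.Sat B)
    (hρ : IsKDRule J ρ ∨ IsEqRule ρ ∨ ρ = q.maquillage)
    (hbody : ∀ A ∈ ρ.body, BaseHolds q B (A.map (DTerm.value h))) :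
    BaseHolds q B (ρ.head.map (DTerm.value h)) := by
  rcases hρ with hρ | hρ | rfl
  exacts [baseHolds_head_of_isKDRule hJ hρ hbody, baseHolds_head_of_isEqRule hρ hbody,
    baseHolds_head_maquillage hbody]

end BaseRules

variable {ord : ChaseOrder S (DummyConst S)}

theorem mem_of_dummyApplied (hI : UnaryOrFull I) (hB : ∀ σ ∈ I, σ.Sat B)
    {st : ChaseState S (DummyConst S)} {σ : IncDep S}
    {t : Fin (S.arity σ.lhs) → Val (DummyConst S)} (happ : DummyApplied ord I st σ t)
    {a₁ : Fin (S.arity σ.lhs) → SkTerm S (DummyConst S)}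
    {a₂ : Fin (S.arity σ.rhs) → SkTerm S (DummyConst S)} (ha₁ : ∀ i, SkolemOf ord I (t i) (a₁ i))
    (ha₂ : ∀ j, SkolemOf ord I (newTuple st σ t j) (a₂ j)) {s : DummyConst S → Val K}
    (hlhs : (⟨σ.lhs, fun i => (a₁ i).valueIn B s⟩ : Atom S (Val K)) ∈ B) :
    (⟨σ.rhs, fun j => (a₂ j).valueIn B s⟩ : Atom S (Val K)) ∈ B := by
  have hσ : σ ∈ I := happ.2.1.1.1
  have hinherited (i) : a₂ (σ.Y i) = a₁ (σ.X i) :=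
    (ha₂ (σ.Y i)).eq_of_newTuple_Y (hI.injective σ hσ) (ha₁ (σ.X i))
  obtain ⟨t', ht', hXY⟩ := hB σ hσ _ hlhs
  by_cases hsurj : Function.Surjective σ.Y
  · have hargs : (fun j => (a₂ j).valueIn B s) = t' := by
      refine funext (hsurj.forall.2 fun i => ?_)
      rw [hinherited, ← hXY]
    rwa [hargs]
  · have hwidth : σ.width = 1 := (hI.unary_or_surjective σ hσ).resolve_right hsurj
    have : Subsingleton (Fin σ.width) := hwidth ▸ inferInstance
    let i₀ : Fin σ.width := ⟨0, hI.width_pos σ hσ⟩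
    obtain ⟨hmem, hfix⟩ := skolemFun_spec (v := (a₁ (σ.X i₀)).valueIn B s)
      ⟨t', ht', fun i => by rw [← hXY, Subsingleton.elim i i₀]⟩
    have hargs (j) : (a₂ j).valueIn B s = skolemFun B σ j ((a₁ (σ.X i₀)).valueIn B s) := by
      by_cases hj : ∃ i, σ.Y i = j
      · obtain ⟨i, rfl⟩ := hj
        rw [hfix i, hinherited, Subsingleton.elim i i₀]
      · have hfn : a₂ j = .fn σ j (a₁ (σ.X i₀)) := (ha₂ j).unique
          (.fn st σ t i₀ j _ happ hwidth (not_exists.1 hj) (ha₁ _))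
        rw [hfn]
        rfl
    rwa [funext hargs]

theorem annHolds_of_leastModel (hI : UnaryOrFull I) (hB : ∀ σ ∈ I, σ.Sat B)
    (hJ : ∀ κ ∈ J, κ.Sat B) {D : Set (Atom S K)} (hD : embedDB D ⊆ B) {N : ℕ}
    {A : Atom (annSchema S n) K}
    (hA : LeastModel (finProgram ord I J q N) (plainFacts n D) A) : AnnHolds q B A := by
  induction hA with
  | fact A hA =>
    obtain ⟨A, hA, rfl⟩ := hA
    exact hD ⟨A, hA, rfl⟩
  | rule ρ θ hρ _ ih =>
    rcases hρ with (hρ | hρ) | ⟨ρ₀, α, hρ₀, -, rfl⟩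
    · obtain ⟨st, σ, t, a₁, a₂, happ, -, ha₁, ha₂⟩ := hρ
      rw [List.forall_mem_singleton, annHolds_annotatedVersion] at ih
      exact (annHolds_annotatedVersion θ _ _).2 (mem_of_dummyApplied hI hB happ ha₁ ha₂ ih)
    · obtain ⟨b, -⟩ := hρ
      rw [List.forall_mem_singleton] at ih
      exact ih
    · refine (annHolds_annotate α θ ρ₀.head).2 (baseHolds_head hJ hρ₀ fun A hA => ?_)
      exact (annHolds_annotate α θ A).1 (List.forall_mem_map.1 ih A hA)

theorem evalProgram_subset_certainAnswers (hI : UnaryOrFull I)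
    (ord : ChaseOrder S (DummyConst S)) (J : Set (KeyDep S)) (q : CQ S V K n) (N : ℕ)
    (D : Set (Atom S K)) :
    evalProgram (finProgram ord I J q N) D ⊆ certainAnswers I J q D :=
  fun _ ht _ hB hJ hD => annHolds_of_leastModel hI hB hJ hD ht

end Soundness

/-! ## Certain answers depend on few components of the database -/

section Locality

variable {S : RelSchema} {V K Lab Idx W : Type*} {n : ℕ} {I : Set (IncDep S)}
  {J : Set (KeyDep S)} {D : Set (Atom S K)}

/-- The labelled product of a family of structures, in which the `x`-th factor only takes part in
the facts whose label is in `L x`. -/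
def labelledProduct (L : Idx → Set Lab) (B : Idx → Set (Atom S W)) (w₀ : W) :
    Set (Atom S (Lab × (Idx → W))) :=
  {A | ∃ ℓ, (∀ i, (A.args i).1 = ℓ) ∧ ∀ x, (ℓ ∈ L x → A.map (fun w => w.2 x) ∈ B x) ∧
    (ℓ ∉ L x → ∀ i, (A.args i).2 x = w₀)}

theorem IncDep.sat_labelledProduct {L : Idx → Set Lab} {B : Idx → Set (Atom S W)} {w₀ : W}
    {σ : IncDep S} (h : ∀ x, σ.Sat (B x)) : σ.Sat (labelledProduct L B w₀) := by
  rintro t ⟨ℓ, hℓ, ht⟩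
  have hwit (x) : ∃ t' : Fin (S.arity σ.rhs) → W,
      ((ℓ ∈ L x → (⟨σ.rhs, t'⟩ : Atom S W) ∈ B x) ∧ (ℓ ∉ L x → ∀ i, t' i = w₀)) ∧
        ∀ i, (t (σ.X i)).2 x = t' (σ.Y i) := by
    by_cases hx : ℓ ∈ L x
    · obtain ⟨t', ht', hXY⟩ := h x _ ((ht x).1 hx)
      exact ⟨t', ⟨fun _ => ht', fun hx' => absurd hx hx'⟩, hXY⟩
    · exact ⟨fun _ => w₀, ⟨fun hx' => absurd hx' hx, fun _ _ => rfl⟩, fun i => (ht x).2 hx _⟩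
  choose t' ht' hXY using hwit
  exact ⟨fun j => (ℓ, fun x => t' x j), ⟨ℓ, fun _ => rfl, ht'⟩,
    fun i => Prod.ext (hℓ _) (funext fun x => hXY x i)⟩

-- Labels are part of the values, so two facts that agree on the key have the same label.
theorem KeyDep.sat_labelledProduct {L : Idx → Set Lab} {B : Idx → Set (Atom S W)} {w₀ : W}
    {κ : KeyDep S} (hκ : κ.key.Nonempty) (h : ∀ x, κ.Sat (B x)) :
    κ.Sat (labelledProduct L B w₀) := by
  rintro t t' ⟨ℓ, hℓ, ht⟩ ⟨ℓ', hℓ', ht'⟩ hne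
  obtain ⟨k, hk⟩ := hκ
  by_contra! hkey
  obtain rfl : ℓ = ℓ' := by rw [← hℓ k, ← hℓ' k]; exact congrArg Prod.fst (hkey k hk)
  refine hne (funext fun i => Prod.ext ((hℓ i).trans (hℓ' i).symm) (funext fun x => ?_))
  by_cases hx : ℓ ∈ L x
  · by_contra hi
    obtain ⟨k', hk', hne'⟩ := h x _ _ ((ht x).1 hx) ((ht' x).1 hx) fun heq => hi (congrFun heq i)
    exact hne' (congrArg (fun w => w.2 x) (hkey k' hk'))
  · exact ((ht x).2 hx i).trans ((ht' x).2 hx i).symm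

/-- The facts of `D` all of whose constants have a label in `L`. -/
def labelRestrict (lab : K → Lab) (D : Set (Atom S K)) (L : Set Lab) : Set (Atom S K) :=
  {A | A ∈ D ∧ ∀ i, lab (A.args i) ∈ L}

section Product

variable {lab : K → Lab} {L : Idx → Set Lab} {B : Idx → Set (Atom S (Val K))}

open Classical in
/-- The element of a labelled product that stands for a labelled constant: the constant itself in
the factors in which its label takes part. -/
noncomputable def labelledConst (lab : K → Lab) (L : Idx → Set Lab) (c : K) :
    Lab × (Idx → Val K) :=
  (lab c, fun x => if lab c ∈ L x then .dom c else .fresh 0)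

theorem map_labelledConst_mem {A : Atom S K} (hA : A ∈ D) (hlab : ∃ ℓ, ∀ i, lab (A.args i) = ℓ)
    (hB : ∀ x, embedDB (labelRestrict lab D (L x)) ⊆ B x) :
    A.map (labelledConst lab L) ∈ labelledProduct L B (.fresh 0) := by
  obtain ⟨ℓ, hℓ⟩ := hlab
  refine ⟨ℓ, hℓ, fun x => ⟨fun hx => ?_, fun hx i => if_neg (hℓ i ▸ hx)⟩⟩
  refine hB x ⟨A, ⟨hA, fun i => hℓ i ▸ hx⟩, ?_⟩
  rw [Atom.map_map]
  exact Atom.map_congr fun i => (if_pos (hℓ i ▸ hx)).symm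

theorem mem_answers_of_labelledProduct {q : CQ S V K n} {t : Fin n → K}
    {φ : DTerm V K → Lab × (Idx → Val K)} (hconst : ∀ c, φ (.const c) = labelledConst lab L c)
    (hhead : ∀ i, φ (.var (q.head i)) = labelledConst lab L (t i)) {x : Idx}
    (hbody : ∀ A ∈ q.body, ∃ ℓ ∈ L x, (∀ i, (φ (A.args i)).1 = ℓ) ∧
      A.map (fun u => (φ u).2 x) ∈ B x) :
    (fun i => .dom (t i)) ∈ q.answers (B x) := by
  have hval {A} (hA : A ∈ q.body) (i : Fin (S.arity A.pred)) {c : K}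
      (hc : φ (A.args i) = labelledConst lab L c) : (φ (A.args i)).2 x = .dom c := by
    obtain ⟨ℓ, hℓ, hfst, -⟩ := hbody A hA
    obtain rfl : lab c = ℓ := by rw [← hfst i, hc]; rfl
    rw [hc]
    exact if_pos hℓ
  refine ⟨fun v => (φ (.var v)).2 x, fun A hA => ?_, funext fun i => ?_⟩
  · obtain ⟨_, _, _, hmem⟩ := hbody A hA
    convert hmem using 1
    refine Atom.map_congr fun i => ?_
    cases hu : A.args i with
    | var v => rfl
    | const c => exact ((congrArg (fun u => (φ u).2 x) hu).symm.trans
        (hval hA i (hu ▸ hconst c))).symm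
  · obtain ⟨A, hA, j, hj⟩ := q.safe i
    exact ((congrArg (fun u => (φ u).2 x) hj).symm.trans (hval hA j (hj ▸ hhead i))).symm

end Product

-- One chase of `D` maps into the labelled product of all models of all restrictions of `D`; the
-- labels of the images of the atoms of the query select the restriction.
theorem exists_labelRestrict [Finite S.Pred] [Nonempty Lab] (hI : UnaryOrFull I)
    (hJ : ∀ κ ∈ J, κ.key.Nonempty) {ord : ChaseOrder S K} (hD : D.Finite)
    (hex : ChaseExists ord I J D) {q : CQ S V K n} {t : Fin n → K}
    (ht : t ∈ certainAnswers I J q D) {lab : K → Lab}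
    (hlab : ∀ A ∈ D, ∃ ℓ, ∀ i, lab (A.args i) = ℓ) :
    ∃ L : Finset Lab, L.card ≤ q.body.length ∧
      t ∈ certainAnswers I J q (labelRestrict lab D L) := by
  classical
  obtain ⟨m, g, hgt, hg⟩ := exists_chaseSeq_match hI hD hex ht
  let Model := {x : Set Lab × Set (Atom S (Val K)) //
    (∀ σ ∈ I, σ.Sat x.2) ∧ (∀ κ ∈ J, κ.Sat x.2) ∧ embedDB (labelRestrict lab D x.1) ⊆ x.2}
  let L₀ (x : Model) : Set Lab := x.1.1
  have hι (A) (hA : A ∈ D) : A.map (labelledConst lab L₀) ∈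
      labelledProduct L₀ (fun x => x.1.2) (.fresh 0) :=
    map_labelledConst_mem hA (hlab A hA) fun x => x.2.2.2
  have : Nonempty (Val K) := ⟨.fresh 0⟩
  obtain ⟨h, hh⟩ := exists_isHomUpTo_of_sat
    (fun σ hσ => σ.sat_labelledProduct fun x => x.2.1 σ hσ)
    (fun κ hκ => κ.sat_labelledProduct (hJ κ hκ) fun x => x.2.2.1 κ hκ) hI.injective hι
    (chaseSeq_reachable (ord := ord) (I := I) (J := J) (D := D) m)
  have hbody (A) (hA : A ∈ q.body) := hh.map_mem (hg A hA)
  choose ℓ hℓ hmem using hbody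
  let L : Finset Lab := (q.body.attach.map fun A => ℓ A.1 A.2).toFinset
  refine ⟨L, (List.toFinset_card_le _).trans_eq ?_, fun B hBI hBJ hDB => ?_⟩
  · rw [List.length_map, List.length_attach]
  · let x : Model := ⟨(L, B), hBI, hBJ, hDB⟩
    have hℓL (A) (hA : A ∈ q.body) : ℓ A hA ∈ L :=
      List.mem_toFinset.2 (List.mem_map.2 ⟨⟨A, hA⟩, List.mem_attach _ _, rfl⟩)
    refine mem_answers_of_labelledProduct (B := fun x : Model => x.1.2) (x := x) (L := L₀)
      (lab := lab) (φ := fun u => h (u.value g)) hh.map_dom (fun i => ?_) fun A hA =>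
      ⟨ℓ A hA, hℓL A hA, hℓ A hA, ?_⟩
    · exact (congrArg h (hgt i)).trans (hh.map_dom (t i))
    · exact (hmem A hA x).1 (hℓL A hA)

section Component

open Classical in
/-- The connected component of the join graph to which a constant belongs, if it occurs in `D`. -/
noncomputable def constComponent (D : Set (Atom S K)) (c : K) :
    Option (joinGraph D).ConnectedComponent :=
  if h : ∃ A : D, ∃ i, A.1.args i = c then some ((joinGraph D).connectedComponentMk h.choose)
  else none

theorem constComponent_args (A : D) (i : Fin (S.arity A.1.pred)) :
    constComponent D (A.1.args i) = some ((joinGraph D).connectedComponentMk A) := by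
  have h : ∃ A' : D, ∃ j, A'.1.args j = A.1.args i := ⟨A, i, rfl⟩
  rw [constComponent, dif_pos h]
  refine congrArg some (SimpleGraph.ConnectedComponent.eq.2 ?_)
  obtain ⟨j, hj⟩ := h.choose_spec
  by_cases hne : h.choose = A
  · rw [hne]
  · exact SimpleGraph.Adj.reachable ⟨hne, j, i, hj⟩

theorem ncard_supp_le_largestConnectedSize (hD : D.Finite)
    (c : (joinGraph D).ConnectedComponent) : c.supp.ncard ≤ largestConnectedSize D := by
  have : Finite D := hD
  have : Finite (joinGraph D).ConnectedComponent := Quot.finite _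
  exact le_ciSup (f := fun c : (joinGraph D).ConnectedComponent => c.supp.ncard)
    (Set.finite_range _).bddAbove c

theorem ncard_labelRestrict_constComponent_le (hS : ∀ p, 0 < S.arity p) (hD : D.Finite)
    (L : Finset (Option (joinGraph D).ConnectedComponent)) :
    (labelRestrict (constComponent D) D L).ncard ≤ largestConnectedSize D * L.card := by
  classical
  let f (A : Atom S K) := constComponent D (A.args ⟨0, hS A.pred⟩)
  have hfin : (labelRestrict (constComponent D) D L).Finite := hD.subset fun _ hA => hA.1
  have hfiber (ℓ) : {A | A ∈ D ∧ f A = ℓ}.ncard ≤ largestConnectedSize D := by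
    rcases Set.eq_empty_or_nonempty {A | A ∈ D ∧ f A = ℓ} with h | ⟨A₀, hA₀, rfl⟩
    · exact h ▸ Set.ncard_empty _ ▸ Nat.zero_le _
    have hsub : {A | A ∈ D ∧ f A = f A₀} ⊆
        Subtype.val '' ((joinGraph D).connectedComponentMk ⟨A₀, hA₀⟩).supp := fun A ⟨hA, hf⟩ =>
      ⟨⟨A, hA⟩, Option.some_injective _
        ((constComponent_args ⟨A, hA⟩ _).symm.trans (hf.trans (constComponent_args ⟨A₀, hA₀⟩ _))),
        rfl⟩
    have : Finite D := hD
    exact (Set.ncard_le_ncard hsub (Set.toFinite _)).trans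
      ((Set.ncard_image_le (Set.toFinite _)).trans (ncard_supp_le_largestConnectedSize hD _))
  rw [Set.ncard_eq_toFinset_card _ hfin]
  refine Finset.card_le_mul_card_image_of_maps_to (f := f)
    (fun A hA => (hfin.mem_toFinset.1 hA).2 _) _ fun ℓ _ => (hfiber ℓ).trans' ?_
  rw [← Set.ncard_coe_finset]
  refine Set.ncard_le_ncard (fun A hA => ?_) (hD.subset fun _ hA => hA.1)
  have hA := Finset.mem_filter.1 (Finset.mem_coe.1 hA)
  exact ⟨(hfin.mem_toFinset.1 hA.1).1, hA.2⟩

end Component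

end Locality

/-! ## Renaming constants -/

section Renaming

variable {S : RelSchema} {V W K : Type*} {n : ℕ} {f : K → K}

/-- The constants of a query. -/
def CQ.constants (q : CQ S V K n) : Set K := {c | ∃ A ∈ q.body, ∃ i, A.args i = .const c}

theorem CQ.finite_constants (q : CQ S V K n) : q.constants.Finite := by
  have hinj : Function.Injective (DTerm.const : K → DTerm V K) := fun _ _ h => DTerm.const.inj h
  exact (finite_activeValues q.body.finite_toSet).preimage (f := DTerm.const) hinj.injOn

section Programs

/-- `f` fixes the constants of the term `u`. -/
def DTerm.FixedBy (f : K → K) (u : DTerm W K) : Prop := ∀ c, u = .const c → f c = c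

/-- `f` fixes the constants of the atom `A`. -/
def Atom.FixedBy (f : K → K) (A : Atom S (DTerm W K)) : Prop := ∀ i, (A.args i).FixedBy f

/-- `f` fixes the constants of the rule `ρ`. -/
def Rule.FixedBy (f : K → K) (ρ : Rule S W K) : Prop :=
  ρ.head.FixedBy f ∧ ∀ A ∈ ρ.body, A.FixedBy f

theorem DTerm.fixedBy_var (x : W) : (DTerm.var x : DTerm W K).FixedBy f := fun _ h => by cases h

theorem Atom.FixedBy.map_eval {A : Atom S (DTerm W K)} (hA : A.FixedBy f) (θ : W → K) :
    (A.map (DTerm.eval θ)).map f = A.map (DTerm.eval (f ∘ θ)) := by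
  rw [Atom.map_map]
  refine Atom.map_congr fun i => ?_
  cases hu : A.args i with
  | var x => rfl
  | const c => exact hA i c hu

theorem LeastModel.map {P : Set (Rule S W K)} {D : Set (Atom S K)} (hP : ∀ ρ ∈ P, ρ.FixedBy f)
    {A : Atom S K} (hA : LeastModel P D A) : LeastModel P (Atom.map f '' D) (A.map f) := by
  induction hA with
  | fact A hA => exact .fact _ ⟨A, hA, rfl⟩
  | rule ρ θ hρ _ ih =>
    obtain ⟨hhead, hbody⟩ := hP ρ hρ
    rw [hhead.map_eval]
    exact .rule ρ _ hρ fun A hA => (hbody A hA).map_eval θ ▸ ih A hA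

theorem LeastModel.mono {P : Set (Rule S W K)} {D D' : Set (Atom S K)} (hD : D ⊆ D')
    {A : Atom S K} (hA : LeastModel P D A) : LeastModel P D' A := by
  induction hA with
  | fact A hA => exact .fact A (hD hA)
  | rule ρ θ hρ _ ih => exact .rule ρ θ hρ ih

theorem evalProgram_mono {P : Set (Rule (annSchema S n) W K)} {D D' : Set (Atom S K)}
    (hD : D ⊆ D') : evalProgram P D ⊆ evalProgram P D' :=
  fun _ ht => LeastModel.mono (Set.image_mono hD) ht

theorem mem_evalProgram_map {P : Set (Rule (annSchema S n) W K)} (hP : ∀ ρ ∈ P, ρ.FixedBy f)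
    {D : Set (Atom S K)} {t : Fin n → K} (ht : t ∈ evalProgram P D) :
    f ∘ t ∈ evalProgram P (Atom.map f '' D) := by
  have himage : plainFacts n (Atom.map f '' D) = Atom.map f '' plainFacts n D := by
    simp only [plainFacts, Set.image_image]
    rfl
  unfold evalProgram
  rw [himage]
  exact LeastModel.map hP ht

end Programs

section Rewriting

theorem fixedBy_eqAtom {u u' : DTerm W K} (hu : u.FixedBy f) (hu' : u'.FixedBy f) :
    (eqAtom S n u u').FixedBy f := by
  intro i
  change Fin 2 at i
  fin_cases i
  exacts [hu, hu']

theorem fixedBy_relAtom {p : S.Pred} {u : Fin (S.arity p) → DTerm W K}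
    (hu : ∀ i, (u i).FixedBy f) : (relAtom n p u).FixedBy f := hu

theorem fixedBy_nv (k i : ℕ) : (nv S V K k i).FixedBy f := DTerm.fixedBy_var _

theorem Rule.FixedBy.annotate {ρ : Rule (baseSchema S n) W K} (hρ : ρ.FixedBy f)
    (α : W → Ann S) : (ρ.annotate α).FixedBy f :=
  ⟨hρ.1, List.forall_mem_map.2 hρ.2⟩

theorem fixedBy_of_isKDRule {J : Set (KeyDep S)} {ρ : Rule (baseSchema S n) (RVar S V) K}
    (hρ : IsKDRule J ρ) : ρ.FixedBy f := by
  obtain ⟨κ, k, i, -, -, -⟩ := hρ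
  refine ⟨fixedBy_eqAtom (fixedBy_nv _ _) (fixedBy_nv _ _), ?_⟩
  rw [List.forall_mem_cons, List.forall_mem_cons, List.forall_mem_singleton]
  exact ⟨fixedBy_relAtom fun _ => fixedBy_nv _ _, fixedBy_relAtom fun _ => fixedBy_nv _ _,
    fixedBy_eqAtom (fixedBy_nv _ _) (fixedBy_nv _ _)⟩

theorem fixedBy_of_isEqRule {ρ : Rule (baseSchema S n) (RVar S V) K} (hρ : IsEqRule ρ) :
    ρ.FixedBy f := by
  have heq (k i k' i' : ℕ) : (eqAtom S n (nv S V K k i) (nv S V K k' i')).FixedBy f :=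
    fixedBy_eqAtom (fixedBy_nv _ _) (fixedBy_nv _ _)
  cases hρ with
  | refl p i =>
    exact ⟨heq _ _ _ _, List.forall_mem_singleton.2 <| fixedBy_relAtom fun _ => fixedBy_nv _ _⟩
  | symm => exact ⟨heq _ _ _ _, List.forall_mem_singleton.2 <| heq _ _ _ _⟩
  | trans =>
    exact ⟨heq _ _ _ _, List.forall_mem_cons.2
      ⟨heq _ _ _ _, List.forall_mem_singleton.2 <| heq _ _ _ _⟩⟩

theorem CQ.fixedBy_maquillage {q : CQ S V K n} (hf : ∀ c ∈ q.constants, f c = c) :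
    q.maquillage.FixedBy f := by
  refine ⟨fun i => DTerm.fixedBy_var _, List.forall_mem_flatMap.2 fun ⟨A, a⟩ hA => ?_⟩
  have hAq : A ∈ q.body := List.mem_of_getElem? (List.mem_zipIdx_iff_getElem?.1 hA)
  refine List.forall_mem_cons.2 ⟨fixedBy_relAtom fun _ => fixedBy_nv _ _,
    List.forall_mem_map.2 fun i _ => fixedBy_eqAtom (fixedBy_nv _ _) fun c hc => ?_⟩
  refine hf c ⟨A, hAq, i, ?_⟩
  cases hu : A.args i with
  | var x => rw [hu] at hc; cases hc
  | const d => rw [hu] at hc; cases hc; rfl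

theorem fixedBy_of_mem_finProgram {ord : ChaseOrder S (DummyConst S)} {I : Set (IncDep S)}
    {J : Set (KeyDep S)} {q : CQ S V K n} {N : ℕ} (hf : ∀ c ∈ q.constants, f c = c)
    {ρ : Rule (annSchema S n) (RVar S V) K} (hρ : ρ ∈ finProgram ord I J q N) :
    ρ.FixedBy f := by
  rcases hρ with (hρ | hρ) | ⟨ρ₀, α, hρ₀, -, rfl⟩
  · obtain ⟨st, σ, t, a₁, a₂, -, -, -, -⟩ := hρ
    exact ⟨fun i => DTerm.fixedBy_var _,
      List.forall_mem_singleton.2 fun i => DTerm.fixedBy_var _⟩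
  · obtain ⟨b, -⟩ := hρ
    exact ⟨fun i => fixedBy_nv _ _, List.forall_mem_singleton.2 fun i => fixedBy_nv _ _⟩
  · refine Rule.FixedBy.annotate ?_ α
    rcases hρ₀ with hρ₀ | hρ₀ | rfl
    exacts [fixedBy_of_isKDRule hρ₀, fixedBy_of_isEqRule hρ₀, CQ.fixedBy_maquillage hf]

end Rewriting

section Chase

variable {I : Set (IncDep S)} {J : Set (KeyDep S)} {ord : ChaseOrder S K} {D D' : Set (Atom S K)}

theorem chaseExists_of_subset [Finite S.Pred] (hY : ∀ σ ∈ I, Function.Injective σ.Y)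
    (hD : D.Finite) (hex : ChaseExists ord I J D) (hsub : D' ⊆ D) : ChaseExists ord I J D' := by
  obtain ⟨B, hBI, hBJ, hDB, -⟩ := exists_chase_model hY hD hex
  have : Nonempty (Val K) := ⟨.fresh 0⟩
  exact chaseExists_of_sat hBI hBJ hY (fun A hA => hDB ⟨A, hsub hA, rfl⟩) fun _ _ => Val.dom.inj

theorem chaseExists_map [Finite S.Pred] (hY : ∀ σ ∈ I, Function.Injective σ.Y) (hD : D.Finite)
    (hex : ChaseExists ord I J D) (π : Equiv.Perm K) :
    ChaseExists ord I J (Atom.map π '' D) := by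
  obtain ⟨B, hBI, hBJ, hDB, -⟩ := exists_chase_model hY hD hex
  have : Nonempty (Val K) := ⟨.fresh 0⟩
  refine chaseExists_of_sat (ι := Val.dom ∘ π.symm) hBI hBJ hY ?_
    (.comp (fun _ _ => Val.dom.inj) π.symm.injective)
  rintro _ ⟨A, hA, rfl⟩
  refine hDB ⟨A, hA, ?_⟩
  rw [Atom.map_map]
  exact Atom.map_congr fun i => congrArg Val.dom (π.symm_apply_apply (A.args i)).symm

theorem mem_certainAnswers_map [Finite S.Pred] (hI : UnaryOrFull I) (hD : D.Finite)
    (hex : ChaseExists ord I J D) {q : CQ S V K n} (hf : ∀ c ∈ q.constants, f c = c)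
    {t : Fin n → K} (ht : t ∈ certainAnswers I J q D) :
    f ∘ t ∈ certainAnswers I J q (Atom.map f '' D) := by
  obtain ⟨m, g, hgt, hg⟩ := exists_chaseSeq_match hI hD hex ht
  intro B hBI hBJ hDB
  have : Nonempty (Val K) := ⟨.fresh 0⟩
  obtain ⟨h, hh⟩ := exists_isHomUpTo_of_sat (ι := Val.dom ∘ f) hBI hBJ hI.injective
    (fun A hA => hDB ⟨_, ⟨A, hA, rfl⟩, rfl⟩)
    (chaseSeq_reachable (ord := ord) (I := I) (J := J) (D := D) m)
  refine ⟨h ∘ g, fun A hA => ?_, funext fun i => ?_⟩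
  · convert hh.map_mem (hg A hA) using 1
    rw [Atom.map_map]
    refine Atom.map_congr fun i => ?_
    cases hu : A.args i with
    | var x => rfl
    | const c => exact ((hh.map_dom c).trans (congrArg Val.dom (hf c ⟨A, hA, i, hu⟩))).symm
  · exact ((congrArg h (hgt i)).trans (hh.map_dom (t i))).symm

end Chase

section Absorbing

open scoped Pointwise in
theorem exists_finset_forall_perm_mapsTo (α : Type*) (m : ℕ) :
    ∃ P : Finset α, ∀ X : Set α, X.Finite → X.ncard ≤ m →
      ∃ π : Equiv.Perm α, Set.MapsTo π X P := by
  classical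
  rcases finite_or_infinite α with hα | hα
  · have := Fintype.ofFinite α
    exact ⟨Finset.univ, fun X _ _ => ⟨1, fun _ _ => Finset.mem_coe.2 (Finset.mem_univ _)⟩⟩
  obtain ⟨P, hP⟩ := Infinite.exists_subset_card_eq α m
  refine ⟨P, fun X hX hXm => ?_⟩
  rw [Set.ncard_eq_toFinset_card X hX] at hXm
  obtain ⟨X', hXX', hX'⟩ := Infinite.exists_superset_card_eq hX.toFinset m hXm
  have := Set.powersetCard.isPretransitive (α := α) (n := m)
  obtain ⟨π, hπ⟩ := MulAction.exists_smul_eq (Equiv.Perm α) (⟨X', hX'⟩ : Set.powersetCard α m)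
    ⟨P, hP⟩
  refine ⟨π, fun c hc => ?_⟩
  have hπX' : π • X' = P := congrArg Subtype.val hπ
  rw [← hπX']
  exact Finset.mem_coe.2 (Finset.smul_mem_smul_finset (hXX' (hX.mem_toFinset.2 hc)))

theorem exists_finite_forall_perm_mapsTo {Q : Set K} (hQ : Q.Finite) (m : ℕ) :
    ∃ P : Set K, P.Finite ∧ ∀ X : Set K, X.Finite → X.ncard ≤ m →
      ∃ π : Equiv.Perm K, (∀ c ∈ Q, π c = c) ∧ Set.MapsTo π X P := by
  classical
  obtain ⟨P, hP⟩ := exists_finset_forall_perm_mapsTo {c // c ∉ Q} m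
  refine ⟨Q ∪ Subtype.val '' (P : Set {c // c ∉ Q}), hQ.union (P.finite_toSet.image _),
    fun X hX hXm => ?_⟩
  have hval : Function.Injective (Subtype.val : {c // c ∉ Q} → K) := Subtype.val_injective
  obtain ⟨π, hπ⟩ := hP (Subtype.val ⁻¹' X) (hX.preimage hval.injOn)
    ((Set.ncard_le_ncard_of_injOn Subtype.val (fun _ hc => hc) hval.injOn hX).trans hXm)
  have hfix {c} (hc : c ∈ Q) : Equiv.Perm.ofSubtype π c = c :=
    Equiv.Perm.ofSubtype_apply_of_not_mem π (not_not.2 hc)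
  refine ⟨Equiv.Perm.ofSubtype π, fun c => hfix, fun c hc => ?_⟩
  by_cases hcQ : c ∈ Q
  · exact .inl ((hfix hcQ).symm ▸ hcQ)
  · rw [Equiv.Perm.ofSubtype_apply_of_mem π hcQ]
    exact .inr ⟨_, hπ hc, rfl⟩

end Absorbing

theorem ncard_activeValues_le {F : Set (Atom S K)} (hF : F.Finite) {a : ℕ}
    (ha : ∀ p, S.arity p ≤ a) : (activeValues F).ncard ≤ F.ncard * a := by
  classical
  have hunion : activeValues F =
      (hF.toFinset.biUnion fun A => Finset.univ.image A.args : Finset K) := by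
    ext v; simp [activeValues]
  rw [hunion, Set.ncard_coe_finset, Set.ncard_eq_toFinset_card _ hF]
  refine Finset.card_biUnion_le_card_mul _ _ _ fun A _ => Finset.card_image_le.trans ?_
  rw [Finset.card_univ, Fintype.card_fin]
  exact ha A.pred

end Renaming

/-! ## The bound on the levels of the dummy chase -/

section Bound

open Filter

variable {S : RelSchema} {V K : Type*} {n : ℕ} {I : Set (IncDep S)} {J : Set (KeyDep S)}
  [Finite S.Pred] [Nonempty K]

theorem eventually_mem_evalProgram_of_args_mem (hI : UnaryOrFull I) (hS : ∀ p, 0 < S.arity p)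
    (hJ : ∀ κ ∈ J, ∃ k, κ.key = {k}) (q : CQ S V K n) {P : Set K} (hP : P.Finite) :
    ∀ᶠ N in atTop, ∀ (ordB : ChaseOrder S (DummyConst S)) (ord : ChaseOrder S K)
      (D : Set (Atom S K)) (t : Fin n → K), (∀ A ∈ D, ∀ i, A.args i ∈ P) → (∀ i, t i ∈ P) →
      ChaseExists ord I J D → t ∈ certainAnswers I J q D →
        t ∈ evalProgram (finProgram ordB I J q N) D := by
  have hatoms := finite_setOf_forall_args_mem (S := S) hP
  have hfin : (𝒫 {A : Atom S K | ∀ i, A.args i ∈ P} ×ˢ {t : Fin n → K | ∀ i, t i ∈ P}).Finite :=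
    hatoms.finite_subsets.prod (Set.Finite.pi' fun _ => hP)
  have hpair : ∀ z ∈ 𝒫 {A : Atom S K | ∀ i, A.args i ∈ P} ×ˢ {t : Fin n → K | ∀ i, t i ∈ P},
      ∀ᶠ N in atTop, ∀ ord : ChaseOrder S K, ChaseExists ord I J z.1 →
        z.2 ∈ certainAnswers I J q z.1 → ∀ ordB : ChaseOrder S (DummyConst S),
          z.2 ∈ evalProgram (finProgram ordB I J q N) z.1 := by
    rintro ⟨D, t⟩ ⟨hD, -⟩
    by_cases h : (∃ ord : ChaseOrder S K, ChaseExists ord I J D) ∧ t ∈ certainAnswers I J q D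
    · obtain ⟨⟨ord, hex⟩, ht⟩ := h
      filter_upwards [eventually_mem_evalProgram hI hS hJ (hatoms.subset hD) hex ht]
        with N hN _ _ _ using hN
    · exact .of_forall fun N ord hex ht => absurd ⟨⟨ord, hex⟩, ht⟩ h
  filter_upwards [(eventually_all_finite hfin).2 hpair] with N hN ordB ord D t hD ht hex hcert
    using hN (D, t) ⟨hD, ht⟩ ord hex hcert ordB

theorem eventually_certainAnswers_subset_of_ncard_le (hI : UnaryOrFull I)
    (hS : ∀ p, 0 < S.arity p) (hJ : ∀ κ ∈ J, ∃ k, κ.key = {k}) (q : CQ S V K n) (m : ℕ) :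
    ∀ᶠ N in atTop, ∀ (ordB : ChaseOrder S (DummyConst S)) (ord : ChaseOrder S K)
      (D : Set (Atom S K)), D.Finite → D.ncard ≤ m → ChaseExists ord I J D →
        certainAnswers I J q D ⊆ evalProgram (finProgram ordB I J q N) D := by
  obtain ⟨a, ha⟩ := Finite.exists_le S.arity
  obtain ⟨P, hP, hπ⟩ := exists_finite_forall_perm_mapsTo q.finite_constants (m * a + n)
  filter_upwards [eventually_mem_evalProgram_of_args_mem hI hS hJ q hP]
    with N hN ordB ord D hD hDm hex t ht
  have hvalues : (activeValues D ∪ Set.range t).ncard ≤ m * a + n := by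
    refine (Set.ncard_union_le _ _).trans (Nat.add_le_add ?_ ?_)
    · exact (ncard_activeValues_le hD ha).trans (Nat.mul_le_mul_right a hDm)
    · rw [← Set.image_univ]
      exact (Set.ncard_image_le Set.finite_univ).trans_eq (by
        rw [Set.ncard_univ, Nat.card_eq_fintype_card, Fintype.card_fin])
  obtain ⟨π, hπq, hπP⟩ := hπ _ ((finite_activeValues hD).union (Set.finite_range t)) hvalues
  have heval : π ∘ t ∈ evalProgram (finProgram ordB I J q N) (Atom.map π '' D) := by
    refine hN ordB ord _ _ ?_ (fun i => hπP (.inr ⟨i, rfl⟩)) (chaseExists_map hI.injective hD hex π)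
      (mem_certainAnswers_map hI hD hex hπq ht)
    rintro _ ⟨A, hA, rfl⟩ i
    exact hπP (.inl ⟨A, hA, i, rfl⟩)
  have hπq' (c) (hc : c ∈ q.constants) : π.symm c = c := (π.symm_apply_eq).2 (hπq c hc).symm
  have hDD : Atom.map π.symm '' (Atom.map π '' D) = D := by
    rw [Set.image_image]
    refine (Set.image_congr' fun A => ?_).trans (Set.image_id D)
    rw [Atom.map_map]
    exact Atom.map_eq_self fun i => π.symm_apply_apply (A.args i)
  have htt : π.symm ∘ π ∘ t = t := funext fun i => π.symm_apply_apply (t i)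
  rw [← hDD, ← htt]
  exact mem_evalProgram_map (fun ρ => fixedBy_of_mem_finProgram hπq') heval

theorem eventually_certainAnswers_subset (hI : UnaryOrFull I) (hS : ∀ p, 0 < S.arity p)
    (hJ : ∀ κ ∈ J, ∃ k, κ.key = {k}) (q : CQ S V K n) (k : ℕ) :
    ∀ᶠ N in atTop, ∀ (ordB : ChaseOrder S (DummyConst S)) (ord : ChaseOrder S K)
      (D : Set (Atom S K)), D.Finite → ChaseExists ord I J D → largestConnectedSize D ≤ k →
        certainAnswers I J q D ⊆ evalProgram (finProgram ordB I J q N) D := by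
  filter_upwards [eventually_certainAnswers_subset_of_ncard_le hI hS hJ q (k * q.body.length)]
    with N hN ordB ord D hD hex hk t ht
  have hkey (κ) (hκ : κ ∈ J) : κ.key.Nonempty := by
    obtain ⟨k, hk⟩ := hJ κ hκ
    exact ⟨k, hk ▸ rfl⟩
  obtain ⟨L, hL, htL⟩ := exists_labelRestrict hI hkey hD hex ht (lab := constComponent D)
    fun A hA => ⟨_, constComponent_args ⟨A, hA⟩⟩
  have hsub : labelRestrict (constComponent D) D L ⊆ D := fun _ hA => hA.1
  exact evalProgram_mono hsub <| hN ordB ord _ (hD.subset hsub)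
    ((ncard_labelRestrict_constComponent_le hS hD L).trans (Nat.mul_le_mul hk hL))
    (chaseExists_of_subset hI.injective hD hex hsub) htL

end Bound

/-! ## Conceptual dependencies -/

section Conceptual

variable {Ent Rel : Type*} (C : EERSchema Ent Rel)

theorem EERSchema.arity_pos : ∀ p, 0 < C.schema.arity p
  | .inl _ => Nat.one_pos
  | .inr R => Nat.zero_lt_two.trans_le (C.two_le_arity R)

theorem EERSchema.unaryOrFull_ids : UnaryOrFull C.ids where
  injective := by
    rintro σ (⟨E, E', -⟩ | ⟨R, i⟩ | ⟨R, R', j, -⟩ | ⟨R, c, -⟩)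
    case isaRel => exact j.injective
    all_goals exact fun (a b : Fin 1) _ => Subsingleton.elim a b
  width_pos := by
    rintro σ (⟨E, E', -⟩ | ⟨R, i⟩ | ⟨R, R', j, -⟩ | ⟨R, c, -⟩)
    case isaRel => exact C.arity_pos (.inr R)
    all_goals exact Nat.one_pos
  unary_or_surjective := by
    rintro σ (⟨E, E', -⟩ | ⟨R, i⟩ | ⟨R, R', j, -⟩ | ⟨R, c, -⟩)
    case isaRel => exact .inr j.surjective
    all_goals exact .inl rfl

theorem EERSchema.exists_key_eq_singleton {κ : KeyDep C.schema} (hκ : κ ∈ C.kds) :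
    ∃ k, κ.key = {k} := by
  obtain ⟨R, c, -⟩ := hκ
  exact ⟨c, rfl⟩

end Conceptual

theorem mainTheorem1_general {S : RelSchema} [Finite S.Pred] (hS : ∀ p, 0 < S.arity p)
    {K V : Type*} [Nonempty K] {I : Set (IncDep S)} (hI : UnaryOrFull I) {J : Set (KeyDep S)}
    (hJ : ∀ κ ∈ J, ∃ k, κ.key = {k}) {n : ℕ} (q : CQ S V K n) :
    ∃ δ : ℕ → ℕ,
      ∀ (ordB : ChaseOrder S (DummyConst S)) (ord : ChaseOrder S K) (D : Set (Atom S K)),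
        D.Finite → ChaseExists ord I J D → ∀ N, δ (largestConnectedSize D) ≤ N →
          evalProgram (finProgram ordB I J q N) D = certainAnswers I J q D := by
  choose δ hδ using fun k => Filter.eventually_atTop.1 <|
    eventually_certainAnswers_subset hI hS hJ q k
  refine ⟨δ, fun ordB ord D hD hex N hN => Set.Subset.antisymm ?_ ?_⟩
  · exact evalProgram_subset_certainAnswers hI ordB J q N D
  · exact hδ _ N hN ordB ord D hD hex le_rfl

theorem mainTheorem1 {Ent Rel Dom V : Type*} [Finite Ent] [Finite Rel] [Infinite Dom]
    (C : EERSchema Ent Rel) {n : ℕ} (q : CQ C.schema V Dom n) :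
    ∃ δ : ℕ → ℕ,
      ∀ (ordB : ChaseOrder C.schema (DummyConst C.schema)) (ord : ChaseOrder C.schema Dom)
        (D : Set (Atom C.schema Dom)), D.Finite → ChaseExists ord C.ids C.kds D →
      ∀ N, δ (largestConnectedSize D) ≤ N →
        evalProgram (finProgram ordB C.ids C.kds q N) D = certainAnswers C.ids C.kds q D :=
  have : Finite C.schema.Pred := inferInstanceAs (Finite (Ent ⊕ Rel))
  mainTheorem1_general C.arity_pos C.unaryOrFull_ids (fun _ => C.exists_key_eq_singleton) q
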